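/- Let $K$ be an algebraically closed field of characteristic $2$. Let $(Q,f)$ be a triangulation quiver with at least three vertices: $Q=(Q_0,Q_1,s,t)$ is a finite connected quiver in which every vertex is the source of exactly two arrows and the target of exactly two arrows, and $f$ is a permutation of $Q_1$ with $s(f(\alpha))=t(\alpha)$ for all $\alpha\in Q_1$ and $f^3=\mathrm{id}$. For an arrow $\alpha$ let $\bar\alpha\neq\alpha$ be the other arrow with $s(\bar\alpha)=s(\alpha)$, put $g(\alpha)=\overline{f(\alpha)}$, let $\mathcal O(g)$ be the set of $g$-orbits in $Q_1$, and let $n_\alpha$ be the size of the $g$-orbit of $\alpha$. The border $\partial(Q,f)$ is the set of vertices $i$ carrying a loop $\alpha$ with $f(\alpha)=\alpha$ (a border loop); assume that it is non-empty. Let $m_\bullet:\mathcal O(g)\to\mathbb N\setminus\{0\}$, $c_\bullet:\mathcal O(g)\to K\setminus\{0\}$ and $b_\bullet:\partial(Q,f)\to K$ be functions with $m_\alpha n_\alpha\ge 3$ for every arrow $\alpha$ and with $b_\bullet$ not identically zero, where $m_\alpha$ and $c_\alpha$ denote the values at the $g$-orbit of $\alpha$. Let $A_\alpha$ and $B_\alpha$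 be the paths $\alpha\, g(\alpha)\, g^2(\alpha)\cdots$ along the $g$-orbit of $\alpha$ of lengths $m_\alpha n_\alpha-1$ and $m_\alpha n_\alpha$, respectively. The socle deformed weighted triangulation algebra $\bar\Lambda=\Lambda(Q,f,m_\bullet,c_\bullet,b_\bullet)$ is the quotient of the path algebra $KQ$ (paths composed from left to right) by the two-sided ideal generated by 1. $\alpha f(\alpha)-c_{\bar\alpha}A_{\bar\alpha}$ for all arrows $\alpha$ that are not border loops, 2. $\alpha^2-c_{\bar\alpha}A_{\bar\alpha}-b_{s(\alpha)}B_{\bar\alpha}$ for all border loops $\alpha$, 3. $\beta f(\beta)g(f(\beta))$ for all arrows $\beta$. Let $\bar\Lambda^e=\bar\Lambda^{\mathrm{op}}\otimes_K\bar\Lambda$ be the enveloping algebra, whose right modules are the $\bar\Lambda$-$\bar\Lambda$-bimodules on which $K$ acts centrally, and let $\Omega_{\bar\Lambda^e}(M)$ denote the kernel of a projective cover of a finitely generated module $M$. **Theorem.** There is an isomorphism of bimodules $\Omega^4_{\bar\Lambda^e}(\bar\Lambda)\cong\bar\Lambda$. In particular, $\bar\Lambda$ is a periodic algebra of period $4$: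 it is finite-dimensional over $K$, and $4$ is the least integer $n\ge 1$ with $\Omega^n_{\bar\Lambda^e}(\bar\Lambda)\cong\bar\Lambda$. -/

import Mathlib

open scoped TensorProduct

/-! ### Quivers and path algebras -/

/-- A quiver with vertex set `V` and arrow set `A`, given by its source and target maps. -/
structure ArrowQuiver (V A : Type*) where
  /-- the source of an arrow -/
  src : A → V
  /-- the target of an arrow -/
  tgt : A → V

namespace ArrowQuiver

variable {V A : Type*}

/-- Paths in a quiver, composed from left to right: `cons a p` is the arrow `a` followed by the
path `p`, and `nil i` is the trivial path at `i`. -/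
inductive Path (Q : ArrowQuiver V A) : V → V → Type _
  | nil (i : V) : Path Q i i
  | cons (a : A) {j : V} (p : Path Q (Q.tgt a) j) : Path Q (Q.src a) j

/-- Concatenation of paths (first `p`, then `q`). -/
def Path.comp {Q : ArrowQuiver V A} : {i j k : V} → Path Q i j → Path Q j k → Path Q i k
  | _, _, _, .nil _, q => q
  | _, _, _, .cons a p, q => .cons a (p.comp q)

theorem Path.comp_nil {Q : ArrowQuiver V A} {i j : V} (p : Path Q i j) :
    p.comp (.nil j) = p := by
  induction p with
  | nil i => rfl
  | cons a p ih => simp [Path.comp, ih]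

theorem Path.comp_assoc {Q : ArrowQuiver V A} {i j k l : V} (p : Path Q i j) (q : Path Q j k)
    (r : Path Q k l) : (p.comp q).comp r = p.comp (q.comp r) := by
  induction p with
  | nil i => rfl
  | cons a p ih => simp [Path.comp, ih]

/-- Transport of a path along an equality of sources. -/
def Path.castSrc {Q : ArrowQuiver V A} {i j k : V} (h : i = j) (p : Path Q j k) : Path Q i k :=
  h ▸ p

/-- All paths of the quiver, each recorded with its source and target. -/
structure AnyPath (Q : ArrowQuiver V A) where
  /-- the source -/
  src : V
  /-- the target -/
  tgt : V
  /-- the path -/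
  path : Path Q src tgt

/-- The quiver is connected: any two vertices are joined by an unoriented walk. -/
def Connected (Q : ArrowQuiver V A) : Prop :=
  ∀ i j : V, Relation.EqvGen (fun k l => ∃ a : A, Q.src a = k ∧ Q.tgt a = l) i j

end ArrowQuiver

section PathAlgebra

variable {V A : Type*}

/-- The path algebra `K Q`: the `K`-vector space with basis the set of all paths of `Q`. -/
def PathAlgebra (K : Type*) [Field K] (Q : ArrowQuiver V A) : Type _ := Q.AnyPath →₀ K

namespace PathAlgebra

noncomputable section

variable (K : Type*) [Field K] (Q : ArrowQuiver V A)

instance : AddCommGroup (PathAlgebra K Q) := inferInstanceAs (AddCommGroup (Q.AnyPath →₀ K))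

instance : Module K (PathAlgebra K Q) := inferInstanceAs (Module K (Q.AnyPath →₀ K))

/-- The basis element of the path algebra given by a path. -/
def ofPath {i j : V} (p : Q.Path i j) : PathAlgebra K Q := Finsupp.single ⟨i, j, p⟩ (1 : K)

open Classical in
/-- The product of two paths: their concatenation if the first ends where the second starts,
and zero otherwise. -/
def pathMul (p q : Q.AnyPath) : PathAlgebra K Q :=
  if h : p.tgt = q.src then ofPath K Q (p.path.comp (q.path.castSrc h)) else 0

/-- The multiplication of the path algebra, the bilinear extension of `pathMul`. -/
def mulLin : PathAlgebra K Q →ₗ[K] PathAlgebra K Q →ₗ[K] PathAlgebra K Q :=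
  Finsupp.linearCombination K
    (fun p => (Finsupp.linearCombination K (fun q => pathMul K Q p q) :
      PathAlgebra K Q →ₗ[K] PathAlgebra K Q))

instance : Mul (PathAlgebra K Q) := ⟨fun x y => mulLin K Q x y⟩

instance [Fintype V] : One (PathAlgebra K Q) := ⟨∑ i : V, ofPath K Q (.nil i)⟩

theorem mul_def (x y : PathAlgebra K Q) : x * y = mulLin K Q x y := rfl

theorem one_def [Fintype V] : (1 : PathAlgebra K Q) = ∑ i : V, ofPath K Q (.nil i) := rfl

theorem mulLin_ofPath {i j k l : V} (p : Q.Path i j) (q : Q.Path k l) :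
    mulLin K Q (ofPath K Q p) (ofPath K Q q) = pathMul K Q ⟨i, j, p⟩ ⟨k, l, q⟩ := by
  unfold mulLin ofPath
  erw [Finsupp.linearCombination_single, one_smul, Finsupp.linearCombination_single, one_smul]

theorem mulLin_ofPath_comp {i j l : V} (p : Q.Path i j) (q : Q.Path j l) :
    mulLin K Q (ofPath K Q p) (ofPath K Q q) = ofPath K Q (p.comp q) := by
  rw [mulLin_ofPath]; simp [pathMul, ArrowQuiver.Path.castSrc]

theorem mulLin_ofPath_ne {i j k l : V} (p : Q.Path i j) (q : Q.Path k l) (h : j ≠ k) :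
    mulLin K Q (ofPath K Q p) (ofPath K Q q) = 0 := by
  rw [mulLin_ofPath]; simp [pathMul, h]

theorem induction {P : PathAlgebra K Q → Prop} (zero : P 0)
    (add : ∀ x y, P x → P y → P (x + y)) (smul : ∀ (c : K) x, P x → P (c • x))
    (path : ∀ (i j : V) (p : Q.Path i j), P (ofPath K Q p)) (x : PathAlgebra K Q) : P x := by
  refine Finsupp.induction_linear (motive := P) x zero add ?_
  rintro ⟨i, j, p⟩ c
  have h := smul c _ (path i j p)
  unfold ofPath at h
  erw [Finsupp.smul_single, smul_eq_mul, mul_one] at h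
  exact h

theorem mulLin_assoc (x y z : PathAlgebra K Q) :
    mulLin K Q (mulLin K Q x y) z = mulLin K Q x (mulLin K Q y z) := by
  induction x using PathAlgebra.induction with
  | zero => simp
  | add x x' h h' => simp [h, h']
  | smul c x h => simp [h]
  | path i j p =>
  induction y using PathAlgebra.induction with
  | zero => simp
  | add x x' h h' => simp [h, h']
  | smul c x h => simp [h]
  | path k l q =>
  induction z using PathAlgebra.induction with
  | zero => simp
  | add x x' h h' => simp [h, h']
  | smul c x h => simp [h]
  | path m n r =>
  by_cases h1 : j = k
  · subst h1
    rw [mulLin_ofPath_comp]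
    by_cases h2 : l = m
    · subst h2
      rw [mulLin_ofPath_comp, mulLin_ofPath_comp, mulLin_ofPath_comp, ArrowQuiver.Path.comp_assoc]
    · rw [mulLin_ofPath_ne _ _ _ _ h2, mulLin_ofPath_ne _ _ _ _ h2, map_zero]
  · rw [mulLin_ofPath_ne _ _ _ _ h1, map_zero, LinearMap.zero_apply]
    by_cases h2 : l = m
    · subst h2
      rw [mulLin_ofPath_comp, mulLin_ofPath_ne _ _ _ _ h1]
    · rw [mulLin_ofPath_ne _ _ _ _ h2, map_zero]

theorem mulLin_one_left [Fintype V] (x : PathAlgebra K Q) : mulLin K Q 1 x = x := by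
  induction x using PathAlgebra.induction with
  | zero => simp
  | add x x' h h' => simp [h, h']
  | smul c x h => simp [h]
  | path i j p =>
  rw [one_def, map_sum, LinearMap.sum_apply, Finset.sum_eq_single i]
  · rw [mulLin_ofPath_comp]; rfl
  · intro k _ hk
    exact mulLin_ofPath_ne _ _ _ _ hk
  · intro h; exact absurd (Finset.mem_univ i) h

theorem mulLin_one_right [Fintype V] (x : PathAlgebra K Q) : mulLin K Q x 1 = x := by
  induction x using PathAlgebra.induction with
  | zero => simp
  | add x x' h h' => simp [h, h']
  | smul c x h => simp [h]
  | path i j p =>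
  rw [one_def, map_sum, Finset.sum_eq_single j]
  · rw [mulLin_ofPath_comp, ArrowQuiver.Path.comp_nil]
  · intro k _ hk
    exact mulLin_ofPath_ne _ _ _ _ (Ne.symm hk)
  · intro h; exact absurd (Finset.mem_univ j) h

instance [Fintype V] : Ring (PathAlgebra K Q) :=
  { (inferInstance : AddCommGroup (PathAlgebra K Q)) with
    mul := fun x y => x * y
    one := 1
    left_distrib := fun x y z => by simp [mul_def]
    right_distrib := fun x y z => by simp [mul_def]
    zero_mul := fun x => by simp [mul_def]
    mul_zero := fun x => by simp [mul_def]
    mul_assoc := mulLin_assoc K Q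
    one_mul := mulLin_one_left K Q
    mul_one := mulLin_one_right K Q }

instance [Fintype V] : Algebra K (PathAlgebra K Q) :=
  Algebra.ofModule (fun c x y => by simp [mul_def]) (fun c x y => by simp [mul_def])

/-- An arrow, as an element of the path algebra. -/
def arrow (a : A) : PathAlgebra K Q := ofPath K Q (.cons a (.nil (Q.tgt a)))

end

end PathAlgebra

end PathAlgebra

/-! ### Triangulation quivers -/

/-- A triangulation quiver `(Q, f)`. -/
structure TriangulationQuiver (V A : Type*) extends ArrowQuiver V A where
  connected : toArrowQuiver.Connected
  /-- every vertex is the source of exactly two arrows -/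
  two_out : ∀ i : V, {a : A | src a = i}.ncard = 2
  /-- every vertex is the target of exactly two arrows -/
  two_in : ∀ i : V, {a : A | tgt a = i}.ncard = 2
  /-- the permutation `f` of the arrows -/
  f : Equiv.Perm A
  src_f : ∀ a : A, src (f a) = tgt a
  f_cubed : ∀ a : A, f (f (f a)) = a

namespace TriangulationQuiver

variable {V A : Type*} (T : TriangulationQuiver V A)

theorem existsUnique_bar (a : A) : ∃! b : A, b ≠ a ∧ T.src b = T.src a := by
  obtain ⟨x, y, hxy, h⟩ := Set.ncard_eq_two.1 (T.two_out (T.src a))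
  have key : ∀ b : A, T.src b = T.src a ↔ b = x ∨ b = y := by
    intro b
    have hb := Set.ext_iff.1 h b
    simpa using hb
  rcases (key a).1 rfl with ha | ha
  · refine ⟨y, ⟨?_, (key y).2 (Or.inr rfl)⟩, ?_⟩
    · rw [ha]; exact hxy.symm
    · rintro b ⟨hb, hs⟩
      rcases (key b).1 hs with h1 | h1
      · exact absurd (h1.trans ha.symm) hb
      · exact h1
  · refine ⟨x, ⟨?_, (key x).2 (Or.inl rfl)⟩, ?_⟩
    · rw [ha]; exact hxy
    · rintro b ⟨hb, hs⟩
      rcases (key b).1 hs with h1 | h1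
      · exact h1
      · exact absurd (h1.trans ha.symm) hb

noncomputable section

/-- The other arrow with the same source. -/
def barFun (a : A) : A := (T.existsUnique_bar a).choose

theorem barFun_spec (a : A) : T.barFun a ≠ a ∧ T.src (T.barFun a) = T.src a :=
  (T.existsUnique_bar a).choose_spec.1

theorem barFun_involutive : Function.Involutive T.barFun := by
  intro a
  have h1 := T.barFun_spec a
  have h2 := T.barFun_spec (T.barFun a)
  exact (T.existsUnique_bar (T.barFun a)).unique h2 ⟨h1.1.symm, h1.2.symm⟩

/-- The involution `α ↦ ᾱ`, where `ᾱ ≠ α` is the other arrow starting at the source of `α`. -/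
def bar : Equiv.Perm A := T.barFun_involutive.toPerm

/-- The permutation `g = f̄` of the arrows, `g α` being the arrow other than `f α` that starts at
the target of `α`. -/
def g : Equiv.Perm A := T.f.trans T.bar

/-- The set `O(g)` of `g`-orbits of arrows. -/
def GOrbit : Type _ := Quotient (Equiv.Perm.SameCycle.setoid T.g)

/-- The `g`-orbit of an arrow. -/
def orbit (a : A) : T.GOrbit := Quotient.mk (Equiv.Perm.SameCycle.setoid T.g) a

/-- The number `n_α` of arrows in the `g`-orbit of `α`. -/
def n (a : A) : ℕ := {b : A | T.orbit b = T.orbit a}.ncard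

/-- The border: the set of vertices carrying a loop `α` with `f α = α`. -/
def border : Set V := {i | ∃ a : A, T.src a = i ∧ T.tgt a = i ∧ T.f a = a}

/-- An arrow fixed by `f` is a loop, and its source is a border vertex: it is a border loop. -/
theorem src_mem_border {a : A} (h : T.f a = a) : T.src a ∈ T.border :=
  ⟨a, rfl, by rw [← T.src_f a, h], h⟩

variable (K : Type*) [Field K] [Fintype V]

/-- The product `α g(α) g²(α) ⋯` of the first `l` arrows along the `g`-orbit of `α`, in `K Q`. -/
def gPath (a : A) (l : ℕ) : PathAlgebra K T.toArrowQuiver :=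
  ((List.range l).map fun k => PathAlgebra.arrow K T.toArrowQuiver ((T.g ^ k) a)).prod

variable (m : T.GOrbit → ℕ+) (c : T.GOrbit → Kˣ) (b : T.border → K)

/-- The path `A_α` of length `m_α n_α - 1` along the `g`-orbit of `α`. -/
def pathA (a : A) : PathAlgebra K T.toArrowQuiver := T.gPath K a (m (T.orbit a) * T.n a - 1)

/-- The cycle `B_α` of length `m_α n_α` along the `g`-orbit of `α`. -/
def pathB (a : A) : PathAlgebra K T.toArrowQuiver := T.gPath K a (m (T.orbit a) * T.n a)

/-- The generators of the ideal `I(Q, f, m, c, b)` of `K Q`; the border loops are exactly the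
arrows `α` with `f α = α`. -/
inductive Generator : PathAlgebra K T.toArrowQuiver → Prop
  | nonborder (a : A) (h : T.f a ≠ a) :
      Generator (PathAlgebra.arrow K T.toArrowQuiver a *
          PathAlgebra.arrow K T.toArrowQuiver (T.f a)
        - (c (T.orbit (T.bar a)) : K) • T.pathA K m (T.bar a))
  | border (a : A) (h : T.f a = a) :
      Generator (PathAlgebra.arrow K T.toArrowQuiver a ^ 2
        - (c (T.orbit (T.bar a)) : K) • T.pathA K m (T.bar a)
        - b ⟨T.src a, T.src_mem_border h⟩ • T.pathB K m (T.bar a))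
  | zero (a : A) :
      Generator (PathAlgebra.arrow K T.toArrowQuiver a *
          PathAlgebra.arrow K T.toArrowQuiver (T.f a) *
          PathAlgebra.arrow K T.toArrowQuiver (T.g (T.f a)))

/-- The two-sided ideal `I(Q, f, m, c, b)` of the path algebra. -/
def relationIdeal : TwoSidedIdeal (PathAlgebra K T.toArrowQuiver) :=
  TwoSidedIdeal.span {x | T.Generator K m c b x}

/-- The socle deformed weighted triangulation algebra
`Λ(Q, f, m, c, b) = K Q / I(Q, f, m, c, b)`. -/
abbrev SocleDeformedAlgebra : Type _ := (T.relationIdeal K m c b).ringCon.Quotient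

end

end TriangulationQuiver

/-! ### Syzygies and periodicity -/

section Syzygy

universe u

variable (R : Type u) [Ring R]

/-- A projective cover of a module: a surjection from a projective module whose kernel is
superfluous. -/
structure IsProjectiveCover {P M : Type u} [AddCommGroup P] [Module R P] [AddCommGroup M]
    [Module R M] (π : P →ₗ[R] M) : Prop where
  projective : Module.Projective R P
  surjective : Function.Surjective π
  superfluous : ∀ N : Submodule R P, N ⊔ LinearMap.ker π = ⊤ → N = ⊤

/-- `IsSyzygy R n M N` says that `N ≅ Ωⁿ(M)` in the category of finitely generated `R`-modules,
where `Ω(M)` is the kernel of a projective cover of `M` (it is unique up to isomorphism) and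
`Ωⁿ⁺¹(M) = Ωⁿ(Ω(M))`. -/
def IsSyzygy : ℕ → ∀ (M N : Type u) [AddCommGroup M] [Module R M] [AddCommGroup N] [Module R N],
    Prop
  | 0, M, N, _, _, _, _ => Nonempty (M ≃ₗ[R] N)
  | n + 1, M, N, _, _, _, _ =>
      ∃ (P : Type u) (_ : AddCommGroup P) (_ : Module R P) (π : P →ₗ[R] M),
        Module.Finite R P ∧ IsProjectiveCover R π ∧ IsSyzygy n (LinearMap.ker π) N

/-- The module `M` is periodic of period `n`: `n` is the least positive integer with
`Ωⁿ(M) ≅ M`. -/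
def IsPeriodicModule (n : ℕ) (M : Type u) [AddCommGroup M] [Module R M] : Prop :=
  0 < n ∧ IsSyzygy R n M M ∧ ∀ k : ℕ, 0 < k → k < n → ¬ IsSyzygy R k M M

end Syzygy

section Bimodules

universe u w

variable (K : Type w) [Field K] (A : Type u) [Ring A] [Algebra K A]

/-- The ring whose left modules are the `A`-`A`-bimodules with central action of `K`; these are
the right modules over the enveloping algebra `Aᵉ = Aᵒᵖ ⊗ A`. -/
abbrev Enveloping : Type u := A ⊗[K] Aᵐᵒᵖ

/-- `A` as a bimodule over itself, `(x ⊗ y) • a = x a y`. -/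
noncomputable instance Enveloping.moduleSelf : Module (Enveloping K A) A :=
  TensorProduct.Algebra.module

/-- The finite-dimensional algebra `A` is a periodic algebra of period `n`: it is periodic of
period `n` as a bimodule over itself. -/
def IsPeriodicAlgebra (n : ℕ) : Prop :=
  FiniteDimensional K A ∧ IsPeriodicModule (Enveloping K A) n A

end Bimodules

/-! The algebra Λ is symmetric and its relations behave like the cyclic derivatives of a potential,
so its minimal bimodule resolution is self-dual. With P₀ = ⊕ Λe_i ⊗ e_iΛ over the vertices, P₁ = ⊕
Λe_{s(α)} ⊗ e_{t(α)}Λ and P₂ = ⊕ Λe_{t(α)} ⊗ e_{s(α)}Λ over the arrows, the goal is a minimal exact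
sequence 0 → Λ → P₀ → P₂ → P₁ → P₀ → Λ → 0.

The map P₁ → P₀ has entries α ⊗ e − e ⊗ α, and its kernel is generated by the universal derivatives
of the elements of the ideal I (`env_mem_span_deriv`). For a border loop α one has α³ = c B_ᾱ in Λ,
so the deformation term can be traded for a multiple of α³. All relations of types 1 and 2 then read
f(α)f²(α) = κ_α α³ + c_α A_{g(α)}, formally the derivatives of a potential. The zero relations of
type 3 follow from these modulo I·rad + rad·I (`relations_of_potential`), unless the cycle lengths m
n at α, ᾱ, f(α) and f(ᾱ) are all 3. That exception would force g³ = id on all arrows, and with a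
border loop present at most two vertices. By Nakayama, one relation per arrow suffices
(`span_deriv_eq`).

Thus P₂ → P₁ is a matrix of second derivatives, symmetric under the swap of tensor factors
(`deriv_potentialRel_symm`). A symmetrizing form on Λ induces one on the enveloping algebra, over
which transposition preserves exactness (`IsSymmetrizing.exact_transpose`); transposing P₂ → P₁ → P₀
gives exactness of P₀ → P₂ → P₁. The kernel of P₀ → P₂ consists of the z with z(a ⊗ 1) = z(1 ⊗ a),
which form a copy of Λ generated by the Casimir element (`IsSymmetrizing.innerInvariantsEquiv`).

All entries, and this last kernel, lie in the radical, so the resolution is minimal. An arrow that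
is not a loop distinguishes P₀ from P₁ and P₂, which excludes periods 1 and 2; period 3 combined
with Ω⁴(Λ) ≅ Λ would give period 1 (`isPeriodicModule_four`). -/

open MulOpposite (op unop)

/-! ### Projective covers and syzygies -/

section SyzygyTheory

universe u

variable {R : Type u} [Ring R]

/-- A surjection from a finite projective module with kernel in the radical is a projective
cover. -/
theorem isProjectiveCover_of_ker_le {P M : Type u} [AddCommGroup P] [Module R P] [AddCommGroup M]
    [Module R M] [Module.Finite R P] [Module.Projective R P] (π : P →ₗ[R] M)
    (hs : Function.Surjective π) (hk : LinearMap.ker π ≤ Module.jacobson R P) :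
    IsProjectiveCover R π := by
  refine ⟨inferInstance, hs, fun N hN => ?_⟩
  by_contra hne
  obtain ⟨C, hC, hNC⟩ := (eq_top_or_exists_le_coatom N).resolve_left hne
  have h1 : LinearMap.ker π ≤ C := hk.trans (sInf_le hC)
  exact hC.1 (top_le_iff.1 (hN ▸ sup_le hNC h1))

/-- Projective covers are unique up to isomorphism. -/
theorem IsProjectiveCover.exists_equiv {P P' M M' : Type u} [AddCommGroup P] [Module R P]
    [AddCommGroup P'] [Module R P'] [AddCommGroup M] [Module R M] [AddCommGroup M'] [Module R M']
    {π : P →ₗ[R] M} {π' : P' →ₗ[R] M'} (h : IsProjectiveCover R π) (h' : IsProjectiveCover R π')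
    (e : M ≃ₗ[R] M') : ∃ E : P ≃ₗ[R] P', ∀ x, π' (E x) = e (π x) := by
  have := h.projective
  have := h'.projective
  obtain ⟨F, hF⟩ := Module.projective_lifting_property π' (e.toLinearMap ∘ₗ π) h'.surjective
  have hF' : ∀ x, π' (F x) = e (π x) := fun x => LinearMap.congr_fun hF x
  have hFs : Function.Surjective F := by
    rw [← LinearMap.range_eq_top]
    refine h'.superfluous _ (eq_top_iff.2 fun y _ => ?_)
    obtain ⟨x, hx⟩ := h.surjective (e.symm (π' y))
    refine Submodule.mem_sup.2 ⟨F x, ⟨x, rfl⟩, y - F x, ?_, by abel⟩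
    rw [LinearMap.mem_ker, map_sub, hF', hx, e.apply_symm_apply, sub_self]
  obtain ⟨G, hG⟩ := Module.projective_lifting_property F LinearMap.id hFs
  have hG' : ∀ y, F (G y) = y := fun y => LinearMap.congr_fun hG y
  have hGs : LinearMap.range G = ⊤ := by
    refine h.superfluous _ (eq_top_iff.2 fun x _ => ?_)
    refine Submodule.mem_sup.2 ⟨G (F x), ⟨_, rfl⟩, x - G (F x), ?_, by abel⟩
    apply LinearMap.mem_ker.2
    apply e.injective
    rw [← hF', map_sub, hG', sub_self, map_zero, map_zero]
  have hFi : Function.Injective F := by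
    refine (injective_iff_map_eq_zero F).2 fun x hx => ?_
    obtain ⟨y, rfl⟩ := LinearMap.range_eq_top.1 hGs x
    rw [hG'] at hx
    rw [hx, map_zero]
  exact ⟨LinearEquiv.ofBijective F ⟨hFi, hFs⟩, hF'⟩

theorem IsProjectiveCover.ker_equiv {P P' M M' : Type u} [AddCommGroup P] [Module R P]
    [AddCommGroup P'] [Module R P'] [AddCommGroup M] [Module R M] [AddCommGroup M'] [Module R M']
    {π : P →ₗ[R] M} {π' : P' →ₗ[R] M'} (h : IsProjectiveCover R π) (h' : IsProjectiveCover R π')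
    (e : M ≃ₗ[R] M') : Nonempty (LinearMap.ker π ≃ₗ[R] LinearMap.ker π') := by
  obtain ⟨E, hE⟩ := h.exists_equiv h' e
  refine ⟨E.ofSubmodules _ _ ?_⟩
  ext y
  constructor
  · rintro ⟨x, hx, rfl⟩
    have hx' : π x = 0 := hx
    exact LinearMap.mem_ker.2 ((hE x).trans (by rw [hx', map_zero]))
  · intro hy
    refine ⟨E.symm y, LinearMap.mem_ker.2 (e.injective ?_), E.apply_symm_apply y⟩
    rw [← hE, map_zero]
    simpa using hy

theorem IsProjectiveCover.comp_equiv {P M M' : Type u} [AddCommGroup P] [Module R P]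
    [AddCommGroup M] [Module R M] [AddCommGroup M'] [Module R M']
    {π : P →ₗ[R] M} (h : IsProjectiveCover R π) (e : M ≃ₗ[R] M') :
    IsProjectiveCover R (e.toLinearMap ∘ₗ π) :=
  ⟨h.projective, e.surjective.comp h.surjective, fun N hN => h.superfluous N (by
    rwa [LinearEquiv.ker_comp] at hN)⟩

/-- Syzygies of isomorphic modules are isomorphic. -/
theorem IsSyzygy.unique : ∀ (n : ℕ) (M M' N N' : Type u) [AddCommGroup M] [Module R M]
    [AddCommGroup M'] [Module R M'] [AddCommGroup N] [Module R N] [AddCommGroup N'] [Module R N'],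
    Nonempty (M ≃ₗ[R] M') → IsSyzygy R n M N → IsSyzygy R n M' N' → Nonempty (N ≃ₗ[R] N')
  | 0, _, _, _, _, _, _, _, _, _, _, _, _, ⟨e⟩, ⟨a⟩, ⟨b⟩ => ⟨a.symm.trans (e.trans b)⟩
  | n + 1, _, _, N, N', _, _, _, _, _, _, _, _, ⟨e⟩, ⟨_, _, _, _, _, hπ, h⟩,
      ⟨_, _, _, _, _, hπ', h'⟩ =>
    IsSyzygy.unique n _ _ N N' (hπ.ker_equiv hπ' e) h h'

theorem IsSyzygy.congr_left : ∀ (n : ℕ) (M M' N : Type u) [AddCommGroup M] [Module R M]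
    [AddCommGroup M'] [Module R M'] [AddCommGroup N] [Module R N],
    Nonempty (M ≃ₗ[R] M') → IsSyzygy R n M N → IsSyzygy R n M' N
  | 0, _, _, _, _, _, _, _, _, _, ⟨e⟩, ⟨a⟩ => ⟨e.symm.trans a⟩
  | n + 1, _, _, N, _, _, _, _, _, _, ⟨e⟩, ⟨P, i1, i2, π, hf, hπ, h⟩ =>
    ⟨P, i1, i2, e.toLinearMap ∘ₗ π, hf, hπ.comp_equiv e,
      IsSyzygy.congr_left n _ _ N ⟨LinearEquiv.ofEq _ _ (LinearEquiv.ker_comp e π).symm⟩ h⟩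

/-- The restriction of the second map of an exact sequence to the kernel of the first one. -/
def toKer {P Q M : Type u} [AddCommGroup P] [Module R P] [AddCommGroup Q] [Module R Q]
    [AddCommGroup M] [Module R M] (d : P →ₗ[R] Q) (π : Q →ₗ[R] M) (h : ∀ x, π (d x) = 0) :
    P →ₗ[R] LinearMap.ker π :=
  d.codRestrict _ fun x => LinearMap.mem_ker.2 (h x)

theorem ker_toKer {P Q M : Type u} [AddCommGroup P] [Module R P] [AddCommGroup Q] [Module R Q]
    [AddCommGroup M] [Module R M] (d : P →ₗ[R] Q) (π : Q →ₗ[R] M) (h : ∀ x, π (d x) = 0) :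
    LinearMap.ker (toKer d π h) = LinearMap.ker d :=
  LinearMap.ker_codRestrict _ _ _

/-- Exactness at the middle term makes the corestriction onto the kernel surjective. In this way the
differentials of a minimal resolution become the successive projective covers in `IsSyzygy`. -/
theorem isProjectiveCover_toKer {P Q M : Type u} [AddCommGroup P] [Module R P] [AddCommGroup Q]
    [Module R Q] [AddCommGroup M] [Module R M] [Module.Finite R P] [Module.Projective R P]
    (d : P →ₗ[R] Q) (π : Q →ₗ[R] M)
    (h : ∀ x, π (d x) = 0) (hex : ∀ y, π y = 0 → ∃ x, d x = y)
    (hk : LinearMap.ker d ≤ Module.jacobson R P) : IsProjectiveCover R (toKer d π h) := by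
  refine isProjectiveCover_of_ker_le _ ?_ (by rwa [ker_toKer])
  rintro ⟨y, hy⟩
  obtain ⟨x, hx⟩ := hex y hy
  exact ⟨x, Subtype.ext hx⟩

/-- A minimal projective resolution of length four whose last kernel is `M` itself, with
`P₀` isomorphic to neither `P₁` nor `P₂`, shows that `M` is periodic of period four. -/
theorem isPeriodicModule_four {M P₀ P₁ P₂ P₃ : Type u} [AddCommGroup M] [Module R M]
    [AddCommGroup P₀] [Module R P₀] [AddCommGroup P₁] [Module R P₁] [AddCommGroup P₂] [Module R P₂]
    [AddCommGroup P₃] [Module R P₃] [Module.Finite R P₀] [Module.Projective R P₀]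
    [Module.Finite R P₁] [Module.Projective R P₁] [Module.Finite R P₂] [Module.Projective R P₂]
    [Module.Finite R P₃] [Module.Projective R P₃]
    (π : P₀ →ₗ[R] M) (d₁ : P₁ →ₗ[R] P₀) (d₂ : P₂ →ₗ[R] P₁) (d₃ : P₃ →ₗ[R] P₂)
    (hπ : Function.Surjective π)
    (h₀ : ∀ x, π (d₁ x) = 0) (ex₀ : ∀ y, π y = 0 → ∃ x, d₁ x = y)
    (h₁ : ∀ x, d₁ (d₂ x) = 0) (ex₁ : ∀ y, d₁ y = 0 → ∃ x, d₂ x = y)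
    (h₂ : ∀ x, d₂ (d₃ x) = 0) (ex₂ : ∀ y, d₂ y = 0 → ∃ x, d₃ x = y)
    (e : LinearMap.ker d₃ ≃ₗ[R] M)
    (r₀ : LinearMap.range d₁ ≤ Module.jacobson R P₀) (r₁ : LinearMap.range d₂ ≤ Module.jacobson R P₁)
    (r₂ : LinearMap.range d₃ ≤ Module.jacobson R P₂) (r₃ : LinearMap.ker d₃ ≤ Module.jacobson R P₃)
    (n₁ : IsEmpty (P₀ ≃ₗ[R] P₁)) (n₂ : IsEmpty (P₀ ≃ₗ[R] P₂)) :
    IsSyzygy R 4 M M ∧ IsPeriodicModule R 4 M := by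
  have c₀ : IsProjectiveCover R π :=
    isProjectiveCover_of_ker_le π hπ fun y hy => r₀ (ex₀ y hy)
  have c₁ := isProjectiveCover_toKer d₁ π h₀ ex₀ fun y hy => r₁ (ex₁ y hy)
  have c₂ := isProjectiveCover_toKer d₂ d₁ h₁ ex₁ fun y hy => r₂ (ex₂ y hy)
  have c₃ := isProjectiveCover_toKer d₃ d₂ h₂ ex₂ r₃
  let e₁ : LinearMap.ker d₁ ≃ₗ[R] LinearMap.ker (toKer d₁ π h₀) :=
    LinearEquiv.ofEq _ _ (ker_toKer d₁ π h₀).symm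
  let e₂ : LinearMap.ker d₂ ≃ₗ[R] LinearMap.ker (toKer d₂ d₁ h₁) :=
    LinearEquiv.ofEq _ _ (ker_toKer d₂ d₁ h₁).symm
  let e₃ : LinearMap.ker d₃ ≃ₗ[R] LinearMap.ker (toKer d₃ d₂ h₂) :=
    LinearEquiv.ofEq _ _ (ker_toKer d₃ d₂ h₂).symm
  have s₃ : IsSyzygy R 1 (LinearMap.ker d₂) M :=
    ⟨P₃, _, _, _, inferInstance, c₃, ⟨e₃.symm.trans e⟩⟩
  have s₂ : IsSyzygy R 2 (LinearMap.ker d₁) M :=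
    ⟨P₂, _, _, _, inferInstance, c₂, s₃.congr_left 1 _ _ _ ⟨e₂⟩⟩
  have s₁ : IsSyzygy R 3 (LinearMap.ker π) M :=
    ⟨P₁, _, _, _, inferInstance, c₁, s₂.congr_left 2 _ _ _ ⟨e₁⟩⟩
  have s₀ : IsSyzygy R 4 M M := ⟨P₀, _, _, _, inferInstance, c₀, s₁⟩
  have k₁ : IsSyzygy R 1 M (LinearMap.ker π) :=
    ⟨P₀, _, _, _, inferInstance, c₀, ⟨LinearEquiv.refl _ _⟩⟩
  have k₂ : IsSyzygy R 2 M (LinearMap.ker d₁) :=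
    ⟨P₀, _, _, _, inferInstance, c₀, P₁, _, _, _, inferInstance, c₁, ⟨e₁.symm⟩⟩
  have k₃ : IsSyzygy R 3 M (LinearMap.ker d₂) :=
    ⟨P₀, _, _, _, inferInstance, c₀, P₁, _, _, _, inferInstance, c₁,
      IsSyzygy.congr_left 1 _ _ _ ⟨e₁⟩ ⟨P₂, _, _, _, inferInstance, c₂, ⟨e₂.symm⟩⟩⟩
  -- An isomorphism M ≅ Ω(M) lifts to an isomorphism of the projective covers P₀ and P₁.
  have no₁ : ¬ IsSyzygy R 1 M M := fun h => by
    obtain ⟨t⟩ := IsSyzygy.unique 1 _ _ _ _ ⟨LinearEquiv.refl R M⟩ h k₁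
    obtain ⟨E, -⟩ := c₀.exists_equiv c₁ t
    exact n₁.false E
  refine ⟨s₀, by norm_num, s₀, fun k hk hk4 h => ?_⟩
  interval_cases k
  · exact no₁ h
  · obtain ⟨t⟩ := IsSyzygy.unique 2 _ _ _ _ ⟨LinearEquiv.refl R M⟩ h k₂
    obtain ⟨E, -⟩ := c₀.exists_equiv c₂ t
    exact n₂.false E
  -- If Ω³(M) ≅ M, then Ω(M) ≅ Ω(Ω³(M)) ≅ M, the case already excluded.
  · obtain ⟨t⟩ := IsSyzygy.unique 3 _ _ _ _ ⟨LinearEquiv.refl R M⟩ h k₃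
    exact no₁ (s₃.congr_left 1 _ _ _ ⟨t.symm⟩)

end SyzygyTheory

/-! ### Modules cut out by families of idempotents -/

section IdemModule

variable {R : Type*} [Ring R] {ι κ μ : Type*}

/-- The submodule `⨁ R ε k` of the free module `ι → R`. -/
def idemModule (ε : ι → R) : Submodule R (ι → R) where
  carrier := {x | ∀ k, x k * ε k = x k}
  add_mem' hx hy k := by simp [add_mul, hx k, hy k]
  zero_mem' k := by simp
  smul_mem' r x hx k := by simp [mul_assoc, hx k]

/-- The projection of the free module onto `idemModule ε`. -/
def idemProj (ε : ι → R) (hε : ∀ k, ε k * ε k = ε k) : (ι → R) →ₗ[R] idemModule ε where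
  toFun x := ⟨fun k => x k * ε k, fun k => by rw [mul_assoc, hε]⟩
  map_add' x y := by ext k; simp [add_mul]
  map_smul' r x := by ext k; simp [mul_assoc]

theorem idemProj_subtype (ε : ι → R) (hε : ∀ k, ε k * ε k = ε k) :
    idemProj ε hε ∘ₗ (idemModule ε).subtype = LinearMap.id := by
  ext x k
  exact x.2 k

theorem idemModule_projective [Finite ι] (ε : ι → R) (hε : ∀ k, ε k * ε k = ε k) :
    Module.Projective R (idemModule ε) :=
  Module.Projective.of_split _ _ (idemProj_subtype ε hε)

theorem idemModule_finite [Finite ι] (ε : ι → R) (hε : ∀ k, ε k * ε k = ε k) :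
    Module.Finite R (idemModule ε) :=
  Module.Finite.of_surjective (idemProj ε hε) fun x =>
    ⟨x, LinearMap.congr_fun (idemProj_subtype ε hε) x⟩

variable [Fintype ι]

/-- Right multiplication by a matrix, as a map between the modules of two families. -/
def idemMap (ε : ι → R) (ε' : κ → R) (D : ι → κ → R) (hD : ∀ k l, D k l * ε' l = D k l) :
    idemModule ε →ₗ[R] idemModule ε' where
  toFun x := ⟨fun l => ∑ k, x.1 k * D k l, fun l => by simp [Finset.sum_mul, mul_assoc, hD]⟩
  map_add' x y := by ext l; simp [add_mul, Finset.sum_add_distrib]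
  map_smul' r x := by ext l; simp [Finset.mul_sum, mul_assoc]

theorem idemMap_apply (ε : ι → R) (ε' : κ → R) (D : ι → κ → R)
    (hD : ∀ k l, D k l * ε' l = D k l) (x : idemModule ε) (l : κ) :
    (idemMap ε ε' D hD x).1 l = ∑ k, x.1 k * D k l := rfl

/-- The module is the image of a free module under `idemProj`; linear maps carry radicals into
radicals, and in a free module coordinates in the radical suffice. -/
theorem mem_jacobson_idemModule (ε : ι → R) (hε : ∀ k, ε k * ε k = ε k) (x : idemModule ε)
    (hx : ∀ k, x.1 k ∈ Ring.jacobson R) : x ∈ Module.jacobson R (idemModule ε) := by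
  classical
  have h1 : x.1 ∈ Module.jacobson R (ι → R) := by
    rw [pi_eq_sum_univ x.1]
    refine Submodule.sum_mem _ fun k _ => ?_
    exact Ring.jacobson_smul_top_le R _ (Submodule.smul_mem_smul (hx k) trivial)
  have h2 : idemProj ε hε x.1 = x := LinearMap.congr_fun (idemProj_subtype ε hε) x
  rw [← h2]
  exact Module.map_jacobson_le (idemProj ε hε) (Submodule.mem_map_of_mem h1)

theorem range_idemMap_le_jacobson [Fintype κ] (ε : ι → R) (ε' : κ → R) (hε' : ∀ k, ε' k * ε' k = ε' k)
    (D : ι → κ → R) (hD : ∀ k l, D k l * ε' l = D k l) (hJ : ∀ k l, D k l ∈ Ring.jacobson R) :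
    LinearMap.range (idemMap ε ε' D hD) ≤ Module.jacobson R (idemModule ε') := by
  rintro _ ⟨x, rfl⟩
  refine mem_jacobson_idemModule ε' hε' _ fun l => ?_
  rw [idemMap_apply]
  exact Submodule.sum_mem _ fun k _ => Ideal.mul_mem_left _ _ (hJ k l)

/-- If a character of `R` kills all idempotents of the first family but not all of those of the
second one, then the two modules are not isomorphic. -/
theorem isEmpty_idemModule_equiv {F : Type*} [Ring F] [Nontrivial F] (ε : ι → R) (ε' : κ → R)
    (hε : ∀ k, ε k * ε k = ε k) (hε' : ∀ k, ε' k * ε' k = ε' k)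
    (χ : R →+* F) (h : ∀ k, χ (ε k) = 0) (l : κ) (hl : χ (ε' l) = 1) :
    IsEmpty (idemModule ε ≃ₗ[R] idemModule ε') := by
  classical
  refine ⟨fun E => ?_⟩
  let y : idemModule ε' := idemProj ε' hε' (Pi.single l 1)
  have hy : y.1 l = ε' l := by simp [y, idemProj]
  -- The module is generated by elements fixed by the various ε k, so every coordinate of E x is a
  -- sum of products containing some ε k, and χ kills all of these.
  have key : ∀ x : idemModule ε, χ ((E x).1 l) = 0 := by
    intro x
    have hx : x = ∑ k, x.1 k • idemProj ε hε (Pi.single k 1) := by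
      refine Subtype.ext (funext fun j => ?_)
      rw [Submodule.coe_sum, Finset.sum_apply, Finset.sum_eq_single j]
      · simp [idemProj, x.2 j]
      · intro k _ hk
        simp [idemProj, hk.symm]
      · simp
    have h2 : ∀ k, idemProj ε hε (Pi.single k 1)
        = ε k • idemProj ε hε (Pi.single k 1) := by
      intro k
      ext j
      rcases eq_or_ne j k with rfl | hjk
      · simp [idemProj, hε]
      · simp [idemProj, hjk]
    rw [hx, map_sum]
    simp only [map_smul]
    rw [Submodule.coe_sum, Finset.sum_apply, map_sum]
    refine Finset.sum_eq_zero fun k _ => ?_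
    rw [h2 k, map_smul]
    simp [h]
  have := key (E.symm y)
  rw [E.apply_symm_apply, hy, hl] at this
  exact one_ne_zero this

end IdemModule

/-! ### Symmetric algebras and duality -/

section SymmetricForm

variable {K : Type*} [Field K]

/-- `φ` is a symmetrizing form with finite dual families `b` and `b'`. -/
structure IsSymmetrizing {S : Type*} [Ring S] [Algebra K S] (φ : S →ₗ[K] K) {ι : Type*}
    [Fintype ι] (b b' : ι → S) : Prop where
  comm : ∀ x y, φ (x * y) = φ (y * x)
  expand : ∀ x, ∑ k, φ (b' k * x) • b k = x
  expand' : ∀ x, ∑ k, φ (b k * x) • b' k = x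

/-- A basis together with its dual basis for the bilinear form φ(xy); the trace property lets the
two exchange roles. -/
theorem exists_isSymmetrizing {S : Type*} [Ring S] [Algebra K S] [FiniteDimensional K S]
    (φ : S →ₗ[K] K) (comm : ∀ x y, φ (x * y) = φ (y * x))
    (nondeg : ∀ x, (∀ y, φ (x * y) = 0) → x = 0) :
    ∃ b b' : Fin (Module.finrank K S) → S, IsSymmetrizing φ b b' := by
  classical
  let B : LinearMap.BilinForm K S := (LinearMap.mul K S).compr₂ φ
  have hB : B.Nondegenerate := ⟨fun x hx => nondeg x hx, fun y hy => nondeg y fun x => by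
    rw [comm]; exact hy x⟩
  let b := Module.finBasis K S
  refine ⟨b, B.dualBasis hB b, comm, fun x => ?_, fun x => ?_⟩
  · conv_rhs => rw [← b.sum_repr x]
    refine Finset.sum_congr rfl fun k _ => ?_
    congr 1
    have h1 : ∀ j, φ (B.dualBasis hB b k * b j) = if j = k then 1 else 0 := fun j =>
      LinearMap.BilinForm.apply_dualBasis_left hB b k j
    have h2 : φ (B.dualBasis hB b k * x) = ∑ j, b.repr x j * φ (B.dualBasis hB b k * b j) := by
      conv_lhs => rw [← b.sum_repr x, Finset.mul_sum, map_sum]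
      simp only [mul_smul_comm, map_smul, smul_eq_mul]
    simp [h2, h1]
  · conv_rhs => rw [← (B.dualBasis hB b).sum_repr x]
    refine Finset.sum_congr rfl fun k _ => ?_
    congr 1
    rw [LinearMap.BilinForm.dualBasis_repr_apply, comm]
    rfl

namespace IsSymmetrizing

variable {S : Type*} [Ring S] [Algebra K S] {φ : S →ₗ[K] K} {ι : Type*} [Fintype ι] {b b' : ι → S}

theorem eq_zero (h : IsSymmetrizing φ b b') {x : S} (hx : ∀ y, φ (x * y) = 0) : x = 0 := by
  rw [← h.expand x]
  exact Finset.sum_eq_zero fun k _ => by rw [h.comm, hx, zero_smul]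

/-- The dual families give the representing element explicitly, so S is identified with its K-dual.
-/
theorem exists_repr (h : IsSymmetrizing φ b b') (f : S →ₗ[K] K) : ∃ w, ∀ x, f x = φ (w * x) := by
  refine ⟨∑ k, f (b k) • b' k, fun x => ?_⟩
  conv_lhs => rw [← h.expand x]
  simp [Finset.sum_mul, mul_comm]

/-- Over a symmetric algebra, transposing an exact sequence of matrices gives an exact sequence. -/
theorem exact_transpose (h : IsSymmetrizing φ b b') {α β γ : Type*} [Fintype α] [Fintype β]
    [Fintype γ] (ε : β → S) (hε : ∀ l, ε l * ε l = ε l) (M : α → β → S) (N : β → γ → S) (hN : ∀ l j, ε l * N l j = N l j)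
    (hex : ∀ y : β → S, (∀ l, y l * ε l = y l) → (∀ j, ∑ l, y l * N l j = 0) →
      ∃ x : α → S, ∀ l, y l = ∑ k, x k * M k l)
    (y : β → S) (hy : ∀ l, ε l * y l = y l) (hM : ∀ k, ∑ l, M k l * y l = 0) :
    ∃ z : γ → S, ∀ l, y l = ∑ j, N l j * z j := by
  classical
  let T : (γ → S) →ₗ[K] (β → S) :=
    { toFun := fun z l => ∑ j, N l j * z j
      map_add' := fun z w => by ext l; simp [mul_add, Finset.sum_add_distrib]
      map_smul' := fun c z => by ext l; simp [Finset.smul_sum] }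
  -- If y is outside the column image, some functional f kills that image but not y. Writing f
  -- through φ gives a row w, and w ε lies in the kernel of N, hence equals x M. Then f(y) = φ(x M
  -- y) = 0, a contradiction.
  by_contra hcon
  have hyT : y ∉ LinearMap.range T := fun ⟨z, hz⟩ => hcon ⟨z, fun l => (congrFun hz l).symm⟩
  obtain ⟨f, hfy, hf⟩ := Submodule.exists_le_ker_of_notMem hyT
  choose w hw using fun l => h.exists_repr (f ∘ₗ LinearMap.single K (fun _ : β => S) l)
  have hfw : ∀ v : β → S, f v = ∑ l, φ (w l * v l) := by
    intro v
    conv_lhs => rw [← Finset.univ_sum_single v]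
    rw [map_sum]
    exact Finset.sum_congr rfl fun l _ => hw l (v l)
  have hB : ∀ j, ∑ l, w l * ε l * N l j = 0 := by
    intro j
    refine h.eq_zero fun v => ?_
    have h1 : f (T (Pi.single j v)) = 0 := hf ⟨_, rfl⟩
    rw [hfw, ← map_sum] at h1
    rw [Finset.sum_mul, ← h1]
    congr 1
    refine Finset.sum_congr rfl fun l _ => ?_
    simp only [T, LinearMap.coe_mk, AddHom.coe_mk]
    rw [Finset.sum_eq_single j (fun i _ hi => by simp [hi]) (by simp), Pi.single_eq_same,
      mul_assoc (w l), hN, mul_assoc]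
  obtain ⟨x, hx⟩ := hex (fun l => w l * ε l) (fun l => by rw [mul_assoc, hε]) hB
  apply hfy
  rw [hfw]
  have h1 : ∀ l, φ (w l * y l) = φ (∑ k, x k * (M k l * y l)) := fun l => by
    rw [← hy l, ← mul_assoc, hx l, Finset.sum_mul]
    simp [mul_assoc, hy]
  simp_rw [h1]
  rw [← map_sum, Finset.sum_comm]
  simp [← Finset.mul_sum, hM]

end IsSymmetrizing

end SymmetricForm

/-! ### The enveloping algebra of a symmetric algebra and its inner invariants -/

section Enveloping

variable (K : Type*) [Field K] {L : Type*} [Ring L] [Algebra K L]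

/-- The swap of the two tensor factors, an anti-automorphism of the enveloping algebra. -/
noncomputable def envSwap : Enveloping K L →ₗ[K] Enveloping K L :=
  TensorProduct.map (MulOpposite.opLinearEquiv K).symm.toLinearMap
    (MulOpposite.opLinearEquiv K).toLinearMap ∘ₗ (TensorProduct.comm K L Lᵐᵒᵖ).toLinearMap

@[simp] theorem envSwap_tmul (x : L) (y : Lᵐᵒᵖ) : envSwap K (x ⊗ₜ[K] y) = unop y ⊗ₜ[K] op x := rfl

theorem envSwap_mul (z w : Enveloping K L) : envSwap K (z * w) = envSwap K w * envSwap K z := by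
  induction z using TensorProduct.induction_on with
  | zero => simp
  | add a b ha hb => simp [add_mul, mul_add, ha, hb]
  | tmul x y =>
  induction w using TensorProduct.induction_on with
  | zero => simp
  | add a b ha hb => simp [add_mul, mul_add, ha, hb]
  | tmul x' y' => simp [Algebra.TensorProduct.tmul_mul_tmul]

@[simp] theorem envSwap_envSwap (z : Enveloping K L) : envSwap K (envSwap K z) = z := by
  induction z using TensorProduct.induction_on with
  | zero => simp
  | add a b ha hb => simp [ha, hb]
  | tmul x y => rfl

variable {K}

/-- The form on the enveloping algebra induced by a form on the algebra. -/
noncomputable def envForm (φ : L →ₗ[K] K) : Enveloping K L →ₗ[K] K :=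
  LinearMap.mul' K K ∘ₗ TensorProduct.map φ (φ ∘ₗ (MulOpposite.opLinearEquiv K).symm.toLinearMap)

@[simp] theorem envForm_tmul (φ : L →ₗ[K] K) (x : L) (y : Lᵐᵒᵖ) :
    envForm φ (x ⊗ₜ[K] y) = φ x * φ (unop y) := rfl

theorem IsSymmetrizing.enveloping {φ : L →ₗ[K] K} {ι : Type*} [Fintype ι] {b b' : ι → L}
    (h : IsSymmetrizing φ b b') :
    IsSymmetrizing (envForm φ) (fun p : ι × ι => b p.1 ⊗ₜ[K] op (b p.2))
      (fun p : ι × ι => b' p.1 ⊗ₜ[K] op (b' p.2)) := by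
  have key : ∀ {c c' : ι → L}, (∀ x, ∑ k, φ (c' k * x) • c k = x) → ∀ z : Enveloping K L,
      ∑ p : ι × ι, envForm φ (c' p.1 ⊗ₜ[K] op (c' p.2) * z) • (c p.1 ⊗ₜ[K] op (c p.2)) = z := by
    intro c c' hc z
    induction z using TensorProduct.induction_on with
    | zero => simp
    | add a b ha hb => simp [mul_add, add_smul, Finset.sum_add_distrib, ha, hb]
    | tmul x y =>
      conv_rhs => rw [← hc x, ← MulOpposite.op_unop y, ← hc (unop y)]
      simp only [Algebra.TensorProduct.tmul_mul_tmul, envForm_tmul, MulOpposite.unop_mul,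
        MulOpposite.unop_op, Finset.op_sum, MulOpposite.op_smul, TensorProduct.sum_tmul,
        TensorProduct.tmul_sum, TensorProduct.smul_tmul_smul, ← Finset.univ_product_univ,
        Finset.sum_product, h.comm (unop y)]
      exact Finset.sum_comm
  refine ⟨fun z w => ?_, key h.expand, key h.expand'⟩
  induction z using TensorProduct.induction_on with
  | zero => simp
  | add a b ha hb => simp [add_mul, mul_add, ha, hb]
  | tmul x y =>
  induction w using TensorProduct.induction_on with
  | zero => simp
  | add a b ha hb => simp [add_mul, mul_add, ha, hb]
  | tmul x' y' =>
    simp [Algebra.TensorProduct.tmul_mul_tmul, h.comm x x', h.comm (unop y)]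

theorem Enveloping.tmul_smul (x y : L) (a : L) : (x ⊗ₜ[K] op y : Enveloping K L) • a = x * a * y := by
  change x • (op y • a) = _
  rw [op_smul_eq_mul, smul_eq_mul, mul_assoc]

variable (K L) in
/-- The elements of the enveloping algebra that are invariant under the inner bimodule
structure. -/
def innerInvariants : Submodule (Enveloping K L) (Enveloping K L) where
  carrier := {z | ∀ a : L, z * (a ⊗ₜ[K] op 1) = z * (1 ⊗ₜ[K] op a)}
  add_mem' hz hw a := by rw [add_mul, add_mul, hz a, hw a]
  zero_mem' a := by simp
  smul_mem' r z hz a := by rw [smul_eq_mul, mul_assoc, mul_assoc, hz a]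

/-- Contraction of the first tensor factor by a linear form. -/
noncomputable def contract (φ : L →ₗ[K] K) : Enveloping K L →ₗ[K] L :=
  (TensorProduct.lid K L).toLinearMap ∘ₗ
    TensorProduct.map φ (MulOpposite.opLinearEquiv K).symm.toLinearMap

@[simp] theorem contract_tmul (φ : L →ₗ[K] K) (x : L) (y : Lᵐᵒᵖ) :
    contract φ (x ⊗ₜ[K] y) = φ x • unop y := rfl

theorem contract_mul_right (φ : L →ₗ[K] K) (z : Enveloping K L) (a : L) :
    contract φ (z * (1 ⊗ₜ[K] op a)) = a * contract φ z := by
  induction z using TensorProduct.induction_on with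
  | zero => simp
  | add a b ha hb => simp [add_mul, mul_add, ha, hb]
  | tmul x y => simp [Algebra.TensorProduct.tmul_mul_tmul]

namespace IsSymmetrizing

variable {φ : L →ₗ[K] K} {ι : Type*} [Fintype ι] {b b' : ι → L}

/-- Since φ is a trace, a left factor x of the first tensor component may be moved to its right,
that is, to the inner side. -/
theorem contract_mul_left (h : IsSymmetrizing φ b b') (z : Enveloping K L) (x y : L) :
    contract φ (x ⊗ₜ[K] op y * z) = contract φ (z * (x ⊗ₜ[K] op 1)) * y := by
  induction z using TensorProduct.induction_on with
  | zero => simp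
  | add a b ha hb => simp [add_mul, mul_add, ha, hb]
  | tmul x' y' => simp [Algebra.TensorProduct.tmul_mul_tmul, h.comm x x']

/-- The outer left factor x becomes an inner left one by the trace property; inner invariance moves
it across the tensor sign, where it multiplies the contraction from the left. -/
theorem contract_smul (h : IsSymmetrizing φ b b') (r z : Enveloping K L)
    (hz : z ∈ innerInvariants K L) : contract φ (r * z) = r • contract φ z := by
  induction r using TensorProduct.induction_on with
  | zero => rw [zero_mul, map_zero]; exact (zero_smul (Enveloping K L) (contract φ z)).symm
  | add a b ha hb => simp [add_mul, add_smul, ha, hb]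
  | tmul x y =>
    rw [← MulOpposite.op_unop y, h.contract_mul_left, hz x, contract_mul_right,
      Enveloping.tmul_smul]

/-- Contractions of the inner translates of z by a dual family determine z. For an inner invariant,
the contraction of z alone is then enough, which gives injectivity in `innerInvariantsEquiv`. -/
theorem expand_contract (h : IsSymmetrizing φ b b') (z : Enveloping K L) :
    ∑ k, b k ⊗ₜ[K] op (contract φ (z * (b' k ⊗ₜ[K] op 1))) = z := by
  induction z using TensorProduct.induction_on with
  | zero => simp
  | add x y hx hy =>
    simp only [add_mul, map_add, MulOpposite.op_add, TensorProduct.tmul_add,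
      Finset.sum_add_distrib, hx, hy]
  | tmul x y =>
    conv_rhs => rw [← h.expand x]
    simp [Algebra.TensorProduct.tmul_mul_tmul, h.comm x, TensorProduct.sum_tmul,
      TensorProduct.smul_tmul]

/-- Expanding b k * a in the family b and a * b' l in the family b' produces the same double sum. -/
theorem casimir_mul (h : IsSymmetrizing φ b b') (a : L) :
    ∑ k, (b k * a) ⊗ₜ[K] op (b' k) = ∑ k, b k ⊗ₜ[K] op (a * b' k) := by
  have h1 : ∀ k, (b k * a) ⊗ₜ[K] op (b' k)
      = ∑ l, b l ⊗ₜ[K] op (φ (b k * (a * b' l)) • b' k) := fun k => by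
    conv_lhs => rw [← h.expand (b k * a)]
    rw [TensorProduct.sum_tmul]
    refine Finset.sum_congr rfl fun l _ => ?_
    rw [TensorProduct.smul_tmul, MulOpposite.op_smul, h.comm, mul_assoc]
  simp_rw [h1]
  rw [Finset.sum_comm]
  refine Finset.sum_congr rfl fun l _ => ?_
  rw [← TensorProduct.tmul_sum, ← Finset.op_sum, h.expand' (a * b' l)]

/-- The inner invariants of the enveloping algebra of a symmetric algebra form a bimodule
isomorphic to the algebra. -/
noncomputable def innerInvariantsEquiv (h : IsSymmetrizing φ b b') :
    innerInvariants K L ≃ₗ[Enveloping K L] L :=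
  LinearEquiv.ofBijective
    { toFun := fun z => contract φ z.1
      map_add' := fun z w => map_add _ _ _
      map_smul' := fun r z => h.contract_smul r z.1 z.2 } (by
    constructor
    · refine (injective_iff_map_eq_zero _).2 fun z hz => Subtype.ext ?_
      have hz' : contract φ z.1 = 0 := hz
      rw [← h.expand_contract z.1]
      refine Finset.sum_eq_zero fun k _ => ?_
      rw [z.2 (b' k), contract_mul_right, hz', mul_zero, MulOpposite.op_zero,
        TensorProduct.tmul_zero]
    · intro a
      refine ⟨⟨∑ k, b k ⊗ₜ[K] op (b' k * a), fun x => ?_⟩, ?_⟩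
      · have h1 := congrArg (fun z => (1 ⊗ₜ[K] op a : Enveloping K L) * z) (h.casimir_mul x)
        simpa [Finset.mul_sum, Finset.sum_mul, Algebra.TensorProduct.tmul_mul_tmul, mul_assoc]
          using h1
      · have h1 := h.expand' 1
        simp only [mul_one] at h1
        change contract φ (∑ k, b k ⊗ₜ[K] op (b' k * a)) = a
        rw [map_sum]
        conv_rhs => rw [← one_mul a, ← h1, Finset.sum_mul]
        simp)

end IsSymmetrizing

end Enveloping

/-! ### Words in a path algebra -/

namespace ArrowQuiver

variable {V A : Type*} {Q : ArrowQuiver V A}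

/-- The list of arrows of a path. -/
def Path.toList : {i j : V} → Q.Path i j → List A
  | _, _, .nil _ => []
  | _, _, .cons a p => a :: p.toList

theorem Path.toList_castSrc {i j k : V} (h : i = j) (p : Q.Path j k) :
    (p.castSrc h).toList = p.toList := by
  subst h; rfl

end ArrowQuiver

namespace PathAlgebra

variable {V A : Type*} (K : Type*) [Field K] (Q : ArrowQuiver V A)

/-- The idempotent of a vertex. -/
noncomputable def vertex (i : V) : PathAlgebra K Q := ofPath K Q (.nil i)

theorem ofPath_castSrc {i j k : V} (h : i = j) (p : Q.Path j k) :
    ofPath K Q (p.castSrc h) = ofPath K Q p := by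
  subst h; rfl

/-- The linear map on the path algebra with given values on the paths. -/
noncomputable def ofFun {E : Type*} [AddCommGroup E] [Module K E] (F : Q.AnyPath → E) :
    PathAlgebra K Q →ₗ[K] E :=
  Finsupp.linearCombination K F

theorem ofFun_ofPath {E : Type*} [AddCommGroup E] [Module K E] (F : Q.AnyPath → E) {i j : V}
    (p : Q.Path i j) : ofFun K Q F (ofPath K Q p) = F ⟨i, j, p⟩ := by
  unfold ofFun ofPath
  erw [Finsupp.linearCombination_single, one_smul]

variable [Fintype V]

theorem ofPath_mul_ofPath {i j l : V} (p : Q.Path i j) (r : Q.Path j l) :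
    ofPath K Q p * ofPath K Q r = ofPath K Q (p.comp r) := mulLin_ofPath_comp K Q p r

theorem ofPath_mul_ofPath_ne {i j k l : V} (p : Q.Path i j) (r : Q.Path k l) (h : j ≠ k) :
    ofPath K Q p * ofPath K Q r = 0 := mulLin_ofPath_ne K Q p r h

theorem ofPath_cons (a : A) {j : V} (p : Q.Path (Q.tgt a) j) :
    ofPath K Q (.cons a p) = arrow K Q a * ofPath K Q p := by
  rw [arrow, ofPath_mul_ofPath]; rfl

theorem vertex_mul_ofPath {i j : V} (p : Q.Path i j) :
    vertex K Q i * ofPath K Q p = ofPath K Q p := by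
  rw [vertex, ofPath_mul_ofPath]; rfl

theorem vertex_mul_self (i : V) : vertex K Q i * vertex K Q i = vertex K Q i :=
  vertex_mul_ofPath K Q _

theorem vertex_mul_ne {i j : V} (h : i ≠ j) : vertex K Q i * vertex K Q j = 0 :=
  ofPath_mul_ofPath_ne K Q _ _ h

theorem vertex_mul_ofPath_ne {k i j : V} (p : Q.Path i j) (h : k ≠ i) :
    vertex K Q k * ofPath K Q p = 0 := ofPath_mul_ofPath_ne K Q _ _ h

theorem vertex_src_mul (a : A) : vertex K Q (Q.src a) * arrow K Q a = arrow K Q a :=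
  vertex_mul_ofPath K Q _

theorem arrow_mul_vertex (a : A) : arrow K Q a * vertex K Q (Q.tgt a) = arrow K Q a :=
  (ofPath_cons K Q a _).symm

theorem sum_vertex : ∑ i, vertex K Q i = 1 := rfl

theorem vertex_mul_arrow_ne {i : V} {a : A} (h : i ≠ Q.src a) :
    vertex K Q i * arrow K Q a = 0 := ofPath_mul_ofPath_ne K Q _ _ h

theorem arrow_mul_vertex_ne {i : V} {a : A} (h : Q.tgt a ≠ i) :
    arrow K Q a * vertex K Q i = 0 := ofPath_mul_ofPath_ne K Q _ _ h

theorem arrow_mul_arrow_ne {a b : A} (h : Q.tgt a ≠ Q.src b) :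
    arrow K Q a * arrow K Q b = 0 := ofPath_mul_ofPath_ne K Q _ _ h

/-- The path algebra is generated by vertices and arrows. -/
theorem mul_induction {P : PathAlgebra K Q → Prop} (zero : P 0)
    (add : ∀ x y, P x → P y → P (x + y)) (smul : ∀ (c : K) x, P x → P (c • x))
    (vert : ∀ i, P (vertex K Q i)) (mul : ∀ a x, P x → P (arrow K Q a * x))
    (x : PathAlgebra K Q) : P x := by
  refine PathAlgebra.induction K Q zero add smul (fun i j p => ?_) x
  induction p with
  | nil i => exact vert i
  | cons a p ih => rw [ofPath_cons]; exact mul _ _ ih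

/-- The product of a list of arrows. -/
noncomputable def word (l : List A) : PathAlgebra K Q := (l.map (arrow K Q)).prod

@[simp] theorem word_nil : word K Q [] = 1 := rfl

theorem word_cons (a : A) (l : List A) : word K Q (a :: l) = arrow K Q a * word K Q l := by
  simp [word]

theorem word_append (l l' : List A) : word K Q (l ++ l') = word K Q l * word K Q l' := by
  simp [word]

theorem ofPath_eq {i j : V} (p : Q.Path i j) :
    ofPath K Q p = vertex K Q i * word K Q p.toList := by
  induction p with
  | nil i => exact (mul_one _).symm
  | cons a p ih =>
    rw [ofPath_cons, ih, ArrowQuiver.Path.toList, word_cons, ← mul_assoc, ← mul_assoc,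
      arrow_mul_vertex, vertex_src_mul]

theorem vertex_src_mul_word (a : A) (l : List A) :
    vertex K Q (Q.src a) * word K Q (a :: l) = word K Q (a :: l) := by
  rw [word_cons, ← mul_assoc, vertex_src_mul]

/-- A non-empty word is zero or a path. -/
theorem word_cons_eq (a : A) (l : List A) :
    ((a :: l).IsChain (fun x y => Q.tgt x = Q.src y) ∧
      ∃ (j : V) (p : Q.Path (Q.src a) j), p.toList = a :: l ∧ word K Q (a :: l) = ofPath K Q p) ∨
    (¬ (a :: l).IsChain (fun x y => Q.tgt x = Q.src y) ∧ word K Q (a :: l) = 0) := by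
  induction l generalizing a with
  | nil =>
    refine Or.inl ⟨List.isChain_singleton a, _, .cons a (.nil _), rfl, ?_⟩
    rw [word_cons, word_nil, mul_one]; rfl
  | cons b l ih =>
    by_cases h : Q.tgt a = Q.src b
    · rcases ih b with ⟨hc, j, p, hp, hw⟩ | ⟨hc, hw⟩
      · left
        refine ⟨List.isChain_cons_cons.2 ⟨h, hc⟩, j, .cons a (p.castSrc h), ?_, ?_⟩
        · rw [ArrowQuiver.Path.toList, ← hp]
          exact congrArg _ (ArrowQuiver.Path.toList_castSrc h p)
        · rw [word_cons, hw, ofPath_cons]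
          exact congrArg _ (ofPath_castSrc K Q h p).symm
      · exact Or.inr ⟨fun h' => hc (List.isChain_cons_cons.1 h').2, by rw [word_cons, hw, mul_zero]⟩
    · refine Or.inr ⟨fun h' => h (List.isChain_cons_cons.1 h').1, ?_⟩
      rw [word_cons, word_cons, ← mul_assoc, arrow_mul_arrow_ne K Q h, zero_mul]

/-- The linear form on the path algebra given by a function on lists of arrows. -/
noncomputable def listForm (F : List A → K) : PathAlgebra K Q →ₗ[K] K :=
  ofFun K Q fun p => F p.path.toList

/-- A non-composable word is zero in the path algebra, so F must vanish on it. The empty word is the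
sum of all trivial paths rather than one path, hence the condition on F []. -/
theorem listForm_word (F : List A → K) (h0 : F [] = 0)
    (hF : ∀ l, ¬ l.IsChain (fun x y => Q.tgt x = Q.src y) → F l = 0) (l : List A) :
    listForm K Q F (word K Q l) = F l := by
  cases l with
  | nil =>
    rw [word_nil, ← sum_vertex, map_sum, h0]
    exact Finset.sum_eq_zero fun i _ => (ofFun_ofPath K Q _ _).trans h0
  | cons a l =>
    rcases word_cons_eq K Q a l with ⟨-, j, p, hp, hw⟩ | ⟨hc, hw⟩
    · rw [hw, listForm, ofFun_ofPath, hp]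
    · rw [hw, map_zero, hF _ hc]

/-- A linear form vanishes on the ideal generated by a set if it vanishes on the products of its
elements with paths on both sides. -/
theorem linear_span_eq_zero {E : Type*} [AddCommGroup E] [Module K E]
    (f : PathAlgebra K Q →ₗ[K] E) (s : Set (PathAlgebra K Q))
    (h : ∀ r ∈ s, ∀ x y, f (x * r * y) = 0) (z : PathAlgebra K Q)
    (hz : z ∈ TwoSidedIdeal.span s) : f z = 0 := by
  -- The largest two-sided ideal contained in the kernel of f; it contains s by assumption.
  let J : TwoSidedIdeal (PathAlgebra K Q) := TwoSidedIdeal.mk' {r | ∀ x y, f (x * r * y) = 0}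
    (fun x y => by simp) (fun {r r'} hr hr' x y => by simp [mul_add, add_mul, hr x y, hr' x y])
    (fun {r} hr x y => by simp [hr x y])
    (fun {r r'} hr x y => by rw [← mul_assoc]; exact hr _ _)
    (fun {r r'} hr x y => by rw [← mul_assoc, mul_assoc]; exact hr _ _)
  have h1 : TwoSidedIdeal.span s ≤ J :=
    TwoSidedIdeal.span_le.2 fun r hr => (TwoSidedIdeal.mem_mk' _ _ _ _ _ _ r).2 (h r hr)
  have h2 := (TwoSidedIdeal.mem_mk' _ _ _ _ _ _ z).1 (h1 hz) 1 1
  simpa using h2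

/-! ### The universal derivation -/

variable {K Q} {R : Type*} [Ring R] [Algebra K R] (lf : PathAlgebra K Q →ₐ[K] R)
  (rt : (PathAlgebra K Q)ᵐᵒᵖ →ₐ[K] R)

open Classical in
/-- The value on a path of the derivation from the path algebra to the free bimodule on the
arrows; `lf` and `rt` are the two actions. -/
noncomputable def derivPath : {i j : V} → Q.Path i j → A → R
  | _, _, .nil _ => 0
  | _, _, .cons a p =>
    Pi.single a (lf (vertex K Q (Q.src a)) * rt (op (ofPath K Q p))) +
      lf (arrow K Q a) • derivPath p

/-- The derivation from the path algebra to the free bimodule on the arrows. -/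
noncomputable def deriv : PathAlgebra K Q →ₗ[K] (A → R) :=
  ofFun K Q fun p => derivPath lf rt p.path

theorem deriv_ofPath {i j : V} (p : Q.Path i j) :
    deriv lf rt (ofPath K Q p) = derivPath lf rt p :=
  ofFun_ofPath K Q _ _

@[simp] theorem deriv_vertex (i : V) : deriv lf rt (vertex K Q i) = 0 := deriv_ofPath lf rt _

open Classical in
theorem deriv_arrow (a : A) : deriv lf rt (arrow K Q a)
    = Pi.single a (lf (vertex K Q (Q.src a)) * rt (op (vertex K Q (Q.tgt a)))) := by
  rw [arrow, deriv_ofPath, derivPath, derivPath, smul_zero, add_zero]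
  rfl

theorem vertex_smul_derivPath {i j : V} (p : Q.Path i j) :
    lf (vertex K Q i) • derivPath lf rt p = derivPath lf rt p := by
  classical
  cases p with
  | nil i => rw [derivPath, smul_zero]
  | cons a p =>
    rw [derivPath, smul_add, smul_smul, ← Pi.single_smul, smul_eq_mul, ← mul_assoc, ← map_mul,
      ← map_mul, vertex_mul_self, vertex_src_mul]

theorem deriv_vertex_mul (i : V) (x : PathAlgebra K Q) : deriv lf rt (vertex K Q i * x)
    = lf (vertex K Q i) • deriv lf rt x := by
  induction x using PathAlgebra.induction with
  | zero => simp
  | add x y hx hy => rw [mul_add, map_add, map_add, hx, hy, smul_add]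
  | smul c x hx => rw [mul_smul_comm, map_smul, map_smul, hx, smul_comm]
  | path k j p =>
    rw [deriv_ofPath]
    by_cases h : i = k
    · subst h
      rw [vertex_mul_ofPath, deriv_ofPath, vertex_smul_derivPath]
    · rw [vertex_mul_ofPath_ne _ _ _ h, map_zero, ← vertex_smul_derivPath, smul_smul, ← map_mul,
        vertex_mul_ne _ _ h, map_zero, zero_smul]

theorem deriv_arrow_mul (hc : ∀ x y, Commute (lf x) (rt y)) (a : A) (x : PathAlgebra K Q) : deriv lf rt (arrow K Q a * x)
    = lf (arrow K Q a) • deriv lf rt x + rt (op x) • deriv lf rt (arrow K Q a) := by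
  classical
  induction x using PathAlgebra.induction with
  | zero => simp
  | add x y hx hy =>
    rw [mul_add, map_add, map_add, hx, hy, smul_add, MulOpposite.op_add, map_add, add_smul]
    abel
  | smul c x hx =>
    rw [mul_smul_comm, map_smul, map_smul, hx, smul_comm _ c, MulOpposite.op_smul, map_smul,
      smul_add, smul_assoc]
  | path k j p =>
    rw [deriv_arrow, ← Pi.single_smul, smul_eq_mul, ← mul_assoc, ← (hc _ _).eq, mul_assoc,
      ← map_mul, ← MulOpposite.op_mul]
    by_cases h : Q.tgt a = k
    · subst h
      rw [← ofPath_cons, deriv_ofPath, deriv_ofPath, derivPath, vertex_mul_ofPath, add_comm]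
    · rw [arrow, ofPath_mul_ofPath_ne _ _ _ _ h, vertex_mul_ofPath_ne _ _ _ h, map_zero,
        MulOpposite.op_zero, map_zero, mul_zero, Pi.single_zero, add_zero, deriv_ofPath,
        ← vertex_smul_derivPath, smul_smul, ← map_mul]
      change 0 = lf (arrow K Q a * vertex K Q k) • _
      rw [arrow_mul_vertex_ne _ _ h, map_zero, zero_smul]

/-- `derivPath` peels arrows off on the left, so the Leibniz rule follows by induction on the left
factor from the case of a single arrow. -/
theorem deriv_mul (hc : ∀ x y, Commute (lf x) (rt y)) (x y : PathAlgebra K Q) : deriv lf rt (x * y)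
    = lf x • deriv lf rt y + rt (op y) • deriv lf rt x := by
  induction x using mul_induction with
  | zero => simp
  | add x z hx hz =>
    rw [add_mul, map_add, map_add, map_add, hx, hz, smul_add, add_smul]
    abel
  | smul c x hx =>
    rw [smul_mul_assoc, map_smul, map_smul, map_smul, hx, smul_comm _ c, smul_add, smul_assoc]
  | vert i => rw [deriv_vertex_mul, deriv_vertex, smul_zero, add_zero]
  | mul a x hx =>
    rw [mul_assoc, deriv_arrow_mul lf rt hc, hx, deriv_arrow_mul lf rt hc, smul_add, smul_add,
      smul_smul, smul_smul, smul_smul, smul_smul, map_mul, MulOpposite.op_mul, map_mul,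
      (hc _ _).eq]
    abel

end PathAlgebra

/-! ### The first terms of the bimodule resolution -/

namespace PathAlgebra

variable {V A : Type*} {K : Type*} [Field K] {Q : ArrowQuiver V A} [Fintype V]

section Matrices

variable {R : Type*} [Ring R] [Algebra K R] (lf : PathAlgebra K Q →ₐ[K] R)
  (rt : (PathAlgebra K Q)ᵐᵒᵖ →ₐ[K] R)

/-- The idempotent `e_i ⊗ e_j`. -/
noncomputable def idem (i j : V) : R := lf (vertex K Q i) * rt (op (vertex K Q j))

/-- The idempotent `∑ e_i ⊗ e_i`. -/
noncomputable def diagIdem : R := ∑ i, idem lf rt i i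

/-- The entries `α ⊗ e - e ⊗ α` of the first differential. -/
noncomputable def arrowDiff (a : A) : R :=
  lf (arrow K Q a) * rt (op (vertex K Q (Q.tgt a))) -
    lf (vertex K Q (Q.src a)) * rt (op (arrow K Q a))

theorem rt_mul (x y : PathAlgebra K Q) : rt (op x) * rt (op y) = rt (op (y * x)) := by
  rw [MulOpposite.op_mul, map_mul]

variable {lf rt}

theorem pure_mul_pure (hc : ∀ x y, Commute (lf x) (rt y)) (x x' y y' : PathAlgebra K Q) :
    lf x * rt (op y) * (lf x' * rt (op y')) = lf (x * x') * rt (op (y' * y)) := by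
  rw [mul_assoc, ← mul_assoc (rt _), ← (hc _ _).eq, map_mul, MulOpposite.op_mul, map_mul]
  simp only [mul_assoc]

theorem idem_mul_self (hc : ∀ x y, Commute (lf x) (rt y)) (i j : V) :
    idem lf rt i j * idem lf rt i j = idem lf rt i j := by
  rw [idem, pure_mul_pure hc, vertex_mul_self, vertex_mul_self]

/-- By orthogonality only the summand e_i ⊗ e_i survives: an e_i on one inner side forces an e_i on
the other. -/
theorem pure_mul_diagIdem (hc : ∀ x y, Commute (lf x) (rt y)) (x y : PathAlgebra K Q) (i : V) :
    lf (x * vertex K Q i) * rt (op y) * diagIdem lf rt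
      = lf (x * vertex K Q i) * rt (op (vertex K Q i * y)) := by
  rw [diagIdem, Finset.mul_sum, Finset.sum_eq_single i]
  · rw [idem, pure_mul_pure hc, mul_assoc, vertex_mul_self]
  · intro j _ hj
    rw [idem, pure_mul_pure hc, mul_assoc, vertex_mul_ne K Q hj.symm, mul_zero, map_zero, zero_mul]
  · simp

theorem pure_mul_diagIdem' (hc : ∀ x y, Commute (lf x) (rt y)) (x y : PathAlgebra K Q) (i : V) :
    lf x * rt (op (vertex K Q i * y)) * diagIdem lf rt
      = lf (x * vertex K Q i) * rt (op (vertex K Q i * y)) := by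
  rw [diagIdem, Finset.mul_sum, Finset.sum_eq_single i]
  · rw [idem, pure_mul_pure hc, ← mul_assoc, vertex_mul_self]
  · intro j _ hj
    rw [idem, pure_mul_pure hc, ← mul_assoc, vertex_mul_ne K Q hj, zero_mul, MulOpposite.op_zero,
      map_zero, mul_zero]
  · simp

theorem diagIdem_mul_self (hc : ∀ x y, Commute (lf x) (rt y)) :
    diagIdem lf rt * diagIdem lf rt = diagIdem lf rt := by
  conv_lhs => enter [1]; rw [diagIdem]
  rw [Finset.sum_mul]
  refine Finset.sum_congr rfl fun i _ => ?_
  have := pure_mul_diagIdem hc 1 (vertex K Q i) i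
  rwa [one_mul, vertex_mul_self] at this

theorem arrowDiff_mul_diagIdem (hc : ∀ x y, Commute (lf x) (rt y)) (a : A) :
    arrowDiff lf rt a * diagIdem lf rt = arrowDiff lf rt a := by
  have h1 := pure_mul_diagIdem hc (arrow K Q a) (vertex K Q (Q.tgt a)) (Q.tgt a)
  have h2 := pure_mul_diagIdem' hc (vertex K Q (Q.src a)) (arrow K Q a) (Q.src a)
  rw [arrow_mul_vertex, vertex_mul_self] at h1
  rw [vertex_src_mul, vertex_mul_self] at h2
  rw [arrowDiff, sub_mul, h1, h2]

theorem idem_mul_arrowDiff (hc : ∀ x y, Commute (lf x) (rt y)) (a : A) :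
    idem lf rt (Q.src a) (Q.tgt a) * arrowDiff lf rt a = arrowDiff lf rt a := by
  rw [arrowDiff, mul_sub, idem, pure_mul_pure hc, pure_mul_pure hc, vertex_mul_self,
    vertex_mul_self, vertex_src_mul, arrow_mul_vertex]

theorem arrowDiff_eq (hc : ∀ x y, Commute (lf x) (rt y)) (a : A) :
    arrowDiff lf rt a = (lf (arrow K Q a) - rt (op (arrow K Q a))) * diagIdem lf rt := by
  have h1 := pure_mul_diagIdem hc (arrow K Q a) 1 (Q.tgt a)
  have h2 := pure_mul_diagIdem' hc 1 (arrow K Q a) (Q.src a)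
  rw [arrow_mul_vertex, mul_one, MulOpposite.op_one, map_one, mul_one] at h1
  rw [vertex_src_mul, one_mul, map_one, one_mul] at h2
  rw [sub_mul, h1, h2, arrowDiff]

/-- The telescoping identity αx ⊗ 1 − 1 ⊗ αx = α(x ⊗ 1 − 1 ⊗ x) + (α ⊗ 1 − 1 ⊗ α)x reduces
everything to arrows; for a vertex the difference dies against the diagonal idempotent. -/
theorem sub_mul_diagIdem_mem (hc : ∀ x y, Commute (lf x) (rt y)) (x : PathAlgebra K Q) :
    (lf x - rt (op x)) * diagIdem lf rt ∈ Submodule.span R (Set.range (arrowDiff lf rt)) := by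
  induction x using mul_induction with
  | zero => simp
  | add x y hx hy =>
    have : (lf (x + y) - rt (op (x + y))) * diagIdem lf rt
        = (lf x - rt (op x)) * diagIdem lf rt + (lf y - rt (op y)) * diagIdem lf rt := by
      rw [map_add, MulOpposite.op_add, map_add]; noncomm_ring
    rw [this]
    exact add_mem hx hy
  | smul c x hx =>
    have : (lf (c • x) - rt (op (c • x))) * diagIdem lf rt
        = algebraMap K R c • ((lf x - rt (op x)) * diagIdem lf rt) := by
      rw [map_smul, MulOpposite.op_smul, map_smul, ← smul_sub, smul_mul_assoc, algebraMap_smul]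
    rw [this]
    exact Submodule.smul_mem _ _ hx
  | vert i =>
    have h1 := pure_mul_diagIdem hc (vertex K Q i) 1 i
    have h2 := pure_mul_diagIdem' hc 1 (vertex K Q i) i
    rw [vertex_mul_self, mul_one, MulOpposite.op_one, map_one, mul_one] at h1
    rw [vertex_mul_self, one_mul, map_one, one_mul] at h2
    rw [sub_mul, h1, h2, sub_self]
    exact zero_mem _
  | mul a x hx =>
    have : (lf (arrow K Q a * x) - rt (op (arrow K Q a * x))) * diagIdem lf rt
        = lf (arrow K Q a) • ((lf x - rt (op x)) * diagIdem lf rt)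
          + rt (op x) • arrowDiff lf rt a := by
      rw [arrowDiff_eq hc, map_mul, MulOpposite.op_mul, map_mul, smul_eq_mul, smul_eq_mul, sub_mul,
        sub_mul, sub_mul, mul_sub, mul_sub, ← mul_assoc (rt _) (lf _), ← (hc _ _).eq]
      simp only [mul_assoc]
      abel
    rw [this]
    exact add_mem (Submodule.smul_mem _ _ hx)
      (Submodule.smul_mem _ _ (Submodule.subset_span ⟨a, rfl⟩))

/-- Exactness of the bimodule resolution at the first term, where `μ` is the multiplication
map followed by the right action. -/
theorem mem_span_arrowDiff (hc : ∀ x y, Commute (lf x) (rt y))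
    (hs : AddSubmonoid.closure {z | ∃ x y, z = lf x * rt (op y)} = ⊤) (μ : R →+ R)
    (hμ : ∀ x y, μ (lf x * rt (op y)) = rt (op (x * y))) (z : R) (hz : z * diagIdem lf rt = z)
    (h : μ z = 0) : z ∈ Submodule.span R (Set.range (arrowDiff lf rt)) := by
  -- As μ sends x ⊗ y to 1 ⊗ xy, each w − μ w is a combination of elements x ⊗ 1 − 1 ⊗ x, and μ z =
  -- 0.
  have key : ∀ w ∈ AddSubmonoid.closure {z | ∃ x y, z = lf x * rt (op y)},
      (w - μ w) * diagIdem lf rt ∈ Submodule.span R (Set.range (arrowDiff lf rt)) := by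
    intro w hw
    induction hw using AddSubmonoid.closure_induction with
    | zero => simp
    | add x y _ _ hx hy =>
      have : (x + y - μ (x + y)) * diagIdem lf rt
          = (x - μ x) * diagIdem lf rt + (y - μ y) * diagIdem lf rt := by
        rw [map_add]; noncomm_ring
      rw [this]
      exact add_mem hx hy
    | mem w hw =>
      obtain ⟨x, y, rfl⟩ := hw
      have : (lf x * rt (op y) - μ (lf x * rt (op y))) * diagIdem lf rt
          = rt (op y) • ((lf x - rt (op x)) * diagIdem lf rt) := by
        rw [hμ, smul_eq_mul, ← mul_assoc, mul_sub, rt_mul, (hc _ _).eq]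
      rw [this]
      exact Submodule.smul_mem _ _ (sub_mul_diagIdem_mem hc x)
  have := key z (hs ▸ AddSubmonoid.mem_top z)
  rwa [h, sub_zero, hz] at this

/-- The map θ is a contracting homotopy modulo N: on pure tensors it is u ⊗ v ↦ (du)v, and by the
Leibniz rule it sends r(α ⊗ e − e ⊗ α) to the basis vector at α times r. Applied to a vanishing sum
it puts x in N. -/
theorem mem_span_of_sum_arrowDiff [Fintype A] (hc : ∀ x y, Commute (lf x) (rt y))
    (hs : AddSubmonoid.closure {z | ∃ x y, z = lf x * rt (op y)} = ⊤)
    (N : Submodule R (A → R)) (θ : R →+ (A → R))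
    (hθ : ∀ u v, θ (lf u * rt (op v)) - rt (op v) • deriv lf rt u ∈ N) (x : A → R)
    (hx : ∀ a, x a * idem lf rt (Q.src a) (Q.tgt a) = x a)
    (h : ∑ a, x a * arrowDiff lf rt a = 0) : x ∈ N := by
  classical
  have key : ∀ (a : A), ∀ r ∈ AddSubmonoid.closure {z | ∃ x y, z = lf x * rt (op y)},
      θ (r * arrowDiff lf rt a) - Pi.single a (r * idem lf rt (Q.src a) (Q.tgt a)) ∈ N := by
    intro a r hr
    induction hr using AddSubmonoid.closure_induction with
    | zero => simp
    | add x y _ _ hx hy =>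
      have := add_mem hx hy
      rw [add_mul, map_add, add_mul, Pi.single_add]
      convert this using 1
      abel
    | mem w hw =>
      obtain ⟨u, v, rfl⟩ := hw
      -- The two terms of r(α ⊗ e − e ⊗ α) for r = u ⊗ v; their derivatives uα ↦ u dα + (du)α and u
      -- ↦ du differ exactly by u dα.
      have h1 := sub_mem (hθ (u * arrow K Q a) (vertex K Q (Q.tgt a) * v))
        (hθ (u * vertex K Q (Q.src a)) (arrow K Q a * v))
      convert h1 using 1
      have h2 : rt (op (vertex K Q (Q.tgt a) * v)) • deriv lf rt (u * arrow K Q a)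
          = Pi.single a (lf u * rt (op v) * idem lf rt (Q.src a) (Q.tgt a))
            + rt (op (arrow K Q a * v)) • deriv lf rt (u * vertex K Q (Q.src a)) := by
        rw [deriv_mul _ _ hc, deriv_mul _ _ hc, deriv_vertex,
          smul_zero, zero_add, smul_add, smul_smul, smul_smul, smul_smul, rt_mul, rt_mul,
          ← mul_assoc, ← mul_assoc, arrow_mul_vertex, vertex_src_mul, deriv_arrow,
          ← Pi.single_smul, smul_eq_mul, idem, pure_mul_pure hc,
          ← (hc _ _).eq, pure_mul_pure hc, ← mul_assoc, vertex_mul_self]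
      rw [arrowDiff, mul_sub, pure_mul_pure hc, pure_mul_pure hc, map_sub, h2]
      abel
  have h3 : ∑ a, (θ (x a * arrowDiff lf rt a)
      - Pi.single a (x a * idem lf rt (Q.src a) (Q.tgt a))) ∈ N :=
    sum_mem fun a _ => key a (x a) (hs ▸ AddSubmonoid.mem_top _)
  rw [Finset.sum_sub_distrib, ← map_sum, h, map_zero, zero_sub] at h3
  simp only [hx] at h3
  rw [Finset.univ_sum_single] at h3
  simpa using neg_mem h3

/-- The additive map on a tensor product that acts by the second factor on the image of the
first one. -/
noncomputable def tensorAct {L M E : Type*} [AddCommGroup L] [Module K L] [Ring M]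
    [Algebra K M] [AddCommGroup E] [Module R E] [Module K E] [IsScalarTower K R E]
    (ρ : M →ₐ[K] R) (d : L →ₗ[K] E) : L ⊗[K] M →ₗ[K] E :=
  TensorProduct.lift (LinearMap.mk₂ K (fun u v => ρ v • d u)
    (fun u u' v => by rw [map_add, smul_add])
    (fun k u v => by
      rw [map_smul, ← algebraMap_smul R k (d u), ← algebraMap_smul R k (ρ v • d u), smul_smul,
        smul_smul, Algebra.commutes])
    (fun u v v' => by rw [map_add, add_smul])
    (fun k u v => by rw [map_smul, smul_assoc]))

theorem tensorAct_tmul {L M E : Type*} [AddCommGroup L] [Module K L] [Ring M]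
    [Algebra K M] [AddCommGroup E] [Module R E] [Module K E] [IsScalarTower K R E]
    (ρ : M →ₐ[K] R) (d : L →ₗ[K] E) (u : L) (v : M) : tensorAct ρ d (u ⊗ₜ v) = ρ v • d u := rfl

/-- The kernel of the first differential consists of the derivatives of the relations. -/
theorem mem_span_deriv [Fintype A] {L : Type*} [Ring L] [Algebra K L]
    (hc : ∀ x y, Commute (lf x) (rt y))
    (hs : AddSubmonoid.closure {z | ∃ x y, z = lf x * rt (op y)} = ⊤)
    (q : PathAlgebra K Q →ₐ[K] L) (hq : Function.Surjective q) (ρ : Lᵐᵒᵖ →ₐ[K] R)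
    (hρ : ∀ x, ρ (op (q x)) = rt (op x)) (e : R ≃+ L ⊗[K] Lᵐᵒᵖ)
    (he : ∀ x y, e (lf x * rt (op y)) = q x ⊗ₜ op (q y))
    (x : A → R) (hx : ∀ a, x a * idem lf rt (Q.src a) (Q.tgt a) = x a)
    (h : ∑ a, x a * arrowDiff lf rt a = 0) :
    x ∈ Submodule.span R (deriv lf rt '' {r | q r = 0}) := by
  -- The derivation does not descend to L, but u ↦ d(σ(q u)) does for a linear section σ, and it
  -- differs from d by derivatives of elements of the kernel of q.
  obtain ⟨σ, hσ⟩ := LinearMap.exists_rightInverse_of_surjective q.toLinearMap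
    (LinearMap.range_eq_top.2 hq)
  have hσ' : ∀ y, q (σ y) = y := fun y => LinearMap.congr_fun hσ y
  refine mem_span_of_sum_arrowDiff hc hs _
    ((tensorAct ρ (deriv lf rt ∘ₗ σ)).toAddMonoidHom.comp e.toAddMonoidHom) ?_ x hx h
  intro u v
  have h1 : tensorAct ρ (deriv lf rt ∘ₗ σ) (e (lf u * rt (op v)))
      = rt (op v) • deriv lf rt (σ (q u)) := by
    rw [he, tensorAct_tmul, hρ]; rfl
  refine Eq.subst (motive := fun z => z - rt (op v) • deriv lf rt u ∈ _) h1.symm ?_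
  rw [← smul_sub, ← map_sub]
  refine Submodule.smul_mem _ _ (Submodule.subset_span ⟨_, ?_, rfl⟩)
  change q (σ (q u) - u) = 0
  rw [map_sub, hσ', sub_self]

end Matrices

variable {L : Type*} [Ring L] [Algebra K L] (q : PathAlgebra K Q →ₐ[K] L)

/-- The left action of the path algebra on bimodules over a quotient. -/
noncomputable def envLeft : PathAlgebra K Q →ₐ[K] Enveloping K L :=
  Algebra.TensorProduct.includeLeft.comp q

/-- The right action of the path algebra on bimodules over a quotient. -/
noncomputable def envRight : (PathAlgebra K Q)ᵐᵒᵖ →ₐ[K] Enveloping K L :=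
  Algebra.TensorProduct.includeRight.comp (AlgHom.op q)

theorem envLeft_apply (x : PathAlgebra K Q) : envLeft q x = q x ⊗ₜ[K] op 1 := rfl

theorem envRight_apply (x : PathAlgebra K Q) : envRight q (op x) = 1 ⊗ₜ[K] op (q x) := rfl

theorem envLeft_mul_envRight (x y : PathAlgebra K Q) :
    envLeft q x * envRight q (op y) = q x ⊗ₜ[K] op (q y) := by
  rw [envLeft_apply, envRight_apply, Algebra.TensorProduct.tmul_mul_tmul, mul_one,
    MulOpposite.op_one, one_mul]

theorem env_commute (x : PathAlgebra K Q) (y : (PathAlgebra K Q)ᵐᵒᵖ) :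
    Commute (envLeft q x) (envRight q y) := by
  rw [Commute, SemiconjBy, ← MulOpposite.op_unop y, envLeft_apply, envRight_apply]
  simp [Algebra.TensorProduct.tmul_mul_tmul]

variable {q}

theorem env_induction (hq : Function.Surjective q) {P : Enveloping K L → Prop}
    (add : ∀ x y, P x → P y → P (x + y))
    (pure : ∀ x y, P (envLeft q x * envRight q (op y))) (z : Enveloping K L) : P z := by
  induction z using TensorProduct.induction_on with
  | zero => simpa using pure 0 0
  | add x y hx hy => exact add x y hx hy
  | tmul x y =>
    obtain ⟨x', rfl⟩ := hq x
    obtain ⟨y', hy⟩ := hq (unop y)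
    rw [← MulOpposite.op_unop y, ← hy, ← envLeft_mul_envRight]
    exact pure x' y'

theorem closure_env (hq : Function.Surjective q) :
    AddSubmonoid.closure {z | ∃ x y, z = envLeft q x * envRight q (op y)} = ⊤ := by
  refine top_le_iff.1 fun z _ => ?_
  induction z using env_induction hq with
  | add x y hx hy => exact add_mem (hx trivial) (hy trivial)
  | pure x y => exact AddSubmonoid.subset_closure ⟨x, y, rfl⟩

theorem env_smul_one (x y : PathAlgebra K Q) :
    (envLeft q x * envRight q (op y)) • (1 : L) = q (x * y) := by
  rw [envLeft_mul_envRight, Enveloping.tmul_smul, mul_one, map_mul]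

/-- Exactness of the resolution of a quotient of the path algebra at the first term. -/
theorem mem_span_arrowDiff_of_smul_one (hq : Function.Surjective q) (z : Enveloping K L)
    (hz : z * diagIdem (envLeft q) (envRight q) = z) (h : z • (1 : L) = 0) :
    z ∈ Submodule.span (Enveloping K L) (Set.range (arrowDiff (envLeft q) (envRight q))) := by
  refine mem_span_arrowDiff (env_commute q) (closure_env hq)
    { toFun := fun w => 1 ⊗ₜ[K] op (w • (1 : L))
      map_zero' := ?_
      map_add' := fun x y => ?_ } ?_ z hz ?_
  · have h0 : (0 : Enveloping K L) • (1 : L) = 0 := zero_smul (Enveloping K L) (1 : L)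
    rw [h0, MulOpposite.op_zero, TensorProduct.tmul_zero]
  · rw [add_smul, MulOpposite.op_add, TensorProduct.tmul_add]
  · intro x y
    change 1 ⊗ₜ[K] op ((envLeft q x * envRight q (op y)) • (1 : L)) = _
    rw [env_smul_one, ← envRight_apply]
  · change 1 ⊗ₜ[K] op (z • (1 : L)) = _
    rw [h, MulOpposite.op_zero, TensorProduct.tmul_zero]

/-- The kernel of the first differential of the bimodule resolution consists of the derivatives
of the relations. -/
theorem env_mem_span_deriv [Fintype A] (hq : Function.Surjective q) (x : A → Enveloping K L)
    (hx : ∀ a, x a * idem (envLeft q) (envRight q) (Q.src a) (Q.tgt a) = x a)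
    (h : ∑ a, x a * arrowDiff (envLeft q) (envRight q) a = 0) :
    x ∈ Submodule.span (Enveloping K L) (deriv (envLeft q) (envRight q) '' {r | q r = 0}) :=
  mem_span_deriv (env_commute q) (closure_env hq) q hq Algebra.TensorProduct.includeRight
    (fun _ => rfl) (AddEquiv.refl _) (fun x y => envLeft_mul_envRight q x y) x hx h

end PathAlgebra

/-! ### Combinatorics of triangulation quivers -/

namespace TriangulationQuiver

variable {V A : Type*} (T : TriangulationQuiver V A)

theorem bar_ne (a : A) : T.bar a ≠ a := (T.barFun_spec a).1

theorem src_bar (a : A) : T.src (T.bar a) = T.src a := (T.barFun_spec a).2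

@[simp] theorem bar_bar (a : A) : T.bar (T.bar a) = a := T.barFun_involutive a

theorem eq_or_eq_bar {a b : A} (h : T.src b = T.src a) : b = a ∨ b = T.bar a := by
  by_contra! hcon
  exact hcon.2 ((T.existsUnique_bar a).unique ⟨hcon.1, h⟩ (T.barFun_spec a))

theorem g_apply (a : A) : T.g a = T.bar (T.f a) := rfl

@[simp] theorem bar_f (a : A) : T.bar (T.f a) = T.g a := rfl

@[simp] theorem bar_g (a : A) : T.bar (T.g a) = T.f a := T.bar_bar _

theorem g_ne_f (a : A) : T.g a ≠ T.f a := T.bar_ne _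

theorem src_g (a : A) : T.src (T.g a) = T.tgt a := (T.src_bar _).trans (T.src_f a)

theorem eq_f_or_eq_g {a b : A} (h : T.tgt a = T.src b) : b = T.f a ∨ b = T.g a :=
  T.eq_or_eq_bar (h.symm.trans (T.src_f a).symm)

@[simp] theorem f_f_f (a : A) : T.f (T.f (T.f a)) = a := T.f_cubed a

theorem tgt_f_f (a : A) : T.tgt (T.f (T.f a)) = T.src a := by
  rw [← T.src_f, f_f_f]

@[simp] theorem g_f_f (a : A) : T.g (T.f (T.f a)) = T.bar a := by rw [g_apply, f_f_f]

theorem f_eq_bar {a h : A} (hg : T.g h = a) : T.f h = T.bar a := by rw [← hg, bar_g]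

theorem eq_f_f_bar {a h : A} (hg : T.g h = a) : h = T.f (T.f (T.bar a)) :=
  T.g.injective (by rw [hg, g_f_f, bar_bar])

theorem g_of_f_eq {a : A} (h : T.f a = a) : T.g a = T.bar a := by rw [g_apply, h]

@[simp] theorem orbit_g (a : A) : T.orbit (T.g a) = T.orbit a :=
  Quotient.sound (⟨-1, by simp⟩ : T.g.SameCycle (T.g a) a)

@[simp] theorem orbit_g_pow (k : ℕ) (a : A) : T.orbit ((T.g ^ k) a) = T.orbit a := by
  induction k with
  | zero => rfl
  | succ k ih => rw [pow_succ', Equiv.Perm.mul_apply, orbit_g, ih]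

theorem n_eq_of_orbit_eq {a b : A} (h : T.orbit a = T.orbit b) : T.n a = T.n b := by
  unfold n; rw [h]

theorem g_pow_n [Finite A] (a : A) : (T.g ^ T.n a) a = a := by
  classical
  have := Fintype.ofFinite (MulAction.orbit (Subgroup.zpowers T.g) a)
  have h1 : {b : A | T.orbit b = T.orbit a} = MulAction.orbit (Subgroup.zpowers T.g) a := by
    ext b
    constructor
    · intro h
      obtain ⟨k, hk⟩ : T.g.SameCycle a b := (Quotient.exact h).symm
      exact ⟨⟨T.g ^ k, ⟨k, rfl⟩⟩, hk⟩
    · rintro ⟨⟨_, ⟨k, rfl⟩⟩, hk⟩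
      exact Quotient.sound (Equiv.Perm.SameCycle.symm ⟨k, hk⟩)
  have h2 : T.n a = Function.minimalPeriod (T.g • ·) a := by
    rw [MulAction.minimalPeriod_eq_card, n, h1, Set.ncard_eq_toFinset_card', Set.toFinset_card]
  have h3 := Function.isPeriodicPt_minimalPeriod (T.g • ·) a
  rw [← h2, Function.IsPeriodicPt, Function.IsFixedPt, smul_iterate] at h3
  exact h3

/-- A set closed under `bar` is a union of full vertex stars; f passes from the star at the source
of an arrow to the star at its target and f² passes back, so connectedness applies. -/
theorem eq_univ_of_closed {S : Set A} (hS : S.Nonempty) (hf : ∀ a ∈ S, T.f a ∈ S)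
    (hb : ∀ a ∈ S, T.bar a ∈ S) (a : A) : a ∈ S := by
  obtain ⟨a₀, ha₀⟩ := hS
  have key : ∀ {i : V}, (∃ b ∈ S, T.src b = i) → ∀ b, T.src b = i → b ∈ S := by
    rintro i ⟨b, hb', rfl⟩ c hc
    rcases T.eq_or_eq_bar hc with rfl | rfl
    exacts [hb', hb _ hb']
  have step : ∀ k l : V, (∃ a : A, T.src a = k ∧ T.tgt a = l) →
      ((∃ b ∈ S, T.src b = k) ↔ ∃ b ∈ S, T.src b = l) := by
    rintro k l ⟨c, rfl, rfl⟩
    constructor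
    · intro h
      exact ⟨T.f c, hf _ (key h c rfl), T.src_f c⟩
    · intro h
      have h1 := hf _ (hf _ (key h (T.f c) (T.src_f c)))
      rw [f_f_f] at h1
      exact ⟨c, h1, rfl⟩
  have conn : ∀ k l : V, ((∃ b ∈ S, T.src b = k) ↔ ∃ b ∈ S, T.src b = l) := fun k l => by
    induction T.connected k l with
    | rel k l h => exact step k l h
    | refl => rfl
    | symm _ _ _ h => exact h.symm
    | trans _ _ _ _ _ h h' => exact h.trans h'
  exact key ((conn (T.src a₀) (T.src a)).1 ⟨a₀, ha₀, rfl⟩) a rfl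

theorem exists_src_eq (i : V) : ∃ a, T.src a = i := by
  obtain ⟨x, y, -, h⟩ := Set.ncard_eq_two.1 (T.two_out i)
  have : x ∈ {a : A | T.src a = i} := by rw [h]; simp
  exact ⟨x, this⟩

theorem exists_src_ne_tgt [Fintype V] (hV : 3 ≤ Fintype.card V) : ∃ a, T.src a ≠ T.tgt a := by
  by_contra! hcon
  have : ∀ i j : V, i = j := fun i j => by
    induction T.connected i j with
    | rel k l h => obtain ⟨a, rfl, rfl⟩ := h; exact hcon a
    | refl => rfl
    | symm _ _ _ h => exact h.symm
    | trans _ _ _ _ _ h h' => exact h.trans h'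
  have := Fintype.card_le_one_iff.2 this
  omega

/-- Let α be a border loop, so g(α) = ᾱ. If g³ = id, then the arrow opposite to f(ᾱ) is f²(ᾱ), and
{α, ᾱ, f(ᾱ), f²(ᾱ)} is closed under f and `bar`. These arrows start at no more than two vertices. -/
theorem not_g_cubed_eq [Fintype V] (hV : 3 ≤ Fintype.card V) (hborder : T.border.Nonempty) :
    ¬ ∀ a, T.g (T.g (T.g a)) = a := by
  classical
  intro h
  obtain ⟨_, a, -, -, ha⟩ := hborder
  have h1 : T.bar (T.f (T.bar a)) = T.f (T.f (T.bar a)) := by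
    have e := T.eq_f_f_bar (h a)
    rw [T.g_of_f_eq ha] at e
    exact e
  have h2 := T.eq_univ_of_closed (S := {a, T.bar a, T.f (T.bar a), T.f (T.f (T.bar a))})
    ⟨a, by simp⟩ (by
      rintro _ (rfl | rfl | rfl | rfl)
      · rw [ha]; simp
      · simp
      · simp
      · simp) (by
      rintro _ (rfl | rfl | rfl | rfl)
      · simp
      · simp
      · rw [h1]; simp
      · rw [← h1]; simp)
  have h3 : (Finset.univ : Finset V) ⊆ {T.src a, T.src (T.f (T.bar a))} := by
    intro i _
    obtain ⟨x, rfl⟩ := T.exists_src_eq i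
    rcases h2 x with rfl | rfl | rfl | rfl
    · simp
    · simp [src_bar]
    · simp
    · rw [← h1, src_bar]; simp
  have h4 := Finset.card_le_card h3
  have h5 := Finset.card_le_two (a := T.src a) (b := T.src (T.f (T.bar a)))
  rw [Finset.card_univ] at h4
  omega

/-- Around a vertex, the four relevant `g`-orbits cannot all have period dividing three. -/
theorem not_g_cubed_eq_four [Fintype V] (hV : 3 ≤ Fintype.card V) (hborder : T.border.Nonempty)
    (a : A) : ¬ (T.g (T.g (T.g a)) = a ∧ T.g (T.g (T.g (T.bar a))) = T.bar a ∧
      T.g (T.g (T.g (T.f a))) = T.f a ∧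
      T.g (T.g (T.g (T.f (T.bar a)))) = T.f (T.bar a)) := by
  rintro ⟨h1, h2, h3, h4⟩
  -- The union of the four g-orbits. It is g-stable, and the identities from `key` make it stable
  -- under `bar`, hence under f; so g³ = id everywhere.
  let S : Set A := {x | ∃ y, (y = a ∨ y = T.bar a ∨ y = T.f a ∨ y = T.f (T.bar a)) ∧
    (x = y ∨ x = T.g y ∨ x = T.g (T.g y))}
  have hy : ∀ y, (y = a ∨ y = T.bar a ∨ y = T.f a ∨ y = T.f (T.bar a)) →
      T.g (T.g (T.g y)) = y := by
    rintro y (rfl | rfl | rfl | rfl) <;> assumption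
  have key : ∀ b, T.g (T.g (T.g b)) = b → T.g (T.g (T.g (T.bar b))) = T.bar b →
      T.g (T.g (T.g (T.f b))) = T.f b → T.bar (T.g (T.g b)) = T.g (T.f (T.bar b)) ∧
      T.bar (T.g (T.f b)) = T.g (T.g (T.bar b)) ∧
      T.bar (T.g (T.g (T.f b))) = T.g (T.g (T.f (T.bar b))) := by
    intro b e1 e2 e3
    have e4 : T.bar (T.g (T.g b)) = T.g (T.f (T.bar b)) := by
      rw [T.eq_f_f_bar e1, bar_f]
    refine ⟨e4, ?_, ?_⟩
    · rw [bar_g, T.eq_f_f_bar e2, bar_bar]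
    · rw [T.eq_f_f_bar e3, bar_f, bar_f, ← e4, bar_g]
  obtain ⟨k1, k2, k3⟩ := key a h1 h2 h3
  obtain ⟨l1, l2, l3⟩ := key (T.bar a) h2 (by rwa [bar_bar]) h4
  rw [bar_bar] at l1 l2 l3
  have hbar : ∀ x ∈ S, T.bar x ∈ S := by
    rintro x ⟨y, rfl | rfl | rfl | rfl, rfl | rfl | rfl⟩
    · exact ⟨T.bar x, by simp, by simp⟩
    · exact ⟨T.f y, by simp, by simp⟩
    · exact ⟨T.f (T.bar y), by simp, by simp [k1]⟩
    · exact ⟨a, by simp, by simp⟩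
    · exact ⟨T.f (T.bar a), by simp, by simp⟩
    · exact ⟨T.f a, by simp, by simp [l1]⟩
    · exact ⟨a, by simp, by simp⟩
    · exact ⟨T.bar a, by simp, by rw [k2]; simp⟩
    · exact ⟨T.f (T.bar a), by simp, by rw [k3]; simp⟩
    · exact ⟨T.bar a, by simp, by simp⟩
    · exact ⟨a, by simp, by rw [l2]; simp⟩
    · exact ⟨T.f a, by simp, by rw [l3]; simp⟩
  have hg : ∀ x ∈ S, T.g x ∈ S := by
    rintro x ⟨y, hy', rfl | rfl | rfl⟩
    · exact ⟨x, hy', by simp⟩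
    · exact ⟨y, hy', by simp⟩
    · exact ⟨y, hy', by simp [hy y hy']⟩
  refine T.not_g_cubed_eq hV hborder fun x => ?_
  obtain ⟨y, hy', rfl | rfl | rfl⟩ := T.eq_univ_of_closed (S := S) ⟨a, a, by simp, by simp⟩
    (fun x hx => by have := hbar _ (hg x hx); rwa [bar_g] at this) hbar x
  · exact hy _ hy'
  · rw [hy _ hy']
  · rw [hy _ hy']

/-! ### Lengths and products along orbits -/

section Weights

variable (m : T.GOrbit → ℕ+)

/-- The length `m_α n_α` of the cycle `B_α`. -/
noncomputable def len (a : A) : ℕ := m (T.orbit a) * T.n a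

theorem len_eq_of_orbit_eq {a b : A} (h : T.orbit a = T.orbit b) : T.len m a = T.len m b := by
  rw [len, len, h, T.n_eq_of_orbit_eq h]

@[simp] theorem len_g (a : A) : T.len m (T.g a) = T.len m a :=
  T.len_eq_of_orbit_eq m (T.orbit_g a)

theorem g_pow_len [Finite A] (a : A) : (T.g ^ T.len m a) a = a := by
  rw [len, mul_comm, pow_mul]
  exact Function.IsFixedPt.perm_pow (T.g_pow_n a) _

/-- The last arrow of B_α is the g-preimage of α. -/
theorem g_pow_len_sub_one [Finite A] (a : A) (h : 1 ≤ T.len m a) :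
    (T.g ^ (T.len m a - 1)) a = T.f (T.f (T.bar a)) := by
  apply T.eq_f_f_bar
  rw [← Equiv.Perm.mul_apply, ← pow_succ', Nat.sub_add_cancel h, g_pow_len]

/-- Cycle length 3 at an arrow makes g³ fix it. This is the only place where the border and the
number of vertices enter the comparison of presentations. -/
theorem not_len_eq_three [Finite A] [Fintype V] (hV : 3 ≤ Fintype.card V)
    (hborder : T.border.Nonempty) (a : A) :
    ¬ (T.len m a = 3 ∧ T.len m (T.bar a) = 3 ∧ T.len m (T.f a) = 3 ∧
      T.len m (T.f (T.bar a)) = 3) := by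
  have key : ∀ b, T.len m b = 3 → T.g (T.g (T.g b)) = b := fun b hb => by
    have := T.g_pow_len m b
    rw [hb] at this
    exact this
  rintro ⟨h1, h2, h3, h4⟩
  exact T.not_g_cubed_eq_four hV hborder a ⟨key _ h1, key _ h2, key _ h3, key _ h4⟩

end Weights

/-- The list of the first `l` arrows along the `g`-orbit of an arrow. -/
noncomputable def gList (a : A) (l : ℕ) : List A := (List.range l).map fun k => (T.g ^ k) a

@[simp] theorem length_gList (a : A) (l : ℕ) : (T.gList a l).length = l := by simp [gList]

@[simp] theorem gList_zero (a : A) : T.gList a 0 = [] := rfl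

theorem gList_add (a : A) (k l : ℕ) :
    T.gList a (k + l) = T.gList a k ++ T.gList ((T.g ^ k) a) l := by
  simp only [gList, List.range_add, List.map_append, List.map_map]
  congr 2
  funext j
  simp [← Equiv.Perm.mul_apply, ← pow_add, add_comm]

theorem gList_one (a : A) : T.gList a 1 = [a] := rfl

theorem gList_succ (a : A) (l : ℕ) : T.gList a (l + 1) = a :: T.gList (T.g a) l := by
  rw [add_comm, gList_add]; rfl

theorem gList_succ' (a : A) (l : ℕ) : T.gList a (l + 1) = T.gList a l ++ [(T.g ^ l) a] := by
  rw [gList_add]; rfl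

section Products

variable {S : Type*} [Monoid S] (x : A → S)

/-- The product of the first `l` elements along the `g`-orbit of an arrow. -/
noncomputable def gProd (a : A) (l : ℕ) : S := ((T.gList a l).map x).prod

@[simp] theorem gProd_zero (a : A) : T.gProd x a 0 = 1 := rfl

@[simp] theorem gProd_one (a : A) : T.gProd x a 1 = x a := by simp [gProd, gList_one]

theorem gProd_add (a : A) (k l : ℕ) :
    T.gProd x a (k + l) = T.gProd x a k * T.gProd x ((T.g ^ k) a) l := by
  simp [gProd, gList_add]

theorem gProd_succ (a : A) (l : ℕ) : T.gProd x a (l + 1) = x a * T.gProd x (T.g a) l := by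
  simp [gProd, gList_succ]

theorem gProd_succ' (a : A) (l : ℕ) : T.gProd x a (l + 1) = T.gProd x a l * x ((T.g ^ l) a) := by
  simp [gProd, gList_succ']

theorem map_gProd {S' : Type*} [Monoid S'] {F : Type*} [FunLike F S S'] [MonoidHomClass F S S']
    (q : F) (a : A) (l : ℕ) : q (T.gProd x a l) = T.gProd (fun b => q (x b)) a l := by
  simp [gProd, map_list_prod, Function.comp_def]

end Products

end TriangulationQuiver

/-! ### The relations of socle deformed weighted triangulation algebras -/

namespace TriangulationQuiver

variable {V A : Type*} (T : TriangulationQuiver V A) {K : Type*} [Field K]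
  (m : T.GOrbit → ℕ+) (c : T.GOrbit → Kˣ) (b : T.border → K)

open Classical in
/-- The coefficient of the socle deformation at an arrow, zero unless it is a border loop. -/
noncomputable def borderCoeff (a : A) : K :=
  if h : T.f a = a then b ⟨T.src a, T.src_mem_border h⟩ else 0

variable {T b} in
theorem borderCoeff_eq_zero {a : A} (h : T.f a ≠ a) : T.borderCoeff b a = 0 := dif_neg h

theorem borderCoeff_f (a : A) : T.borderCoeff b (T.f a) = T.borderCoeff b a := by
  by_cases h : T.f a = a
  · rw [h]
  · rw [borderCoeff_eq_zero h, borderCoeff_eq_zero fun h' => h (T.f.injective h')]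

/-- The weight `c_α`. -/
noncomputable def weight (a : A) : K := c (T.orbit a)

theorem weight_ne_zero (a : A) : T.weight c a ≠ 0 := (c _).ne_zero

theorem weight_eq_of_orbit_eq {a a' : A} (h : T.orbit a = T.orbit a') :
    T.weight c a = T.weight c a' := by rw [weight, weight, h]

@[simp] theorem weight_g (a : A) : T.weight c (T.g a) = T.weight c a :=
  T.weight_eq_of_orbit_eq c (T.orbit_g a)

variable {S : Type*} [Ring S] [Algebra K S]

/-- The elements `x` satisfy the defining relations of the socle deformed weighted triangulation
algebra. -/
structure Relations (x : A → S) : Prop where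
  three_le : ∀ a, 3 ≤ T.len m a
  mul_f : ∀ a, x a * x (T.f a) = T.weight c (T.bar a) • T.gProd x (T.bar a) (T.len m (T.bar a) - 1)
    + T.borderCoeff b a • T.gProd x (T.bar a) (T.len m (T.bar a))
  f_g : ∀ a, x a * x (T.f a) * x (T.g (T.f a)) = 0

namespace Relations

variable {T m c b} {x : A → S}

theorem mul_gProd_f (h : T.Relations m c b x) (a : A) {l : ℕ} (hl : 2 ≤ l) :
    x a * T.gProd x (T.f a) l = 0 := by
  obtain ⟨l, rfl⟩ := Nat.exists_eq_add_of_le' hl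
  rw [gProd_succ, gProd_succ, ← mul_assoc, ← mul_assoc, h.f_g, zero_mul]

/-- Replacing g(α)f(g(α)) by paths that start with f(α)g(f(α)) turns the product into multiples of a
zero relation, so the mirrored zero relations need not be imposed. -/
theorem g_f (h : T.Relations m c b x) (a : A) : x a * x (T.g a) * x (T.f (T.g a)) = 0 := by
  have h3 := h.three_le (T.f a)
  rw [mul_assoc, h.mul_f, bar_g, mul_add, mul_smul_comm, mul_smul_comm,
    h.mul_gProd_f a (by omega), h.mul_gProd_f a (by omega), smul_zero, smul_zero, add_zero]

/-- Here B_α ends in u ᾱ with g(u) = ᾱ, and a further factor ᾱ = f(ᾱ) completes the product u g(u)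
f(g(u)) = 0. -/
theorem gProd_len_mul_border [Finite A] (h : T.Relations m c b x) {a : A} (ha : T.f (T.bar a) = T.bar a) :
    T.gProd x a (T.len m a) * x (T.bar a) = 0 := by
  have h3 := h.three_le a
  have h1 := T.g_pow_len_sub_one m a (by omega)
  obtain ⟨l, hl⟩ := Nat.exists_eq_add_of_le' (show 2 ≤ T.len m a by omega)
  rw [hl, show l + 2 - 1 = l + 1 from rfl, ha, ha, pow_succ', Equiv.Perm.mul_apply] at h1
  have h2 := h.g_f ((T.g ^ l) a)
  rw [h1, ha] at h2
  rw [hl, gProd_succ', gProd_succ', pow_succ', Equiv.Perm.mul_apply, h1, mul_assoc, mul_assoc,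
    ← mul_assoc (x _), h2, mul_zero]

/-- Write c_α A_α as ᾱ f(ᾱ) minus the deformation term. The two remaining arrows are f²(ᾱ) and α =
g(f²(ᾱ)), so f(ᾱ) and they form a zero relation, while the deformation term dies by the border case.
-/
theorem gProd_len_add_one [Finite A] (h : T.Relations m c b x) (a : A) :
    T.gProd x a (T.len m a + 1) = 0 := by
  have h3 := h.three_le a
  have h1 := h.mul_f (T.bar a)
  have h4 := T.g_pow_len_sub_one m a (by omega)
  rw [bar_bar] at h1
  have h2 : T.weight c a • T.gProd x a (T.len m a - 1)
      = x (T.bar a) * x (T.f (T.bar a))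
        - T.borderCoeff b (T.bar a) • T.gProd x a (T.len m a) := by
    rw [h1, add_sub_cancel_right]
  have h5 : T.gProd x a (T.len m a + 1)
      = T.gProd x a (T.len m a - 1) * (x (T.f (T.f (T.bar a))) * x a) := by
    rw [gProd_succ', g_pow_len, ← mul_assoc]
    congr 1
    conv_lhs => rw [← Nat.sub_add_cancel (show 1 ≤ T.len m a by omega), gProd_succ', h4]
  have h6 := h.f_g (T.f (T.bar a))
  rw [g_f_f, bar_bar] at h6
  have h7 : T.weight c a • T.gProd x a (T.len m a + 1) = 0 := by
    rw [h5, ← smul_mul_assoc, h2, sub_mul, mul_assoc, ← mul_assoc (x (T.f _)), h6, mul_zero,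
      zero_sub, neg_eq_zero, smul_mul_assoc]
    by_cases hf : T.f (T.bar a) = T.bar a
    · rw [hf, hf, ← mul_assoc, h.gProd_len_mul_border hf, zero_mul, smul_zero]
    · rw [borderCoeff_eq_zero hf, zero_smul]
  exact (smul_eq_zero_iff_right (T.weight_ne_zero c a)).1 h7

theorem gProd_eq_zero [Finite A] (h : T.Relations m c b x) (a : A) {l : ℕ} (hl : T.len m a < l) :
    T.gProd x a l = 0 := by
  obtain ⟨k, rfl⟩ := Nat.exists_eq_add_of_lt hl
  rw [show T.len m a + k + 1 = T.len m a + 1 + k by ring, gProd_add, h.gProd_len_add_one, zero_mul]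

theorem f_triangle [Finite A] (h : T.Relations m c b x) (a : A) :
    x a * x (T.f a) * x (T.f (T.f a)) = T.weight c a • T.gProd x a (T.len m a) := by
  have h3 := h.three_le a
  rw [mul_assoc, h.mul_f, bar_f, weight_g, len_g, mul_add, mul_smul_comm, mul_smul_comm,
    ← gProd_succ, ← gProd_succ, h.gProd_len_add_one, smul_zero, add_zero,
    Nat.sub_add_cancel (by omega)]

/-- Evaluating α f(α) first closes A_ᾱ up to B_ᾱ; `f_triangle` evaluates f(α)f²(α) first and obtains
B_α. In both, the deformation term lands beyond the socle. -/
theorem f_triangle_bar [Finite A] (h : T.Relations m c b x) (a : A) :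
    x a * x (T.f a) * x (T.f (T.f a))
      = T.weight c (T.bar a) • T.gProd x (T.bar a) (T.len m (T.bar a)) := by
  have h3 := h.three_le (T.bar a)
  have h4 := T.g_pow_len_sub_one m (T.bar a) (by omega)
  rw [bar_bar] at h4
  rw [h.mul_f, add_mul, smul_mul_assoc, smul_mul_assoc]
  conv_rhs => rw [← Nat.sub_add_cancel (show 1 ≤ T.len m (T.bar a) by omega), gProd_succ', h4]
  rw [add_eq_left]
  by_cases hf : T.f a = a
  · have h5 := h.gProd_len_mul_border (a := T.bar a) (by rw [bar_bar, hf])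
    rw [bar_bar] at h5
    rw [hf, hf, h5, smul_zero]
  · rw [borderCoeff_eq_zero hf, zero_smul]

/-- Both sides are the triangle at α, so each vertex has a single socle element. -/
theorem socle_bar [Finite A] (h : T.Relations m c b x) (a : A) :
    T.weight c (T.bar a) • T.gProd x (T.bar a) (T.len m (T.bar a))
      = T.weight c a • T.gProd x a (T.len m a) := by
  exact (h.f_triangle_bar a).symm.trans (h.f_triangle a)

theorem mul_gProd_len [Finite A] (h : T.Relations m c b x) {a a' : A} (ha : T.tgt a = T.src a') :
    x a * T.gProd x a' (T.len m a') = 0 := by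
  have h3 := h.three_le a'
  rcases T.eq_f_or_eq_g ha with rfl | rfl
  · exact h.mul_gProd_f a (by omega)
  · rw [← gProd_succ, len_g, h.gProd_len_add_one]

/-- A composable list of at least three arrows that is not a path along a `g`-orbit gives zero,
unless it is a triangle. -/
theorem prod_eq [Finite A] (h : T.Relations m c b x) (l : List A) (hl : 3 ≤ l.length)
    (hch : l.IsChain fun x y => T.tgt x = T.src y) :
    (l.map x).prod = 0 ∨ (∃ a, l = T.gList a l.length) ∨ ∃ a, l = [a, T.f a, T.f (T.f a)] := by
  induction l with
  | nil => simp at hl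
  | cons a l ih =>
    rcases Nat.lt_or_ge l.length 3 with hlt | hge
    · match l, hl, hlt, hch with
      | [a', a''], _, _, hch =>
        simp only [List.isChain_cons_cons] at hch
        rcases T.eq_f_or_eq_g hch.1 with rfl | rfl <;> rcases T.eq_f_or_eq_g hch.2.1 with rfl | rfl
        · exact Or.inr (Or.inr ⟨a, rfl⟩)
        · left
          have := h.f_g a
          simpa [mul_assoc] using this
        · left
          have := h.g_f a
          simpa [mul_assoc] using this
        · exact Or.inr (Or.inl ⟨a, rfl⟩)
    · have hch' := hch.tail
      rw [List.tail_cons] at hch'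
      rcases ih hge hch' with h0 | ⟨a', h1⟩ | ⟨a', h1⟩
      · left
        rw [List.map_cons, List.prod_cons, h0, mul_zero]
      · obtain ⟨k, hk⟩ := Nat.exists_eq_add_of_le' (show 1 ≤ l.length by omega)
        have h2 : T.tgt a = T.src a' := by
          rw [h1, hk, gList_succ, List.isChain_cons_cons] at hch
          exact hch.1
        rcases T.eq_f_or_eq_g h2 with rfl | rfl
        · left
          rw [h1, List.map_cons, List.prod_cons]
          exact h.mul_gProd_f a (by omega)
        · right; left
          exact ⟨a, by rw [List.length_cons, gList_succ, ← h1]⟩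
      · left
        have h2 : T.tgt a = T.src a' := by
          rw [h1, List.isChain_cons_cons] at hch
          exact hch.1
        rw [h1]
        have h3 : ((a :: [a', T.f a', T.f (T.f a')]).map x).prod
            = x a * (x a' * x (T.f a') * x (T.f (T.f a'))) := by
          simp [mul_assoc]
        rw [h3, h.f_triangle, mul_smul_comm, h.mul_gProd_len h2, smul_zero]

/-- Long non-zero words run along a g-orbit, and there the length is bounded by the largest m n. A
common bound exists because there are finitely many arrows. -/
theorem exists_nilpotent [Finite A] (h : T.Relations m c b x) :
    ∃ N, ∀ l : List A, N ≤ l.length → (l.IsChain fun x y => T.tgt x = T.src y) →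
      (l.map x).prod = 0 := by
  obtain ⟨M, hM⟩ := (Set.finite_range (T.len m)).bddAbove
  refine ⟨M + 4, fun l hl hch => ?_⟩
  rcases h.prod_eq l (by omega) hch with h0 | ⟨a, h1⟩ | ⟨a, h1⟩
  · exact h0
  · rw [h1]
    refine h.gProd_eq_zero a ?_
    have : T.len m a ≤ M := hM ⟨a, rfl⟩
    omega
  · rw [h1] at hl
    simp at hl

end Relations

end TriangulationQuiver

/-! ### The symmetrizing form -/

namespace TriangulationQuiver

variable {V A : Type*} (T : TriangulationQuiver V A) {K : Type*} [Field K]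
  (m : T.GOrbit → ℕ+) (c : T.GOrbit → Kˣ) (b : T.border → K)

/-- Since g(α) ≠ f(α), this separates paths along g-orbits from all paths containing some α f(α). -/
theorem gList_consecutive (a : A) (n : ℕ) (u v : List A) (p p' : A)
    (h : T.gList a n = u ++ p :: p' :: v) : p' = T.g p := by
  induction u generalizing a n with
  | nil =>
    match n, h with
    | 0, h => simp at h
    | 1, h => simp [gList_one] at h
    | n + 2, h =>
      rw [gList_succ, gList_succ, List.nil_append, List.cons.injEq, List.cons.injEq] at h
      rw [← h.1, ← h.2.1]
  | cons d u ih =>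
    match n, h with
    | 0, h => simp at h
    | n + 1, h =>
      rw [gList_succ, List.cons_append, List.cons.injEq] at h
      exact ih _ _ h.2

theorem orbit_eq_of_mem_gList {a d : A} {n : ℕ} (h : d ∈ T.gList a n) :
    T.orbit d = T.orbit a := by
  obtain ⟨k, -, rfl⟩ := List.mem_map.1 h
  exact T.orbit_g_pow k a

open Classical in
/-- The values of the symmetrizing form on lists of arrows. -/
noncomputable def socleFun : List A → K
  | [] => 0
  | a :: l =>
    if a :: l = [a, T.f a, T.f (T.f a)] then 1
    else if a :: l = T.gList a (T.len m a) then (T.weight c a)⁻¹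
    else if T.f a = a ∧ l = [a] then T.borderCoeff b a * (T.weight c a)⁻¹
    else 0

theorem socleFun_triangle (a : A) : T.socleFun m c b [a, T.f a, T.f (T.f a)] = 1 := by
  simp [socleFun]

variable {m}

theorem gList_ne_triangle (a d : A) (n : ℕ) : T.gList a n ≠ [d, T.f d, T.f (T.f d)] := fun h =>
  T.g_ne_f d (T.gList_consecutive a n [] [T.f (T.f d)] d (T.f d) h).symm

theorem socleFun_gList_len (hm : ∀ a, 3 ≤ T.len m a) (a : A) :
    T.socleFun m c b (T.gList a (T.len m a)) = (T.weight c a)⁻¹ := by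
  have h3 := hm a
  obtain ⟨k, hk⟩ := Nat.exists_eq_add_of_le' (show 1 ≤ T.len m a by omega)
  have h1 := T.gList_ne_triangle a a (T.len m a)
  rw [hk, gList_succ] at h1 ⊢
  rw [socleFun, if_neg h1, if_pos (by rw [hk, gList_succ])]

theorem socleFun_border (hm : ∀ a, 3 ≤ T.len m a) {a : A} (ha : T.f a = a) :
    T.socleFun m c b [a, a] = T.borderCoeff b a * (T.weight c a)⁻¹ := by
  have h3 := hm a
  rw [socleFun, if_neg (by simp), if_neg, if_pos ⟨ha, rfl⟩]
  intro h
  have := congrArg List.length h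
  rw [length_gList] at this
  simp at this
  omega

theorem socleFun_ne_zero {l : List A} (h : T.socleFun m c b l ≠ 0) :
    (∃ a, l = [a, T.f a, T.f (T.f a)]) ∨ (∃ a, l = T.gList a (T.len m a)) ∨
      ∃ a, T.f a = a ∧ l = [a, a] := by
  cases l with
  | nil => exact absurd rfl h
  | cons a l =>
    rw [socleFun] at h
    split_ifs at h with h1 h2 h3
    · exact Or.inl ⟨a, h1⟩
    · exact Or.inr (Or.inl ⟨a, h2⟩)
    · exact Or.inr (Or.inr ⟨a, h3.1, by rw [h3.2]⟩)
    · exact absurd rfl h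

theorem socleFun_ne_zero_of_four_le {l : List A} (hl : 4 ≤ l.length)
    (h : T.socleFun m c b l ≠ 0) : ∃ a, l = T.gList a (T.len m a) := by
  rcases T.socleFun_ne_zero c b h with ⟨a, rfl⟩ | h | ⟨a, -, rfl⟩
  · simp at hl
  · exact h
  · simp at hl

theorem socleFun_append_f (l : List A) (a : A) (hl : 2 ≤ l.length) :
    T.socleFun m c b (l ++ [a, T.f a]) = 0 := by
  by_contra h
  obtain ⟨d, hd⟩ := T.socleFun_ne_zero_of_four_le c b (by simp; omega) h
  exact T.g_ne_f a (T.gList_consecutive d _ l [] a _ hd.symm).symm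

theorem socleFun_append_gList (l : List A) (a : A) {k : ℕ}
    (hk : 1 ≤ k) (h4 : 4 ≤ l.length + k) (h : T.len m a ≠ l.length + k) :
    T.socleFun m c b (l ++ T.gList a k) = 0 := by
  by_contra hne
  obtain ⟨d, hd⟩ := T.socleFun_ne_zero_of_four_le c b (by simpa using h4) hne
  have h1 : a ∈ T.gList d (T.len m d) := by
    rw [← hd]
    obtain ⟨k, rfl⟩ := Nat.exists_eq_add_of_le' hk
    rw [gList_succ]
    simp
  have h2 := congrArg List.length hd
  rw [length_gList, List.length_append, length_gList] at h2
  rw [T.len_eq_of_orbit_eq m (T.orbit_eq_of_mem_gList h1)] at h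
  exact h h2.symm

theorem isChain_gList (a : A) (n : ℕ) :
    (T.gList a n).IsChain fun x y => T.tgt x = T.src y := by
  induction n generalizing a with
  | zero => exact List.isChain_nil
  | succ n ih =>
    match n, ih with
    | 0, _ => exact List.isChain_singleton a
    | n + 1, ih =>
      rw [gList_succ, gList_succ, List.isChain_cons_cons]
      refine ⟨(T.src_g a).symm, ?_⟩
      rw [← gList_succ]
      exact ih _

/-- A list on which the form does not vanish is a closed path. -/
theorem closed_of_socleFun_ne_zero [Finite A] (hm : ∀ a, 3 ≤ T.len m a) {l : List A}
    (h : T.socleFun m c b l ≠ 0) : (l.IsChain fun x y => T.tgt x = T.src y) ∧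
      ∃ a a' u v, l = a :: u ∧ l = v ++ [a'] ∧ T.tgt a' = T.src a := by
  rcases T.socleFun_ne_zero c b h with ⟨a, rfl⟩ | ⟨a, rfl⟩ | ⟨a, ha, rfl⟩
  · refine ⟨?_, a, T.f (T.f a), _, [a, T.f a], rfl, rfl, T.tgt_f_f a⟩
    simp [List.isChain_cons_cons, T.src_f]
  · have h3 := hm a
    obtain ⟨k, hk⟩ := Nat.exists_eq_add_of_le' (show 1 ≤ T.len m a by omega)
    have h1 := T.g_pow_len m a
    refine ⟨T.isChain_gList _ _, a, (T.g ^ k) a, T.gList (T.g a) k, T.gList a k, ?_, ?_, ?_⟩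
    · rw [hk, gList_succ]
    · rw [hk, gList_succ']
    · rw [← src_g, ← Equiv.Perm.mul_apply, ← pow_succ', ← hk, h1]
  · have : T.tgt a = T.src a := by rw [← src_f, ha]
    refine ⟨?_, a, a, _, [a], rfl, rfl, this⟩
    simp [List.isChain_cons_cons, this]

/-- Rotation preserves each of the three kinds of list in the support: triangles, full cycles (the
weight is constant on g-orbits) and border squares. -/
theorem socleFun_rotate_one [Finite A] (hm : ∀ a, 3 ≤ T.len m a) {l : List A}
    (h : T.socleFun m c b l ≠ 0) : T.socleFun m c b (l.rotate 1) = T.socleFun m c b l := by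
  rcases T.socleFun_ne_zero c b h with ⟨a, rfl⟩ | ⟨a, rfl⟩ | ⟨a, ha, rfl⟩
  · have h1 := T.socleFun_triangle m c b (T.f a)
    rw [f_f_f] at h1
    rw [socleFun_triangle]
    exact h1
  · have h3 := hm a
    obtain ⟨k, hk⟩ := Nat.exists_eq_add_of_le' (show 1 ≤ T.len m a by omega)
    have h1 := T.g_pow_len m a
    have h2 : (T.gList a (T.len m a)).rotate 1 = T.gList (T.g a) (T.len m (T.g a)) := by
      rw [len_g, hk]
      conv_lhs => rw [gList_succ, List.rotate_cons_succ, List.rotate_zero]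
      rw [gList_succ', ← Equiv.Perm.mul_apply, ← pow_succ, ← hk, h1]
    rw [h2, T.socleFun_gList_len c b hm, T.socleFun_gList_len c b hm, weight_g]
  · rfl

theorem socleFun_rotate [Finite A] (hm : ∀ a, 3 ≤ T.len m a) (l : List A) (n : ℕ) :
    T.socleFun m c b (l.rotate n) = T.socleFun m c b l := by
  have key : ∀ (l : List A), T.socleFun m c b l ≠ 0 → ∀ n,
      T.socleFun m c b (l.rotate n) = T.socleFun m c b l := by
    intro l hl n
    induction n with
    | zero => rw [List.rotate_zero]
    | succ n ih =>
      rw [← List.rotate_rotate, T.socleFun_rotate_one c b hm (by rwa [ih]), ih]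
  by_cases h0 : T.socleFun m c b l = 0
  · by_contra hcon
    have h1 : T.socleFun m c b (l.rotate n) ≠ 0 := fun h => hcon (h.trans h0.symm)
    -- Rotating further by this amount totals a multiple of the length, so it returns to l.
    have h2 := key _ h1 (l.length * n - n)
    have hne : 1 ≤ l.length := by
      by_contra hlen
      have : l = [] := List.length_eq_zero_iff.1 (by omega)
      subst this
      exact h1 (by rw [List.rotate_nil]; rfl)
    have : n + (l.length * n - n) = l.length * n := by
      have : n ≤ l.length * n := Nat.le_mul_of_pos_left n hne
      omega
    rw [List.rotate_rotate, this, List.rotate_length_mul, h0] at h2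
    exact h1 h2.symm
  · exact key l h0 n

theorem socleFun_append_comm [Finite A] (hm : ∀ a, 3 ≤ T.len m a) (l l' : List A) :
    T.socleFun m c b (l ++ l') = T.socleFun m c b (l' ++ l) := by
  rw [← T.socleFun_rotate c b hm (l ++ l') l.length, List.rotate_append_length_eq]

/-- The form is compatible with the relations for `α f(α)`. -/
theorem socleFun_mul_f (hm : ∀ a, 3 ≤ T.len m a) (l : List A) (a : A) :
    T.socleFun m c b (l ++ [a, T.f a])
      = T.weight c (T.bar a) * T.socleFun m c b (l ++ T.gList (T.bar a) (T.len m (T.bar a) - 1))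
        + T.borderCoeff b a * T.socleFun m c b (l ++ T.gList (T.bar a) (T.len m (T.bar a))) := by
  have h3 := hm (T.bar a)
  have hw := T.weight_ne_zero c (T.bar a)
  match l with
  | [] =>
    -- A_ᾱ has value zero: it is one arrow too short to be a cycle B, and it contains no arrow
    -- followed by its f-image. What remains matches the border square against the deformation term.
    have h1 : T.socleFun m c b ([] ++ T.gList (T.bar a) (T.len m (T.bar a) - 1)) = 0 := by
      by_contra hne
      rcases T.socleFun_ne_zero c b hne with ⟨d, hd⟩ | ⟨d, hd⟩ | ⟨d, hd, hd'⟩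
      · exact T.gList_ne_triangle _ _ _ hd
      · obtain ⟨k, hk⟩ := Nat.exists_eq_add_of_le' (show 2 ≤ T.len m (T.bar a) by omega)
        have h2 := congrArg List.length hd
        rw [List.nil_append, hk, show k + 2 - 1 = k + 1 from rfl, length_gList, length_gList] at h2
        rw [List.nil_append, hk, show k + 2 - 1 = k + 1 from rfl, ← h2, gList_succ, gList_succ]
          at hd
        rw [(List.cons.inj hd).1] at hk
        omega
      · have := T.gList_consecutive _ _ [] [] d d hd'
        exact T.g_ne_f d (by rw [← this, hd])
    rw [h1, mul_zero, zero_add, List.nil_append, List.nil_append, T.socleFun_gList_len c b hm]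
    by_cases hf : T.f a = a
    · rw [hf, T.socleFun_border c b hm hf, ← T.g_of_f_eq hf, weight_g]
    · rw [borderCoeff_eq_zero hf, zero_mul]
      by_contra hne
      rcases T.socleFun_ne_zero c b hne with ⟨d, hd⟩ | ⟨d, hd⟩ | ⟨d, hd, hd'⟩
      · simp at hd
      · have := congrArg List.length hd
        have := hm d
        simp at *
        omega
      · simp at hd'
        exact hf (hd'.2.trans hd'.1.symm)
  | [h] =>
    rw [T.socleFun_append_gList c b [h] (T.bar a) (k := T.len m (T.bar a)) (by omega)
      (by simp; omega) (by simp), mul_zero, add_zero]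
    -- If α = f(h), then h α f(α) is a triangle and h A_ᾱ is the cycle B_h, so both sides are 1;
    -- otherwise both vanish.
    by_cases hf : a = T.f h
    · have h1 : [h] ++ T.gList (T.bar a) (T.len m (T.bar a) - 1) = T.gList h (T.len m h) := by
        rw [hf, bar_f, len_g]
        rw [hf, bar_f, len_g] at h3
        conv_rhs => rw [← Nat.sub_add_cancel (show 1 ≤ T.len m h by omega), gList_succ]
        rfl
      rw [h1, T.socleFun_gList_len c b hm, hf, bar_f, weight_g]
      rw [hf, bar_f, weight_g] at hw
      rw [mul_inv_cancel₀ hw]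
      exact T.socleFun_triangle m c b h
    · have h1 : T.socleFun m c b ([h] ++ [a, T.f a]) = 0 := by
        by_contra hne
        rcases T.socleFun_ne_zero c b hne with ⟨d, hd⟩ | ⟨d, hd⟩ | ⟨d, hd, hd'⟩
        · simp at hd
          exact hf (by rw [hd.2, hd.1])
        · exact T.g_ne_f a (T.gList_consecutive d _ [h] [] a _ hd.symm).symm
        · simp at hd'
      rw [h1, eq_comm, mul_eq_zero]
      right
      by_contra hne
      obtain ⟨k, hk⟩ := Nat.exists_eq_add_of_le' (show 3 ≤ T.len m (T.bar a) by omega)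
      rw [hk, show k + 3 - 1 = k + 2 from rfl, gList_succ, gList_succ] at hne
      rcases T.socleFun_ne_zero c b hne with ⟨d, hd⟩ | ⟨d, hd⟩ | ⟨d, hd, hd'⟩
      · simp at hd
        exact T.g_ne_f (T.f d) (by rw [← hd.2.1, hd.2.2.1, hd.2.1])
      · have := T.gList_consecutive d _ [] _ h _ hd.symm
        exact hf (by rw [← bar_g, ← this, bar_bar])
      · simp at hd'
  | h :: h' :: l =>
    -- With two or more arrows in front, every list involved has at least four arrows and is too
    -- long, or contains α f(α), so it is not a cycle B.
    rw [T.socleFun_append_f c b _ _ (by simp), eq_comm]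
    rw [T.socleFun_append_gList c b, T.socleFun_append_gList c b, mul_zero, mul_zero,
      add_zero] <;> (try rw [List.length_cons, List.length_cons]) <;> omega

/-- The form is compatible with the zero relations. -/
theorem socleFun_f_g (l : List A) (a : A) :
    T.socleFun m c b (l ++ [a, T.f a, T.g (T.f a)]) = 0 := by
  by_contra hne
  have h0 : ∀ d n, l ++ [a, T.f a, T.g (T.f a)] ≠ T.gList d n := fun d n h =>
    T.g_ne_f a (T.gList_consecutive d n l _ a _ h.symm).symm
  rcases T.socleFun_ne_zero c b hne with ⟨d, hd⟩ | ⟨d, hd⟩ | ⟨d, hd, hd'⟩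
  · have hl : l = [] := by
      have := congrArg List.length hd
      simp at this
      exact this
    subst hl
    simp at hd
    exact T.g_ne_f (T.f a) (by rw [hd.2, hd.1])
  · exact h0 _ _ hd
  · have := congrArg List.length hd'
    simp at this

end TriangulationQuiver

/-! ### Trace forms from cyclically invariant functions on words -/

namespace PathAlgebra

variable {V A : Type*} (K : Type*) [Field K] {Q : ArrowQuiver V A}

theorem toList_comp {i j k : V} (p : Q.Path i j) (r : Q.Path j k) :
    (p.comp r).toList = p.toList ++ r.toList := by
  induction p with
  | nil i => rfl
  | cons a p ih => rw [ArrowQuiver.Path.comp, ArrowQuiver.Path.toList, ih]; rfl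

theorem src_eq_of_toList {i j : V} (p : Q.Path i j) {a : A} {l : List A}
    (h : p.toList = a :: l) : Q.src a = i := by
  cases p with
  | nil => simp [ArrowQuiver.Path.toList] at h
  | cons a' p =>
    rw [ArrowQuiver.Path.toList, List.cons.injEq] at h
    rw [h.1]

theorem eq_of_toList_nil {i j : V} (p : Q.Path i j) (h : p.toList = []) : i = j := by
  cases p with
  | nil => rfl
  | cons a' p => simp [ArrowQuiver.Path.toList] at h

theorem tgt_eq_of_toList {i j : V} (p : Q.Path i j) {a : A} {l : List A}
    (h : p.toList = l ++ [a]) : Q.tgt a = j := by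
  induction p generalizing l with
  | nil => simp [ArrowQuiver.Path.toList] at h
  | cons a' p ih =>
    rw [ArrowQuiver.Path.toList] at h
    cases l with
    | nil =>
      rw [List.nil_append, List.cons.injEq] at h
      rw [← h.1, eq_of_toList_nil p h.2]
    | cons d l =>
      rw [List.cons_append, List.cons.injEq] at h
      exact ih h.2

/-- A symmetric function on lists that is supported on closed paths defines a trace form. -/
theorem listForm_mul_comm [Fintype V] (F : List A → K) (hF : ∀ l l', F (l ++ l') = F (l' ++ l))
    (hcl : ∀ l, F l ≠ 0 → ∃ a a' u v, l = a :: u ∧ l = v ++ [a'] ∧ Q.tgt a' = Q.src a)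
    (x y : PathAlgebra K Q) : listForm K Q F (x * y) = listForm K Q F (y * x) := by
  classical
  have closed : ∀ {i j : V} (p : Q.Path i j), F p.toList ≠ 0 → i = j := by
    intro i j p hp
    obtain ⟨a, a', u, v, h1, h2, h3⟩ := hcl _ hp
    rw [← src_eq_of_toList p h1, ← tgt_eq_of_toList p h2, h3]
  have key : ∀ {i j k l : V} (p : Q.Path i j) (r : Q.Path k l),
      listForm K Q F (ofPath K Q p * ofPath K Q r)
        = if j = k ∧ l = i then F (p.toList ++ r.toList) else 0 := by
    intro i j k l p r
    by_cases h : j = k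
    · subst h
      rw [ofPath_mul_ofPath, listForm, ofFun_ofPath]
      simp only [toList_comp, true_and]
      split_ifs with h'
      · rfl
      · by_contra hne
        exact h' (closed (p.comp r) (by rwa [toList_comp])).symm
    · rw [ofPath_mul_ofPath_ne K Q p r h, map_zero, if_neg fun h' => h h'.1]
  induction x using PathAlgebra.induction with
  | zero => simp
  | add x x' h h' => simp [add_mul, mul_add, h, h']
  | smul c x h => simp [h]
  | path i j p =>
  induction y using PathAlgebra.induction with
  | zero => simp
  | add x x' h h' => simp [add_mul, mul_add, h, h']
  | smul c x h => simp [h]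
  | path k l r =>
    rw [key, key, hF]
    simp only [and_comm]

end PathAlgebra

/-! ### Descent of the symmetrizing form to the quotient -/

namespace TriangulationQuiver

open PathAlgebra

variable {V A : Type*} (T : TriangulationQuiver V A) {K : Type*} [Field K] [Fintype V]
  {m : T.GOrbit → ℕ+} (c : T.GOrbit → Kˣ) (b : T.border → K)

variable (m) in
/-- The symmetrizing form on the path algebra. -/
noncomputable def socleForm : PathAlgebra K T.toArrowQuiver →ₗ[K] K :=
  listForm K T.toArrowQuiver (T.socleFun m c b)

theorem gPath_eq (a : A) (l : ℕ) :
    T.gPath K a l = T.gProd (arrow K T.toArrowQuiver) a l := by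
  simp [gPath, gProd, gList, Function.comp_def]

theorem gProd_arrow (a : A) (l : ℕ) :
    T.gProd (arrow K T.toArrowQuiver) a l = word K T.toArrowQuiver (T.gList a l) := rfl

theorem vertex_mul_gProd (a : A) {l : ℕ} (hl : 1 ≤ l) :
    vertex K T.toArrowQuiver (T.src a) * T.gProd (arrow K T.toArrowQuiver) a l
      = T.gProd (arrow K T.toArrowQuiver) a l := by
  obtain ⟨l, rfl⟩ := Nat.exists_eq_add_of_le' hl
  rw [gProd_succ, ← mul_assoc, vertex_src_mul]

theorem relations_of_map {S : Type*} [Ring S] [Algebra K S]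
    (q : PathAlgebra K T.toArrowQuiver →ₐ[K] S) (hm : ∀ a, 3 ≤ T.len m a)
    (hq : ∀ r, T.Generator K m c b r → q r = 0) :
    T.Relations m c b fun a => q (arrow K T.toArrowQuiver a) := by
  refine ⟨hm, fun a => ?_, fun a => ?_⟩
  · by_cases h : T.f a = a
    · have h1 := hq _ (Generator.border a h)
      rw [map_sub, map_sub, map_smul, map_smul, pathA, pathB, gPath_eq, gPath_eq, map_gProd,
        map_gProd, pow_two, map_mul, sub_sub, sub_eq_zero] at h1
      rw [borderCoeff, dif_pos h, h]
      exact h1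
    · have h1 := hq _ (Generator.nonborder a h)
      rw [map_sub, map_smul, pathA, gPath_eq, map_gProd, map_mul, sub_eq_zero] at h1
      rw [borderCoeff_eq_zero h, zero_smul, add_zero]
      exact h1
  · have h1 := hq _ (Generator.zero a)
    rwa [map_mul, map_mul] at h1

theorem socleForm_word [Finite A] (hm : ∀ a, 3 ≤ T.len m a) (l : List A) :
    T.socleForm m c b (word K T.toArrowQuiver l) = T.socleFun m c b l :=
  listForm_word K T.toArrowQuiver _ rfl (fun l hl => by
    by_contra h
    exact hl (T.closed_of_socleFun_ne_zero c b hm h).1) l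

theorem socleForm_mul_comm [Finite A] (hm : ∀ a, 3 ≤ T.len m a) (x y : PathAlgebra K T.toArrowQuiver) :
    T.socleForm m c b (x * y) = T.socleForm m c b (y * x) :=
  listForm_mul_comm K _ (T.socleFun_append_comm c b hm)
    (fun _ h => (T.closed_of_socleFun_ne_zero c b hm h).2) x y

theorem socleForm_word_mul_generator [Finite A] (hm : ∀ a, 3 ≤ T.len m a) (l : List A) {r : PathAlgebra K T.toArrowQuiver}
    (hr : T.Generator K m c b r) : T.socleForm m c b (word K T.toArrowQuiver l * r) = 0 := by
  have h2 : ∀ a, word K T.toArrowQuiver [a, T.f a]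
      = arrow K T.toArrowQuiver a * arrow K T.toArrowQuiver (T.f a) := fun a => by
    simp [word]
  have h3 : ∀ a, word K T.toArrowQuiver [a, T.f a, T.g (T.f a)]
      = arrow K T.toArrowQuiver a * arrow K T.toArrowQuiver (T.f a)
        * arrow K T.toArrowQuiver (T.g (T.f a)) := fun a => by
    simp [word, mul_assoc]
  cases hr with
  | nonborder a h =>
    rw [pathA, gPath_eq, gProd_arrow, ← h2, mul_sub, mul_smul_comm, ← word_append, ← word_append,
      map_sub, map_smul, T.socleForm_word c b hm, T.socleForm_word c b hm,
      T.socleFun_mul_f c b hm, borderCoeff_eq_zero h, zero_mul, add_zero]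
    exact sub_self _
  | border a h =>
    have e : arrow K T.toArrowQuiver a ^ 2 = word K T.toArrowQuiver [a, T.f a] := by
      rw [h2, h, pow_two]
    rw [pathA, pathB, gPath_eq, gPath_eq, gProd_arrow, gProd_arrow, e, mul_sub, mul_sub,
      mul_smul_comm, mul_smul_comm, ← word_append, ← word_append, ← word_append, map_sub, map_sub,
      map_smul, map_smul, T.socleForm_word c b hm, T.socleForm_word c b hm,
      T.socleForm_word c b hm, T.socleFun_mul_f c b hm, borderCoeff, dif_pos h, sub_sub]
    exact sub_self _
  | zero a => rw [← h3, ← word_append, T.socleForm_word c b hm, T.socleFun_f_g c b]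

/-- Needed because a trivial path is not a word: multiplying a generator by a vertex idempotent
leaves it unchanged or kills it. -/
theorem exists_vertex_mul_generator (hm : ∀ a, 3 ≤ T.len m a) {r : PathAlgebra K T.toArrowQuiver}
    (hr : T.Generator K m c b r) : ∃ i, vertex K T.toArrowQuiver i * r = r := by
  have h1 : ∀ a x, vertex K T.toArrowQuiver (T.src a) * (arrow K T.toArrowQuiver a * x)
      = arrow K T.toArrowQuiver a * x := fun a x => by rw [← mul_assoc, vertex_src_mul]
  have h2 : ∀ a l, 1 ≤ l → vertex K T.toArrowQuiver (T.src a) * T.gPath K (T.bar a) l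
      = T.gPath K (T.bar a) l := fun a l hl => by
    rw [gPath_eq, ← src_bar, T.vertex_mul_gProd _ hl]
  cases hr with
  | nonborder a h =>
    have h3 := hm (T.bar a)
    have h4 := h2 a (T.len m (T.bar a) - 1) (by omega)
    refine ⟨T.src a, ?_⟩
    rw [mul_sub, h1, mul_smul_comm, pathA]
    exact congrArg _ (congrArg _ h4)
  | border a h =>
    have h3 := hm (T.bar a)
    have h4 := h2 a (T.len m (T.bar a) - 1) (by omega)
    have h5 := h2 a (T.len m (T.bar a)) (by omega)
    refine ⟨T.src a, ?_⟩
    rw [pow_two, mul_sub, mul_sub, h1, mul_smul_comm, mul_smul_comm, pathA, pathB]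
    exact congrArg₂ _ (congrArg _ (congrArg _ h4)) (congrArg _ h5)
  | zero a => exact ⟨T.src a, by rw [mul_assoc, h1]⟩

/-- The trace property turns x r y into (y x) r, so only left multiples of the generators by paths
have to be tested. -/
theorem socleForm_eq_zero [Finite A] (hm : ∀ a, 3 ≤ T.len m a) (z : PathAlgebra K T.toArrowQuiver) (hz : z ∈ T.relationIdeal K m c b) :
    T.socleForm m c b z = 0 := by
  refine linear_span_eq_zero K T.toArrowQuiver _ _ (fun r hr x y => ?_) z hz
  rw [T.socleForm_mul_comm c b hm, ← mul_assoc]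
  generalize y * x = x
  induction x using PathAlgebra.induction with
  | zero => simp
  | add x x' h h' => simp [add_mul, h, h']
  | smul c x h => simp [h]
  | path i j p =>
    cases p with
    | nil i =>
      have h0 := T.socleForm_word_mul_generator c b hm [] hr
      rw [word_nil, one_mul] at h0
      obtain ⟨k, hk⟩ := T.exists_vertex_mul_generator c b hm hr
      change T.socleForm m c b (vertex K T.toArrowQuiver i * r) = 0
      by_cases hik : i = k
      · rw [hik, hk, h0]
      · rw [← hk, ← mul_assoc, vertex_mul_ne _ _ hik, zero_mul, map_zero]
    | cons a p =>
      rw [ofPath_eq, ArrowQuiver.Path.toList, vertex_src_mul_word]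
      exact T.socleForm_word_mul_generator c b hm _ hr

end TriangulationQuiver

/-! ### Spanning set, finite dimension and nondegeneracy of the form -/

namespace TriangulationQuiver

open PathAlgebra

variable {V A : Type*} (T : TriangulationQuiver V A) {K : Type*} [Field K]
  {m : T.GOrbit → ℕ+} (c : T.GOrbit → Kˣ) (b : T.border → K)

theorem gList_inj {a a' : A} {n : ℕ} (hn : 1 ≤ n) (h : T.gList a n = T.gList a' n) : a = a' := by
  obtain ⟨n, rfl⟩ := Nat.exists_eq_add_of_le' hn
  rw [gList_succ, gList_succ, List.cons.injEq] at h
  exact h.1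

/-- The pairing of initial and final pieces of the cycles `B_α` is triangular. -/
theorem socleFun_pairing {a a' : A} {l l' : ℕ} (hla : l < T.len m a)
    (hl' : 1 ≤ l')
    (h : T.socleFun m c b (T.gList a' l' ++ T.gList ((T.g ^ l) a) (T.len m a - l)) ≠ 0) :
    (a' = a ∧ l' = l) ∨ (l' = 1 ∧ l + 1 = T.len m a) := by
  obtain ⟨n, hn⟩ : ∃ n, T.len m a - l = n + 1 := ⟨T.len m a - l - 1, by omega⟩
  obtain ⟨k, rfl⟩ := Nat.exists_eq_add_of_le' hl'
  rw [hn] at h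
  rcases T.socleFun_ne_zero c b h with ⟨d, hd⟩ | ⟨d, hd⟩ | ⟨d, -, hd⟩
  · exfalso
    have h1 := congrArg List.length hd
    rw [List.length_append, length_gList, length_gList] at h1
    simp only [List.length_cons, List.length_nil] at h1
    obtain ⟨rfl, rfl⟩ | ⟨rfl, rfl⟩ : (k = 0 ∧ n = 1) ∨ (k = 1 ∧ n = 0) := by omega
    · rw [zero_add, gList_one, gList_succ, gList_succ] at hd
      simp only [List.cons_append, List.nil_append, List.cons.injEq] at hd
      exact T.g_ne_f (T.f d) (by rw [← hd.2.1, hd.2.2.1, hd.2.1])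
    · rw [zero_add, gList_one, gList_succ, gList_succ] at hd
      simp only [List.cons_append, List.cons.injEq] at hd
      exact T.g_ne_f d (by rw [← hd.2.1, hd.1])
  · have h1 := congrArg List.length hd
    rw [List.length_append, length_gList, length_gList, length_gList] at h1
    rw [← h1, T.gList_add d] at hd
    obtain ⟨e1, e2⟩ := List.append_inj hd (by simp)
    have e3 := T.gList_inj (by omega) e1
    have e4 := T.gList_inj (by omega) e2
    subst e3
    have e5 : T.orbit a = T.orbit a' := by
      rw [← T.orbit_g_pow l a, e4, orbit_g_pow]
    have e6 := T.len_eq_of_orbit_eq m e5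
    have e7 : l = k + 1 := by omega
    rw [← e7] at e4
    exact Or.inl ⟨((T.g ^ l).injective e4).symm, e7.symm⟩
  · have h1 := congrArg List.length hd
    rw [List.length_append, length_gList, length_gList] at h1
    simp only [List.length_cons, List.length_nil] at h1
    right
    omega

/-- A choice of an arrow starting at a vertex. -/
noncomputable def outArrow (i : V) : A := (T.exists_src_eq i).choose

theorem src_outArrow (i : V) : T.src (T.outArrow i) = i := (T.exists_src_eq i).choose_spec

variable [Fintype V] {L : Type*} [Ring L] [Algebra K L] {q : PathAlgebra K T.toArrowQuiver →ₐ[K] L}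

variable (m q) in
/-- The socle element at a vertex. -/
noncomputable def socle (i : V) : L :=
  T.weight c (T.outArrow i) •
    q (T.gProd (arrow K T.toArrowQuiver) (T.outArrow i) (T.len m (T.outArrow i)))

variable {T c b}

/-- By `socle_bar` the socle element does not depend on the choice made in `outArrow`. -/
theorem Relations.weight_smul_gProd [Finite A]
    (h : T.Relations m c b fun a => q (arrow K T.toArrowQuiver a)) (a : A) :
    T.weight c a • q (T.gProd (arrow K T.toArrowQuiver) a (T.len m a))
      = T.socle m c q (T.src a) := by
  have h1 := T.src_outArrow (T.src a)
  rw [socle]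
  rcases T.eq_or_eq_bar h1 with h2 | h2
  · rw [h2]
  · rw [h2, map_gProd, map_gProd, h.socle_bar]

theorem Relations.arrow_mul_socle [Finite A]
    (h : T.Relations m c b fun a => q (arrow K T.toArrowQuiver a)) (a : A) (i : V) :
    q (arrow K T.toArrowQuiver a) * T.socle m c q i = 0 := by
  have h3 := h.three_le (T.outArrow i)
  rw [socle, mul_smul_comm]
  by_cases hi : T.tgt a = T.src (T.outArrow i)
  · rw [map_gProd, h.mul_gProd_len hi, smul_zero]
  · obtain ⟨k, hk⟩ := Nat.exists_eq_add_of_le' (show 1 ≤ T.len m (T.outArrow i) by omega)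
    rw [hk, gProd_succ, ← map_mul, ← mul_assoc, arrow_mul_arrow_ne K _ hi, zero_mul, map_zero,
      smul_zero]

theorem vertex_mul_socle (hm : ∀ a, 3 ≤ T.len m a) (i : V) :
    q (vertex K T.toArrowQuiver i) * T.socle m c q i = T.socle m c q i := by
  have h3 := hm (T.outArrow i)
  have h4 := T.vertex_mul_gProd (K := K) (T.outArrow i) (l := T.len m (T.outArrow i)) (by omega)
  rw [src_outArrow] at h4
  rw [socle, mul_smul_comm, ← map_mul, h4]

theorem vertex_mul_socle_ne (hm : ∀ a, 3 ≤ T.len m a) {i j : V} (hij : i ≠ j) :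
    q (vertex K T.toArrowQuiver i) * T.socle m c q j = 0 := by
  rw [← vertex_mul_socle hm j, ← mul_assoc, ← map_mul, vertex_mul_ne _ _ hij, map_zero, zero_mul]

variable (T m c q) in
/-- The spanning family of vertices, socle elements and initial pieces of the cycles `B_α`. -/
noncomputable def spanFamily : V ⊕ V ⊕ (Σ a : A, Fin (T.len m a - 1)) → L
  | .inl i => q (vertex K T.toArrowQuiver i)
  | .inr (.inl i) => T.socle m c q i
  | .inr (.inr p) => q (T.gProd (arrow K T.toArrowQuiver) p.1 (p.2 + 1))

theorem Relations.gProd_mem_span [Finite A]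
    (h : T.Relations m c b fun a => q (arrow K T.toArrowQuiver a)) (a : A) {l : ℕ} (hl : 1 ≤ l) :
    q (T.gProd (arrow K T.toArrowQuiver) a l) ∈
      Submodule.span K (Set.range (T.spanFamily m c q)) := by
  rcases lt_trichotomy l (T.len m a) with h1 | h1 | h1
  · exact Submodule.subset_span ⟨.inr (.inr ⟨a, ⟨l - 1, by omega⟩⟩), by
      simp [spanFamily, Nat.sub_add_cancel hl]⟩
  · have h2 := h.weight_smul_gProd a
    rw [← h1] at h2
    rw [← inv_smul_smul₀ (T.weight_ne_zero c a) (q _), h2]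
    exact Submodule.smul_mem _ _ (Submodule.subset_span ⟨.inr (.inl (T.src a)), rfl⟩)
  · rw [map_gProd, h.gProd_eq_zero a h1]
    exact zero_mem _

/-- The span contains the vertices and is stable under left multiplication by arrows. An arrow in
front of a piece of a cycle lengthens it, kills it, or, if the piece is a single arrow f(α), is
rewritten by the relation for α f(α). -/
theorem Relations.span_spanFamily [Finite A]
    (h : T.Relations m c b fun a => q (arrow K T.toArrowQuiver a)) (hq : Function.Surjective q) :
    Submodule.span K (Set.range (T.spanFamily m c q)) = ⊤ := by
  refine top_le_iff.1 fun y _ => ?_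
  obtain ⟨x, rfl⟩ := hq y
  induction x using PathAlgebra.mul_induction with
  | zero => rw [map_zero]; exact zero_mem _
  | add x y hx hy => rw [map_add]; exact add_mem (hx trivial) (hy trivial)
  | smul c x hx => rw [map_smul]; exact Submodule.smul_mem _ _ (hx trivial)
  | vert i => exact Submodule.subset_span ⟨.inl i, rfl⟩
  | mul a x hx =>
    have hx' := hx trivial
    rw [map_mul]
    generalize q x = x at hx'
    induction hx' using Submodule.span_induction with
    | zero => rw [mul_zero]; exact zero_mem _
    | add x y _ _ hx hy => rw [mul_add]; exact add_mem hx hy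
    | smul c x _ hx => rw [mul_smul_comm]; exact Submodule.smul_mem _ _ hx
    | mem x hx =>
      obtain ⟨i | i | ⟨d, k⟩, rfl⟩ := hx
      · by_cases hi : T.tgt a = i
        · subst hi
          rw [spanFamily, ← map_mul, arrow_mul_vertex]
          have := h.gProd_mem_span a le_rfl
          rwa [gProd_one] at this
        · rw [spanFamily, ← map_mul, arrow_mul_vertex_ne _ _ hi, map_zero]
          exact zero_mem _
      · rw [spanFamily, h.arrow_mul_socle]
        exact zero_mem _
      · rw [spanFamily]
        by_cases hd : T.tgt a = T.src d
        · rcases T.eq_f_or_eq_g hd with h1 | h1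
          · simp only [h1]
            rcases Nat.eq_zero_or_pos k.1 with hk | hk
            · have h3 := h.three_le (T.bar a)
              have h4 := h.mul_f a
              rw [hk, zero_add, gProd_one, h4, ← map_gProd, ← map_gProd]
              exact add_mem (Submodule.smul_mem _ _ (h.gProd_mem_span _ (by omega)))
                (Submodule.smul_mem _ _ (h.gProd_mem_span _ (by omega)))
            · rw [map_gProd, h.mul_gProd_f a (by omega)]
              exact zero_mem _
          · simp only [h1]
            rw [← map_mul, ← gProd_succ]
            exact h.gProd_mem_span a (by omega)
        · rw [gProd_succ, ← map_mul, ← mul_assoc, arrow_mul_arrow_ne K _ hd, zero_mul, map_zero]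
          exact zero_mem _

theorem Relations.finiteDimensional [Finite A]
    (h : T.Relations m c b fun a => q (arrow K T.toArrowQuiver a)) (hq : Function.Surjective q) :
    FiniteDimensional K L :=
  ⟨(Set.finite_range (T.spanFamily m c q)).toFinset, by
    rw [Set.Finite.coe_toFinset, h.span_spanFamily hq]⟩

section Form

variable [Finite A] {φ : L →ₗ[K] K} (hm : ∀ a, 3 ≤ T.len m a)
  (hφ : ∀ x, φ (q x) = T.socleForm m c b x)

theorem form_gProd_mul (hm : ∀ a, 3 ≤ T.len m a) (hφ : ∀ x, φ (q x) = T.socleForm m c b x)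
    (a d : A) (l k : ℕ) :
    φ (q (T.gProd (arrow K T.toArrowQuiver) a l) * q (T.gProd (arrow K T.toArrowQuiver) d k))
      = T.socleFun m c b (T.gList a l ++ T.gList d k) := by
  rw [← map_mul, hφ, gProd_arrow, gProd_arrow, ← word_append, T.socleForm_word c b hm]

theorem form_socle (hm : ∀ a, 3 ≤ T.len m a) (hφ : ∀ x, φ (q x) = T.socleForm m c b x) (i : V) :
    φ (T.socle m c q i) = 1 := by
  rw [socle, map_smul, hφ, gProd_arrow, T.socleForm_word c b hm, T.socleFun_gList_len c b hm,
    smul_eq_mul, mul_inv_cancel₀ (T.weight_ne_zero c _)]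

theorem form_gProd_mul_socle (hm : ∀ a, 3 ≤ T.len m a)
    (hφ : ∀ x, φ (q x) = T.socleForm m c b x) (a : A) {l : ℕ} (hl : 1 ≤ l) (i : V) :
    φ (q (T.gProd (arrow K T.toArrowQuiver) a l) * T.socle m c q i) = 0 := by
  have h3 := hm (T.outArrow i)
  rw [socle, mul_smul_comm, map_smul, form_gProd_mul hm hφ, T.socleFun_append_gList, smul_zero]
  · omega
  · rw [length_gList]; omega
  · rw [length_gList]; omega

/-- The symmetrizing form is nondegenerate. -/
theorem form_nondegenerate (hm : ∀ a, 3 ≤ T.len m a) (hφ : ∀ x, φ (q x) = T.socleForm m c b x)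
    (h : T.Relations m c b fun a => q (arrow K T.toArrowQuiver a)) (hq : Function.Surjective q)
    (hcomm : ∀ x y, φ (x * y) = φ (y * x)) (x : L) (hx : ∀ y, φ (x * y) = 0) : x = 0 := by
  classical
  have := Fintype.ofFinite A
  have hspan := h.span_spanFamily hq
  obtain ⟨r, rfl⟩ := (Submodule.mem_span_range_iff_exists_fun K).1 (hspan ▸ Submodule.mem_top (x := x))
  have hx' : ∀ y, ∑ j, r j * φ (T.spanFamily m c q j * y) = 0 := fun y => by
    have := hx y
    rw [Finset.sum_mul, map_sum] at this
    simpa using this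
  -- The coefficients are eliminated in this order: vertices, single arrows, longer pieces, socle
  -- elements. Pairing with the socle element at i sees only the vertex i.
  have s0 : ∀ i, r (.inl i) = 0 := by
    intro i
    have h1 := hx' (T.socle m c q i)
    rw [Finset.sum_eq_single (.inl i)] at h1
    · rwa [spanFamily, vertex_mul_socle hm, form_socle hm hφ, mul_one] at h1
    · rintro (j | j | ⟨a, k⟩) - hj
      · rw [spanFamily, vertex_mul_socle_ne hm (fun h => hj (by rw [h])), map_zero, mul_zero]
      · have h3 := hm (T.outArrow j)
        rw [spanFamily]
        conv_lhs => enter [2]; rw [socle, smul_mul_assoc, map_smul,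
          form_gProd_mul_socle hm hφ _ (by omega), smul_zero]
        rw [mul_zero]
      · rw [spanFamily, form_gProd_mul_socle hm hφ _ (by omega), mul_zero]
    · simp
  -- An initial piece of B_α is paired with the complementary final piece. The only other
  -- contributions come from border squares: a single arrow against the last arrow of the cycle,
  -- when the piece has length m n − 1.
  have pairing : ∀ (p : Σ a : A, Fin (T.len m a - 1)),
      (∀ p' : Σ a : A, Fin (T.len m a - 1), p' ≠ p → p'.2.1 = 0 → p.2.1 + 2 = T.len m p.1 →
        r (.inr (.inr p')) = 0) → r (.inr (.inr p)) = 0 := by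
    rintro ⟨a, k, hk⟩ hp
    have hka : k + 1 < T.len m a := by omega
    have h1 := hx' (q (T.gProd (arrow K T.toArrowQuiver) ((T.g ^ (k + 1)) a)
      (T.len m a - (k + 1))))
    rw [Finset.sum_eq_single (.inr (.inr ⟨a, ⟨k, hk⟩⟩))] at h1
    · rw [spanFamily, form_gProd_mul hm hφ] at h1
      simp only at h1
      rw [← gList_add, Nat.add_sub_of_le hka.le, T.socleFun_gList_len c b hm] at h1
      exact (mul_eq_zero.1 h1).resolve_right (inv_ne_zero (T.weight_ne_zero c a))
    · rintro (j | j | ⟨a', k', hk'⟩) - hj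
      · rw [s0, zero_mul]
      · have h3 := hm (T.outArrow j)
        rw [spanFamily, hcomm, form_gProd_mul_socle hm hφ _ (by omega), mul_zero]
      · rw [spanFamily, form_gProd_mul hm hφ, mul_eq_zero]
        by_contra! hne
        rcases T.socleFun_pairing c b hka (by omega) hne.2 with ⟨e1, e2⟩ | ⟨e1, e2⟩
        · subst e1
          have : k' = k := by simpa using e2
          subst this
          exact hj rfl
        · refine hne.1 (hp ⟨a', k', hk'⟩ (fun h => hj (by rw [h])) (by simpa using e1) (by
            simp only; omega))
    · simp
  -- For pieces of length one the exceptional case would need m n = 2.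
  have s1 : ∀ p : Σ a : A, Fin (T.len m a - 1), p.2.1 = 0 → r (.inr (.inr p)) = 0 := by
    intro p hp
    refine pairing p fun p' _ _ hp' => ?_
    have := hm p.1
    omega
  have s2 : ∀ p : Σ a : A, Fin (T.len m a - 1), r (.inr (.inr p)) = 0 := fun p =>
    pairing p fun p' _ hp' _ => s1 p' hp'
  have s3 : ∀ i, r (.inr (.inl i)) = 0 := by
    intro i
    have h1 := hx' (q (vertex K T.toArrowQuiver i))
    rw [Finset.sum_eq_single (.inr (.inl i))] at h1
    · rwa [hcomm, spanFamily, vertex_mul_socle hm, form_socle hm hφ, mul_one] at h1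
    · rintro (j | j | p) - hj
      · rw [s0, zero_mul]
      · rw [hcomm, spanFamily, vertex_mul_socle_ne hm (fun h => hj (by rw [h])), map_zero, mul_zero]
      · rw [s2, zero_mul]
    · simp
  refine Finset.sum_eq_zero ?_
  rintro (j | j | p) -
  · rw [s0, zero_smul]
  · rw [s3, zero_smul]
  · rw [s2, zero_smul]

variable (T m c b) in
/-- The symmetrizing form on the algebra. -/
theorem exists_form (hm : ∀ a, 3 ≤ T.len m a) (hq : Function.Surjective q)
    (hker : ∀ z, q z = 0 ↔ z ∈ T.relationIdeal K m c b) :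
    ∃ φ : L →ₗ[K] K, ∀ x, φ (q x) = T.socleForm m c b x := by
  obtain ⟨σ, hσ⟩ := LinearMap.exists_rightInverse_of_surjective q.toLinearMap
    (LinearMap.range_eq_top.2 hq)
  have hσ' : ∀ y, q (σ y) = y := fun y => LinearMap.congr_fun hσ y
  refine ⟨T.socleForm m c b ∘ₗ σ, fun x => ?_⟩
  have h1 := T.socleForm_eq_zero c b hm (σ (q x) - x) ((hker _).1 (by rw [map_sub, hσ', sub_self]))
  rwa [map_sub, sub_eq_zero] at h1

end Form

end TriangulationQuiver

/-! ### A symmetric presentation -/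

theorem mkₐ_eq_zero_iff {K S : Type*} [CommRing K] [Ring S] [Algebra K S] {I : TwoSidedIdeal S}
    {z : S} : RingCon.mkₐ K I.ringCon z = 0 ↔ z ∈ I := by
  rw [TwoSidedIdeal.mem_iff]
  exact RingCon.eq I.ringCon

namespace TriangulationQuiver

open PathAlgebra

variable {V A : Type*} (T : TriangulationQuiver V A) {K : Type*} [Field K]
  (m : T.GOrbit → ℕ+) (c : T.GOrbit → Kˣ) (b : T.border → K)

/-- The coefficient of `α³` in the symmetric presentation. -/
noncomputable def cubeCoeff (a : A) : K := T.borderCoeff b a * (T.weight c a)⁻¹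

variable {c b} in
theorem cubeCoeff_eq_zero {a : A} (h : T.f a ≠ a) : T.cubeCoeff c b a = 0 := by
  rw [cubeCoeff, borderCoeff_eq_zero h, zero_mul]

/-- The relation of the symmetric presentation at an arrow, a cyclic derivative of a potential. -/
noncomputable def potentialRel [Fintype V] (a : A) : PathAlgebra K T.toArrowQuiver :=
  arrow K T.toArrowQuiver (T.f a) * arrow K T.toArrowQuiver (T.f (T.f a))
    - T.cubeCoeff c b a • arrow K T.toArrowQuiver a ^ 3
    - T.weight c a • T.gProd (arrow K T.toArrowQuiver) (T.g a) (T.len m a - 1)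

variable {T m c b} {S : Type*} [Ring S] [Algebra K S] {x : A → S}

theorem cubeCoeff_f_f (a : A) : T.cubeCoeff c b (T.f (T.f a)) = T.cubeCoeff c b a := by
  by_cases h : T.f a = a
  · rw [h, h]
  · rw [T.cubeCoeff_eq_zero h, T.cubeCoeff_eq_zero fun h' => h ?_]
    exact T.f.injective (T.f.injective h')

/-- For a border loop, α³ is the weighted cycle at ᾱ, so the deformation term equals κ α³ with κ = b
/ c; elsewhere both terms vanish. -/
theorem Relations.potential [Finite A] (h : T.Relations m c b x) (a : A) :
    x (T.f a) * x (T.f (T.f a)) = T.cubeCoeff c b a • x a ^ 3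
      + T.weight c a • T.gProd x (T.g a) (T.len m a - 1) := by
  rw [h.mul_f, bar_f, weight_g, len_g, borderCoeff_f, add_comm]
  congr 1
  by_cases hf : T.f a = a
  · have h1 := h.f_triangle_bar a
    rw [hf, hf, ← T.g_of_f_eq hf, weight_g, len_g, ← pow_two, ← pow_succ] at h1
    rw [h1, smul_smul, cubeCoeff, mul_assoc, inv_mul_cancel₀ (T.weight_ne_zero c a), mul_one]
  · rw [borderCoeff_eq_zero hf, T.cubeCoeff_eq_zero hf, zero_smul, zero_smul]

/-- The relations of the symmetric presentation imply the original ones as soon as the products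
of the zero relations with arrows vanish. -/
theorem relations_of_potential [Finite A] (hm : ∀ a, 3 ≤ T.len m a)
    (hns : ∀ a, ¬ (T.len m a = 3 ∧ T.len m (T.bar a) = 3 ∧ T.len m (T.f a) = 3 ∧
      T.len m (T.f (T.bar a)) = 3))
    (hω : ∀ a, x (T.f a) * x (T.f (T.f a)) = T.cubeCoeff c b a • x a ^ 3
      + T.weight c a • T.gProd x (T.g a) (T.len m a - 1))
    (hX : ∀ a d, x d * (x a * x (T.f a) * x (T.g (T.f a))) = 0)
    (hX' : ∀ a d, x a * x (T.f a) * x (T.g (T.f a)) * x d = 0)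
    (hY : ∀ a d, x d * (x a * x (T.g a) * x (T.f (T.g a))) = 0)
    (hY' : ∀ a d, x a * x (T.g a) * x (T.f (T.g a)) * x d = 0)
    (h5 : ∀ a, T.f a = a → x a ^ 5 = 0) : T.Relations m c b x := by
  -- The relation at f²(α), rewritten with f³ = id as a formula for α f(α).
  have hω' : ∀ a, x a * x (T.f a) = T.cubeCoeff c b a • x (T.f (T.f a)) ^ 3
      + T.weight c (T.bar a) • T.gProd x (T.bar a) (T.len m (T.bar a) - 1) := fun a => by
    have h1 := hω (T.f (T.f a))
    have h2 := T.weight_g c (T.f (T.f a))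
    have h3 := T.len_g m (T.f (T.f a))
    rw [g_f_f] at h2 h3
    rwa [f_f_f, cubeCoeff_f_f, g_f_f, ← h2, ← h3] at h1
  -- Write X(α) = α f(α) g(f(α)) and Y(α) = α g(α) f(g(α)). Substituting for α f(α), the cubic term
  -- dies, and A_ᾱ g(f(α)) ends in some Y(u). Any arrow in front of Y(u) kills it, so X(α) can
  -- survive only if m n = 3 at ᾱ and u = ᾱ.
  have keyX : ∀ a, x a * x (T.f a) * x (T.g (T.f a)) ≠ 0 → T.len m (T.bar a) = 3 ∧
      x (T.bar a) * x (T.g (T.bar a)) * x (T.f (T.g (T.bar a))) ≠ 0 := by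
    intro a hne
    have h1 : T.cubeCoeff c b a • x (T.f (T.f a)) ^ 3 * x (T.g (T.f a)) = 0 := by
      by_cases hf : T.f a = a
      · have h2 := hX a a
        rw [hf] at h2 ⊢
        rw [hf, smul_mul_assoc, pow_succ', pow_two, mul_assoc, h2, smul_zero]
      · rw [T.cubeCoeff_eq_zero hf, zero_smul, zero_mul]
    rw [hω', add_mul, h1, zero_add, smul_mul_assoc] at hne
    obtain ⟨k, hk⟩ := Nat.exists_eq_add_of_le' (hm (T.bar a))
    have h2 := T.g_pow_len_sub_one m (T.bar a) (by omega)
    rw [hk, show k + 3 - 1 = k + 1 + 1 from rfl, pow_succ', Equiv.Perm.mul_apply, bar_bar] at h2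
    have h3 := T.f_eq_bar h2
    have h4 : T.gProd x (T.bar a) (T.len m (T.bar a) - 1) * x (T.g (T.f a))
        = T.gProd x (T.bar a) k * (x ((T.g ^ k) (T.bar a)) * x (T.g ((T.g ^ k) (T.bar a)))
          * x (T.f (T.g ((T.g ^ k) (T.bar a))))) := by
      rw [hk, show k + 3 - 1 = k + 1 + 1 from rfl, gProd_succ', gProd_succ', pow_succ',
        Equiv.Perm.mul_apply]
      rw [pow_succ', Equiv.Perm.mul_apply, bar_f] at h3
      rw [h3]
      simp only [mul_assoc]
    rw [h4] at hne
    rcases Nat.eq_zero_or_pos k with rfl | hpos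
    · refine ⟨hk, fun h0 => hne ?_⟩
      rw [gProd_zero, one_mul, pow_zero, Equiv.Perm.one_apply, h0, smul_zero]
    · obtain ⟨j, rfl⟩ := Nat.exists_eq_add_of_le' hpos
      exact absurd (by rw [gProd_succ' T x _ j, mul_assoc, hY, mul_zero, smul_zero]) hne
  -- Symmetrically, Y(α) is a multiple of α A_{f(α)}, which begins with X(α), and any further arrow
  -- kills it.
  have keyY : ∀ a, x a * x (T.g a) * x (T.f (T.g a)) ≠ 0 → T.len m (T.f a) = 3 ∧
      x a * x (T.f a) * x (T.g (T.f a)) ≠ 0 := by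
    intro a hne
    have h1 : x a * T.cubeCoeff c b (T.g a) • x (T.f (T.f (T.g a))) ^ 3 = 0 := by
      by_cases hf : T.f (T.g a) = T.g a
      · have h2 := hY' a (T.g a)
        rw [hf] at h2
        rw [hf, hf, mul_smul_comm, pow_succ, pow_two, ← mul_assoc, ← mul_assoc, h2, smul_zero]
      · rw [T.cubeCoeff_eq_zero hf, zero_smul, mul_zero]
    rw [mul_assoc, hω', mul_add, h1, zero_add, mul_smul_comm, bar_g] at hne
    obtain ⟨k, hk⟩ := Nat.exists_eq_add_of_le' (hm (T.f a))
    rw [hk, show k + 3 - 1 = k + 1 + 1 from rfl, gProd_succ, gProd_succ, ← mul_assoc,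
      ← mul_assoc] at hne
    rcases Nat.eq_zero_or_pos k with rfl | hpos
    · refine ⟨hk, fun h0 => hne ?_⟩
      rw [h0, zero_mul, smul_zero]
    · obtain ⟨j, rfl⟩ := Nat.exists_eq_add_of_le' hpos
      exact absurd (by rw [gProd_succ T x _ j, ← mul_assoc, hX', zero_mul, smul_zero]) hne
  -- Non-vanishing propagates from X(α) to Y(ᾱ), X(ᾱ) and Y(α), collecting length 3 at ᾱ, f(ᾱ), α
  -- and f(α): the excluded configuration.
  have hX0 : ∀ a, x a * x (T.f a) * x (T.g (T.f a)) = 0 := by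
    intro a
    by_contra hne
    obtain ⟨h1, h2⟩ := keyX a hne
    obtain ⟨h3, h4⟩ := keyY _ h2
    obtain ⟨h5, h6⟩ := keyX _ h4
    rw [bar_bar] at h5 h6
    obtain ⟨h7, -⟩ := keyY _ h6
    exact hns a ⟨h5, h1, h7, h3⟩
  refine ⟨hm, fun a => ?_, hX0⟩
  by_cases hf : T.f a = a
  · have h3 := hm (T.bar a)
    have e1 := hω' a
    have e2 := hX0 a
    have e3 : T.gProd x (T.bar a) (T.len m (T.bar a) - 1) * x a
        = T.gProd x (T.bar a) (T.len m (T.bar a)) := by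
      conv_rhs => rw [← Nat.sub_add_cancel (show 1 ≤ T.len m (T.bar a) by omega), gProd_succ',
        T.g_pow_len_sub_one m _ (by omega), bar_bar, hf, hf]
    have e4 : x a * x a * T.gProd x (T.bar a) (T.len m (T.bar a) - 1) = 0 := by
      obtain ⟨k, hk⟩ := Nat.exists_eq_add_of_le' (show 2 ≤ T.len m (T.bar a) by omega)
      rw [hf, T.g_of_f_eq hf] at e2
      rw [hk, show k + 2 - 1 = k + 1 from rfl, gProd_succ, ← mul_assoc, e2, zero_mul]
    rw [hf, hf] at e1
    -- Substituting for one factor α² in α²·α² leaves κ α⁵ = 0, because α² A_ᾱ begins with the zero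
    -- relation α² ᾱ. This identifies α³ with the socle term and converts κ α³ back into the
    -- deformation term.
    have e5 : x a ^ 4 = 0 := by
      have : x a ^ 4 = x a * x a * (x a * x a) := by noncomm_ring
      rw [this]
      nth_rewrite 2 [e1]
      rw [mul_add, mul_smul_comm, mul_smul_comm, e4, smul_zero, add_zero]
      have : x a * x a * x a ^ 3 = x a ^ 5 := by noncomm_ring
      rw [this, h5 a hf, smul_zero]
    have e6 : x a ^ 3 = T.weight c (T.bar a) • T.gProd x (T.bar a) (T.len m (T.bar a)) := by
      rw [pow_succ, pow_two, e1, add_mul, smul_mul_assoc, smul_mul_assoc, ← pow_succ, e5,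
        smul_zero, zero_add, e3]
    rw [hf]
    conv_lhs => rw [e1, e6]
    rw [add_comm, smul_smul, cubeCoeff, ← T.g_of_f_eq hf, weight_g, mul_assoc,
      inv_mul_cancel₀ (T.weight_ne_zero c a), mul_one]
  · rw [hω', T.cubeCoeff_eq_zero hf, borderCoeff_eq_zero hf, zero_smul, zero_smul, zero_add,
      add_zero]

variable [Fintype V]

theorem map_generator_eq_zero {q : PathAlgebra K T.toArrowQuiver →ₐ[K] S}
    (h : T.Relations m c b fun a => q (arrow K T.toArrowQuiver a))
    {r : PathAlgebra K T.toArrowQuiver} (hr : T.Generator K m c b r) : q r = 0 := by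
  cases hr with
  | nonborder a hf =>
    have h1 := h.mul_f a
    rw [borderCoeff_eq_zero hf, zero_smul, add_zero] at h1
    rw [map_sub, map_smul, pathA, gPath_eq, map_gProd, map_mul, h1]
    exact sub_self _
  | border a hf =>
    have h1 := h.mul_f a
    rw [borderCoeff, dif_pos hf, hf] at h1
    rw [map_sub, map_sub, map_smul, map_smul, pathA, pathB, gPath_eq, gPath_eq, map_gProd,
      map_gProd, pow_two, map_mul, h1, sub_sub]
    exact sub_self _
  | zero a => rw [map_mul, map_mul, h.f_g a]

theorem map_potentialRel [Finite A] {q : PathAlgebra K T.toArrowQuiver →ₐ[K] S}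
    (h : T.Relations m c b fun a => q (arrow K T.toArrowQuiver a)) (a : A) :
    q (T.potentialRel m c b a) = 0 := by
  rw [potentialRel, map_sub, map_sub, map_mul, map_smul, map_smul, map_pow, map_gProd,
    h.potential a, add_sub_cancel_left, sub_self]

variable (T m c b) in
/-- The relations of the symmetric presentation together with the products of relations and
arrows. -/
def potentialSet : Set (PathAlgebra K T.toArrowQuiver) :=
  Set.range (T.potentialRel m c b) ∪ {z | ∃ r ∈ T.relationIdeal K m c b, ∃ a,
    z = r * arrow K T.toArrowQuiver a ∨ z = arrow K T.toArrowQuiver a * r}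

/-- The symmetric presentation generates the relations up to decomposable ones. -/
theorem relationIdeal_le [Finite A] (hm : ∀ a, 3 ≤ T.len m a)
    (hns : ∀ a, ¬ (T.len m a = 3 ∧ T.len m (T.bar a) = 3 ∧ T.len m (T.f a) = 3 ∧
      T.len m (T.f (T.bar a)) = 3)) :
    T.relationIdeal K m c b ≤ TwoSidedIdeal.span (T.potentialSet m c b) := by
  set J := TwoSidedIdeal.span (T.potentialSet m c b) with hJ
  let p := RingCon.mkₐ K (T.relationIdeal K m c b).ringCon
  let q := RingCon.mkₐ K J.ringCon
  have hp : ∀ z, p z = 0 ↔ z ∈ T.relationIdeal K m c b := fun z => mkₐ_eq_zero_iff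
  have hq : ∀ z, q z = 0 ↔ z ∈ J := fun z => mkₐ_eq_zero_iff
  have hpr : T.Relations m c b fun a => p (arrow K T.toArrowQuiver a) :=
    T.relations_of_map c b p hm fun r hr => (hp r).2 (TwoSidedIdeal.subset_span hr)
  have hl : ∀ r, p r = 0 → ∀ a, q (arrow K T.toArrowQuiver a) * q r = 0 := fun r hr a => by
    rw [← map_mul]
    exact (hq _).2 (TwoSidedIdeal.subset_span (Or.inr ⟨r, (hp r).1 hr, a, Or.inr rfl⟩))
  have hr : ∀ r, p r = 0 → ∀ a, q r * q (arrow K T.toArrowQuiver a) = 0 := fun r hr a => by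
    rw [← map_mul]
    exact (hq _).2 (TwoSidedIdeal.subset_span (Or.inr ⟨r, (hp r).1 hr, a, Or.inl rfl⟩))
  have hX : ∀ a, p (arrow K T.toArrowQuiver a * arrow K T.toArrowQuiver (T.f a)
      * arrow K T.toArrowQuiver (T.g (T.f a))) = 0 := fun a => by
    rw [map_mul, map_mul, hpr.f_g a]
  have hY : ∀ a, p (arrow K T.toArrowQuiver a * arrow K T.toArrowQuiver (T.g a)
      * arrow K T.toArrowQuiver (T.f (T.g a))) = 0 := fun a => by
    rw [map_mul, map_mul, hpr.g_f a]
  have hqr : T.Relations m c b fun a => q (arrow K T.toArrowQuiver a) := by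
    refine relations_of_potential hm hns (fun a => ?_) (fun a d => ?_) (fun a d => ?_)
      (fun a d => ?_) (fun a d => ?_) (fun a ha => ?_)
    · have h1 := (hq _).2 (TwoSidedIdeal.subset_span (Or.inl ⟨a, rfl⟩) :
        T.potentialRel m c b a ∈ J)
      rw [potentialRel, map_sub, map_sub, map_mul, map_smul, map_smul, map_pow, map_gProd, sub_sub,
        sub_eq_zero] at h1
      exact h1
    · have := hl _ (hX a) d
      rwa [map_mul, map_mul] at this
    · have := hr _ (hX a) d
      rwa [map_mul, map_mul] at this
    · have := hl _ (hY a) d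
      rwa [map_mul, map_mul] at this
    · have := hr _ (hY a) d
      rwa [map_mul, map_mul] at this
    -- In the original quotient α³ is a socle element, so α⁴ lies in I and α⁵ lies in I·α.
    · have h1 : p (arrow K T.toArrowQuiver a ^ 4) = 0 := by
        have h2 := hpr.f_triangle a
        have h4 : T.tgt a = T.src a := by rw [← src_f, ha]
        rw [ha, ha] at h2
        have h3 : p (arrow K T.toArrowQuiver a ^ 4)
            = p (arrow K T.toArrowQuiver a) * (p (arrow K T.toArrowQuiver a)
              * p (arrow K T.toArrowQuiver a) * p (arrow K T.toArrowQuiver a)) := by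
          rw [map_pow]; noncomm_ring
        rw [h3, h2, mul_smul_comm, hpr.mul_gProd_len h4, smul_zero]
      have := hr _ h1 a
      rwa [map_pow, ← pow_succ] at this
  exact TwoSidedIdeal.span_le.2 fun r hr' => (hq r).1 (map_generator_eq_zero hqr hr')

/-- The derivatives of all relations are generated by those of the symmetric presentation. -/
theorem span_deriv_eq [Finite A] {R : Type*} [Ring R] [Algebra K R] [IsNoetherianRing R]
    (lf : PathAlgebra K T.toArrowQuiver →ₐ[K] R) (rt : (PathAlgebra K T.toArrowQuiver)ᵐᵒᵖ →ₐ[K] R)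
    (hc : ∀ x y, Commute (lf x) (rt y))
    (hlf : ∀ z ∈ T.relationIdeal K m c b, lf z = 0)
    (hrt : ∀ z ∈ T.relationIdeal K m c b, rt (op z) = 0)
    (jl : ∀ a, lf (arrow K T.toArrowQuiver a) ∈ Ring.jacobson R)
    (jr : ∀ a, rt (op (arrow K T.toArrowQuiver a)) ∈ Ring.jacobson R)
    (hω : ∀ a, T.potentialRel m c b a ∈ T.relationIdeal K m c b)
    (hm : ∀ a, 3 ≤ T.len m a)
    (hns : ∀ a, ¬ (T.len m a = 3 ∧ T.len m (T.bar a) = 3 ∧ T.len m (T.f a) = 3 ∧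
      T.len m (T.f (T.bar a)) = 3)) :
    Submodule.span R (deriv lf rt '' {z | z ∈ T.relationIdeal K m c b})
      ≤ Submodule.span R (Set.range fun a => deriv lf rt (T.potentialRel m c b a)) := by
  set N := Submodule.span R (deriv lf rt '' {z | z ∈ T.relationIdeal K m c b}) with hN
  set N' := Submodule.span R (Set.range fun a => deriv lf rt (T.potentialRel m c b a)) with hN'
  -- Relations act as zero, so on I the derivation is a bimodule map. In particular the derivatives
  -- of I·α and α·I land in the radical times N.
  have hd : ∀ r ∈ T.relationIdeal K m c b, ∀ u v,
      deriv lf rt (u * r * v) = lf u • rt (op v) • deriv lf rt r := by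
    intro r hr u v
    have h1 := TwoSidedIdeal.mul_mem_right _ r v hr
    rw [mul_assoc, deriv_mul lf rt hc, deriv_mul lf rt hc, hlf r hr, hrt _ h1, zero_smul, zero_smul,
      add_zero, zero_add]
  have key : ∀ z ∈ T.relationIdeal K m c b, deriv lf rt z ∈ N' ⊔ Ring.jacobson R • N := by
    intro z hz
    have h1 := linear_span_eq_zero K T.toArrowQuiver
      (((N' ⊔ Ring.jacobson R • N).mkQ.restrictScalars K) ∘ₗ deriv lf rt) (T.potentialSet m c b)
      ?_ z (relationIdeal_le hm hns hz)
    · exact (Submodule.Quotient.mk_eq_zero _).1 h1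
    · rintro r hr u v
      refine (Submodule.Quotient.mk_eq_zero _).2 ?_
      rcases hr with ⟨a, rfl⟩ | ⟨r, hr, a, rfl | rfl⟩
      · rw [hd _ (hω a)]
        exact Submodule.mem_sup_left (Submodule.smul_mem _ _ (Submodule.smul_mem _ _
          (Submodule.subset_span ⟨a, rfl⟩)))
      · rw [hd _ (TwoSidedIdeal.mul_mem_right _ _ _ hr), deriv_mul lf rt hc, hlf r hr, zero_smul,
          zero_add]
        exact Submodule.mem_sup_right (Submodule.smul_mem _ _ (Submodule.smul_mem _ _
          (Submodule.smul_mem_smul (jr a) (Submodule.subset_span ⟨r, hr, rfl⟩))))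
      · rw [hd _ (TwoSidedIdeal.mul_mem_left _ _ _ hr), deriv_mul lf rt hc, hrt r hr, zero_smul,
          add_zero]
        exact Submodule.mem_sup_right (Submodule.smul_mem _ _ (Submodule.smul_mem _ _
          (Submodule.smul_mem_smul (jl a) (Submodule.subset_span ⟨r, hr, rfl⟩))))
  have hNle : N ≤ N' ⊔ Ring.jacobson R • N := by
    rw [hN, Submodule.span_le]
    rintro _ ⟨z, hz, rfl⟩
    exact key z hz
  -- Nakayama's lemma for the finitely generated module N modulo N'.
  have hbot : N.map N'.mkQ = ⊥ := by
    refine Submodule.FG.eq_bot_of_le_jacobson_smul ((IsNoetherian.noetherian N).map _) ?_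
    rw [← Submodule.map_smul'']
    refine (Submodule.map_mono hNle).trans ?_
    rw [Submodule.map_sup, Submodule.mkQ_map_self, bot_sup_eq]
  intro x hx
  have := Submodule.mem_map_of_mem (f := N'.mkQ) hx
  rw [hbot] at this
  exact (Submodule.Quotient.mk_eq_zero _).1 ((Submodule.mem_bot R).1 this)

end TriangulationQuiver

/-! ### Symmetry of the second differential -/

namespace PathAlgebra

variable {V A : Type*} {K : Type*} [Field K] {Q : ArrowQuiver V A} [Fintype V]
  {R : Type*} [Ring R] [Algebra K R] {lf : PathAlgebra K Q →ₐ[K] R}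
  {rt : (PathAlgebra K Q)ᵐᵒᵖ →ₐ[K] R}

theorem deriv_arrow_apply [DecidableEq A] (a a' : A) : deriv lf rt (arrow K Q a) a'
    = if a' = a then idem lf rt (Q.src a) (Q.tgt a) else 0 := by
  rw [deriv_arrow]
  by_cases h : a' = a
  · subst h; simp [idem]
  · simp [h]

theorem deriv_mul_idem (hc : ∀ x y, Commute (lf x) (rt y)) (x : PathAlgebra K Q) (a : A) :
    deriv lf rt x a * idem lf rt (Q.src a) (Q.tgt a) = deriv lf rt x a := by
  classical
  induction x using mul_induction with
  | zero => simp
  | add x y hx hy => rw [map_add, Pi.add_apply, add_mul, hx, hy]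
  | smul k x hx => rw [map_smul, Pi.smul_apply, smul_mul_assoc, hx]
  | vert i => rw [deriv_vertex, Pi.zero_apply, zero_mul]
  | mul a' x hx =>
    rw [deriv_mul _ _ hc, Pi.add_apply, Pi.smul_apply, Pi.smul_apply, deriv_arrow_apply, add_mul,
      smul_mul_assoc, smul_mul_assoc, hx]
    split_ifs with h
    · rw [h, idem_mul_self hc]
    · rw [zero_mul]

theorem sub_mul_diagIdem_vertex (hc : ∀ x y, Commute (lf x) (rt y)) (i : V) :
    (lf (vertex K Q i) - rt (op (vertex K Q i))) * diagIdem lf rt = 0 := by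
  have h1 := pure_mul_diagIdem hc (vertex K Q i) 1 i
  have h2 := pure_mul_diagIdem' hc 1 (vertex K Q i) i
  rw [vertex_mul_self, mul_one, MulOpposite.op_one, map_one, mul_one] at h1
  rw [vertex_mul_self, one_mul, map_one, one_mul] at h2
  rw [sub_mul, h1, h2, sub_self]

/-- The first differential turns the universal derivation into the inner one. -/
theorem sum_deriv_mul_arrowDiff [Fintype A] (hc : ∀ x y, Commute (lf x) (rt y))
    (x : PathAlgebra K Q) : ∑ a, deriv lf rt x a * arrowDiff lf rt a
      = (lf x - rt (op x)) * diagIdem lf rt := by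
  classical
  induction x using mul_induction with
  | zero => simp
  | add x y hx hy =>
    simp only [map_add, Pi.add_apply, add_mul, Finset.sum_add_distrib, hx, hy, MulOpposite.op_add]
    noncomm_ring
  | smul k x hx =>
    simp only [map_smul, Pi.smul_apply, smul_mul_assoc, ← Finset.smul_sum, hx,
      MulOpposite.op_smul, ← smul_sub]
  | vert i => simp [sub_mul_diagIdem_vertex hc]
  | mul a x hx =>
    have h1 : ∑ a', deriv lf rt (arrow K Q a) a' * arrowDiff lf rt a' = arrowDiff lf rt a := by
      rw [Finset.sum_eq_single a (fun a' _ h => by rw [deriv_arrow_apply, if_neg h, zero_mul])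
        (by simp), deriv_arrow_apply, if_pos rfl, idem_mul_arrowDiff hc]
    simp only [deriv_mul _ _ hc, Pi.add_apply, Pi.smul_apply, add_mul, smul_mul_assoc,
      Finset.sum_add_distrib, ← Finset.smul_sum, hx, h1]
    rw [arrowDiff_eq hc, map_mul, MulOpposite.op_mul, map_mul, smul_eq_mul, smul_eq_mul, sub_mul,
      sub_mul, sub_mul, mul_sub, mul_sub, ← mul_assoc (rt _) (lf _), ← (hc _ _).eq]
    simp only [mul_assoc]
    abel

end PathAlgebra

namespace TriangulationQuiver

open PathAlgebra

variable {V A : Type*} {T : TriangulationQuiver V A} {K : Type*} [Field K] [Fintype V]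
  {R : Type*} [Ring R] [Algebra K R] {lf : PathAlgebra K T.toArrowQuiver →ₐ[K] R}
  {rt : (PathAlgebra K T.toArrowQuiver)ᵐᵒᵖ →ₐ[K] R}

variable (T K) in
/-- The path of a given length along the `g`-orbit of an arrow. -/
noncomputable def cut (a : A) (l : ℕ) : PathAlgebra K T.toArrowQuiver :=
  vertex K T.toArrowQuiver (T.src a) * T.gProd (arrow K T.toArrowQuiver) a l

theorem arrow_mul_cut (a : A) (l : ℕ) :
    arrow K T.toArrowQuiver a * T.cut K (T.g a) l = T.cut K a (l + 1) := by
  rw [cut, cut, gProd_succ, src_g, ← mul_assoc, ← mul_assoc, arrow_mul_vertex, vertex_src_mul]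

/-- One term (left part) ⊗ (right part) for each occurrence of a' in the path. The vertex factor in
`cut` makes a part of length zero an idempotent e_i instead of 1. -/
theorem deriv_cut [DecidableEq A] (hc : ∀ x y, Commute (lf x) (rt y)) (a a' : A) (l : ℕ) :
    deriv lf rt (T.cut K a l) a' = ∑ k ∈ Finset.range l, if a' = (T.g ^ k) a then
      lf (T.cut K a k) * rt (op (T.cut K ((T.g ^ (k + 1)) a) (l - 1 - k))) else 0 := by
  induction l generalizing a with
  | zero => simp [cut]
  | succ l ih =>
    rw [← arrow_mul_cut, deriv_mul _ _ hc, Pi.add_apply, Pi.smul_apply, Pi.smul_apply, ih,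
      deriv_arrow_apply, Finset.sum_range_succ', smul_eq_mul, smul_eq_mul, Finset.mul_sum]
    congr 1
    · refine Finset.sum_congr rfl fun k hk => ?_
      have hk' := Finset.mem_range.1 hk
      rw [pow_succ T.g (k + 1), Equiv.Perm.mul_apply, pow_succ T.g k, Equiv.Perm.mul_apply,
        Equiv.Perm.mul_apply,
        ← arrow_mul_cut a k, map_mul, mul_assoc, mul_ite, mul_zero,
        show l + 1 - 1 - (k + 1) = l - 1 - k by omega]
    · rw [pow_zero, Equiv.Perm.one_apply, zero_add, pow_one, mul_ite, mul_zero, idem, ← mul_assoc,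
        ← (hc _ _).eq, mul_assoc, rt_mul]
      simp [cut, src_g, ← mul_assoc, vertex_mul_self]

section Symmetry

variable {m : T.GOrbit → ℕ+} {c : T.GOrbit → Kˣ} {b : T.border → K} (τ : R →ₗ[K] R)
  (hτ : ∀ x y, τ (lf x * rt (op y)) = lf y * rt (op x))

/-- An occurrence of α' in the cycle through α splits it as α p α' r and contributes p ⊗ r; seen
from α' it contributes r ⊗ p. The reflection k ↦ m n − 2 − k matches the positions. -/
theorem deriv_cut_symm [Finite A] (hc : ∀ x y, Commute (lf x) (rt y)) (hm : ∀ a, 3 ≤ T.len m a)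
    (hτ : ∀ x y, τ (lf x * rt (op y)) = lf y * rt (op x)) (a a' : A) :
    T.weight c a • deriv lf rt (T.cut K (T.g a) (T.len m a - 1)) a'
      = T.weight c a' • τ (deriv lf rt (T.cut K (T.g a') (T.len m a' - 1)) a) := by
  classical
  rw [deriv_cut hc, deriv_cut hc]
  by_cases h : T.orbit a' = T.orbit a
  · rw [T.weight_eq_of_orbit_eq c h, T.len_eq_of_orbit_eq m h, map_sum]
    congr 1
    rw [← Finset.sum_range_reflect]
    refine Finset.sum_congr rfl fun k hk => ?_
    have hk' := Finset.mem_range.1 hk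
    have h3 := hm a
    have hM := T.g_pow_len m a
    have hM' := T.g_pow_len m a'
    rw [T.len_eq_of_orbit_eq m h] at hM'
    have e1 : ∀ j (x : A), (T.g ^ j) (T.g x) = (T.g ^ (j + 1)) x := fun j x => by
      rw [pow_succ, Equiv.Perm.mul_apply]
    simp only [e1]
    have e2 : (a' = (T.g ^ (T.len m a - 1 - 1 - k + 1)) a) ↔ a = (T.g ^ (k + 1)) a' := by
      constructor
      · intro h1
        rw [h1, ← Equiv.Perm.mul_apply, ← pow_add,
          show k + 1 + (T.len m a - 1 - 1 - k + 1) = T.len m a by omega, hM]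
      · intro h1
        have h2 : (T.g ^ (T.len m a - 1 - 1 - k + 1)) a
            = (T.g ^ (T.len m a - 1 - 1 - k + 1)) ((T.g ^ (k + 1)) a') := congrArg _ h1
        rw [h2, ← Equiv.Perm.mul_apply, ← pow_add,
          show T.len m a - 1 - 1 - k + 1 + (k + 1) = T.len m a by omega, hM']
    by_cases h1 : a = (T.g ^ (k + 1)) a'
    · rw [if_pos h1, if_pos (e2.2 h1), hτ]
      have h2 : (T.g ^ (T.len m a - 1 - 1 - k + 1 + 1)) a = T.g a' := by
        rw [pow_succ', Equiv.Perm.mul_apply, ← e2.2 h1]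
      have h4 : (T.g ^ (k + 1 + 1)) a' = T.g a := by
        rw [pow_succ', Equiv.Perm.mul_apply, ← h1]
      rw [h2, h4, show T.len m a - 1 - 1 - (T.len m a - 1 - 1 - k) = k by omega]
    · rw [if_neg h1, if_neg fun h2 => h1 (e2.1 h2), map_zero]
  · rw [Finset.sum_eq_zero, Finset.sum_eq_zero, smul_zero, map_zero, smul_zero]
    · intro k _
      refine if_neg fun h1 => h ?_
      rw [h1, orbit_g_pow, orbit_g]
    · intro k _
      refine if_neg fun h1 => h ?_
      rw [h1, orbit_g_pow, orbit_g]

theorem deriv_f_mul_f [DecidableEq A] (hc : ∀ x y, Commute (lf x) (rt y)) (a a' : A) :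
    deriv lf rt (arrow K T.toArrowQuiver (T.f a) * arrow K T.toArrowQuiver (T.f (T.f a))) a'
      = (if a' = T.f (T.f a) then
          lf (arrow K T.toArrowQuiver (T.f a)) * rt (op (vertex K T.toArrowQuiver (T.src a)))
          else 0)
        + if a' = T.f a then
          lf (vertex K T.toArrowQuiver (T.tgt a)) * rt (op (arrow K T.toArrowQuiver (T.f (T.f a))))
          else 0 := by
  have h1 := arrow_mul_vertex K T.toArrowQuiver (T.f a)
  have h2 := vertex_src_mul K T.toArrowQuiver (T.f (T.f a))
  rw [deriv_mul _ _ hc, Pi.add_apply, Pi.smul_apply, Pi.smul_apply, deriv_arrow_apply,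
    deriv_arrow_apply, smul_eq_mul, smul_eq_mul, mul_ite, mul_ite, mul_zero, mul_zero, idem, idem,
    ← mul_assoc, ← map_mul, src_f, h1, tgt_f_f, src_f, ← mul_assoc, ← (hc _ _).eq, mul_assoc,
    rt_mul]
  rw [src_f] at h2
  rw [h2]

theorem deriv_f_mul_f_symm (hc : ∀ x y, Commute (lf x) (rt y))
    (hτ : ∀ x y, τ (lf x * rt (op y)) = lf y * rt (op x)) (a a' : A) :
    deriv lf rt (arrow K T.toArrowQuiver (T.f a) * arrow K T.toArrowQuiver (T.f (T.f a))) a'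
      = τ (deriv lf rt (arrow K T.toArrowQuiver (T.f a')
        * arrow K T.toArrowQuiver (T.f (T.f a'))) a) := by
  classical
  rw [deriv_f_mul_f hc, deriv_f_mul_f hc, map_add, add_comm]
  have e1 : ∀ a a' : A, a' = T.f a ↔ a = T.f (T.f a') := fun a a' =>
    ⟨fun h => by rw [h, f_f_f], fun h => by rw [h, f_f_f]⟩
  congr 1
  · by_cases h : a' = T.f a
    · rw [if_pos h, if_pos ((e1 a a').1 h), hτ, h, src_f]
    · rw [if_neg h, if_neg fun h' => h ((e1 a a').2 h'), map_zero]
  · by_cases h : a = T.f a'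
    · rw [if_pos h, if_pos ((e1 a' a).1 h), hτ, h, src_f]
    · rw [if_neg h, if_neg fun h' => h ((e1 a' a).2 h'), map_zero]

/-- Only the diagonal entry at a border loop matters, and α² ⊗ e + α ⊗ α + e ⊗ α² is invariant under
the swap. -/
theorem deriv_cube_symm (hc : ∀ x y, Commute (lf x) (rt y))
    (hτ : ∀ x y, τ (lf x * rt (op y)) = lf y * rt (op x)) (a a' : A) :
    T.cubeCoeff c b a • deriv lf rt (arrow K T.toArrowQuiver a ^ 3) a'
      = T.cubeCoeff c b a' • τ (deriv lf rt (arrow K T.toArrowQuiver a' ^ 3) a) := by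
  classical
  have e0 : ∀ d d' : A, deriv lf rt (arrow K T.toArrowQuiver d ^ 3) d'
      = if d' = d then lf (arrow K T.toArrowQuiver d ^ 2) * idem lf rt (T.src d) (T.tgt d)
        + rt (op (arrow K T.toArrowQuiver d)) * (lf (arrow K T.toArrowQuiver d)
          * idem lf rt (T.src d) (T.tgt d) + rt (op (arrow K T.toArrowQuiver d))
          * idem lf rt (T.src d) (T.tgt d)) else 0 := fun d d' => by
    rw [pow_succ, deriv_mul _ _ hc, pow_two, deriv_mul _ _ hc]
    simp only [Pi.add_apply, Pi.smul_apply, deriv_arrow_apply, smul_eq_mul]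
    split_ifs <;> simp
  by_cases h : a' = a
  · subst h
    by_cases hf : T.f a' = a'
    · have ht : T.tgt a' = T.src a' := by rw [← src_f, hf]
      have h1 := vertex_src_mul K T.toArrowQuiver a'
      have h2 := arrow_mul_vertex K T.toArrowQuiver a'
      rw [ht] at h2
      congr 1
      set x := arrow K T.toArrowQuiver a' with hx
      set e := vertex K T.toArrowQuiver (T.src a') with he
      have e1 : deriv lf rt (x ^ 3) a' = lf (x * x) * rt (op e) + lf x * rt (op x)
          + lf e * rt (op (x * x)) := by
        have e2 : ∀ y, rt (op y) * (lf e * rt (op e)) = lf e * rt (op (e * y)) := fun y => by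
          rw [← mul_assoc, ← (hc _ _).eq, mul_assoc, rt_mul]
        rw [e0, if_pos rfl, ht, idem, ← he, pow_two, mul_add, ← mul_assoc, ← mul_assoc (lf x),
          ← map_mul, ← map_mul, h2, mul_assoc x x e, h2, e2, h1, ← mul_assoc, ← mul_assoc,
          ← (hc _ _).eq, ← (hc _ _).eq, mul_assoc, mul_assoc, rt_mul, rt_mul, h1, add_assoc]
      rw [e1, map_add, map_add, hτ, hτ, hτ]
      abel
    · rw [T.cubeCoeff_eq_zero hf, zero_smul, zero_smul]
  · rw [e0, e0, if_neg h, if_neg (Ne.symm h), map_zero, smul_zero, smul_zero]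

/-- The matrix of the second differential is symmetric with respect to the swap. -/
theorem deriv_potentialRel_symm [Finite A] (hc : ∀ x y, Commute (lf x) (rt y))
    (hm : ∀ a, 3 ≤ T.len m a) (hτ : ∀ x y, τ (lf x * rt (op y)) = lf y * rt (op x)) (a a' : A) :
    deriv lf rt (T.potentialRel m c b a) a' = τ (deriv lf rt (T.potentialRel m c b a') a) := by
  have e1 : ∀ a, T.gProd (arrow K T.toArrowQuiver) (T.g a) (T.len m a - 1)
      = T.cut K (T.g a) (T.len m a - 1) := fun a =>
    (T.vertex_mul_gProd (T.g a) (by have := hm a; omega)).symm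
  simp only [potentialRel, map_sub, map_smul, Pi.sub_apply, Pi.smul_apply, e1]
  rw [deriv_f_mul_f_symm τ hc hτ, deriv_cube_symm τ hc hτ, deriv_cut_symm τ hc hm hτ]

end Symmetry

end TriangulationQuiver

/-! ### The radical of the enveloping algebra -/

section Swap

variable {K : Type*} [Field K] {L : Type*} [Ring L] [Algebra K L]

theorem envSwap_pow (z : Enveloping K L) (n : ℕ) : envSwap K (z ^ n) = envSwap K z ^ n := by
  induction n with
  | zero => rw [pow_zero, pow_zero]; rfl
  | succ n ih => rw [pow_succ, envSwap_mul, ih, pow_succ']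

theorem isNilpotent_envSwap {z : Enveloping K L} : IsNilpotent (envSwap K z) ↔ IsNilpotent z := by
  have key : ∀ z : Enveloping K L, IsNilpotent z → IsNilpotent (envSwap K z) := fun z ⟨n, hn⟩ =>
    ⟨n, by rw [← envSwap_pow, hn, map_zero]⟩
  exact ⟨fun h => by simpa using key _ h, key z⟩

end Swap

theorem isNilpotent_mul_swap {R : Type*} [Ring R] {x y : R} (h : IsNilpotent (x * y)) :
    IsNilpotent (y * x) := by
  obtain ⟨n, hn⟩ := h
  refine ⟨n + 1, ?_⟩
  have : ∀ n, (y * x) ^ (n + 1) = y * (x * y) ^ n * x := fun n => by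
    induction n with
    | zero => simp
    | succ n ih => rw [pow_succ, ih, pow_succ]; simp only [mul_assoc]
  rw [this, hn, mul_zero, zero_mul]

theorem mem_jacobson_of_isNilpotent {R : Type*} [Ring R] {x : R}
    (h : ∀ y, IsNilpotent (y * x)) : x ∈ Ring.jacobson R := by
  rw [← Ideal.jacobson_bot, Ideal.mem_jacobson_iff]
  intro y
  obtain ⟨u, hu⟩ := (h y).isUnit_one_add
  refine ⟨(u⁻¹ : Rˣ), ?_⟩
  have h1 : ((u⁻¹ : Rˣ) : R) * (1 + y * x) = 1 := by rw [← hu, Units.inv_mul]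
  rw [Ideal.mem_bot, ← h1]
  noncomm_ring

namespace PathAlgebra

variable {V A : Type*} {K : Type*} [Field K] {Q : ArrowQuiver V A} [Fintype V]

/-- By induction on n, a word of length at least N − n kills (r α)ⁿ from the left: moving through r,
whose right-hand factors commute past it, and absorbing α, the word becomes longer by at least one
arrow. The empty word gives n = N. -/
theorem mul_arrow_nilpotent {R : Type*} [Ring R] [Algebra K R] {lf : PathAlgebra K Q →ₐ[K] R}
    {rt : (PathAlgebra K Q)ᵐᵒᵖ →ₐ[K] R} (hc : ∀ x y, Commute (lf x) (rt y))
    (hs : ∀ P : R → Prop, (∀ x y, P x → P y → P (x + y)) → (∀ x y, P (lf x * rt (op y))) →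
      ∀ z, P z)
    {N : ℕ} (hN : ∀ l : List A, N ≤ l.length → lf (word K Q l) = 0) (a : A) (r : R) :
    IsNilpotent (r * lf (arrow K Q a)) := by
  have step : ∀ n z, (∀ l : List A, N ≤ l.length + n → lf (word K Q l) * z = 0) →
      ∀ l : List A, N ≤ l.length + (n + 1) →
        lf (word K Q l) * (r * lf (arrow K Q a) * z) = 0 := by
    intro n z hz l hl
    refine hs (fun r => lf (word K Q l) * (r * lf (arrow K Q a) * z) = 0)
      (fun x y hx hy => by rw [add_mul, add_mul, mul_add, hx, hy, add_zero]) (fun x y => ?_) r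
    have key : lf (word K Q l * x * arrow K Q a) * z = 0 := by
      clear r
      induction x using mul_induction generalizing l with
      | zero => simp
      | add x y hx hy => rw [mul_add, add_mul, map_add, add_mul, hx l hl, hy l hl, add_zero]
      | smul k x hx =>
        rw [mul_smul_comm, smul_mul_assoc, map_smul, smul_mul_assoc, hx l hl, smul_zero]
      | vert i =>
        by_cases h : i = Q.src a
        · have := hz (l ++ [a]) (by rw [List.length_append, List.length_singleton]; omega)
          rwa [word_append, word_cons, word_nil, mul_one, ← vertex_src_mul, ← h, ← mul_assoc]
            at this
        · rw [mul_assoc, vertex_mul_arrow_ne K Q h, mul_zero, map_zero, zero_mul]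
      | mul a' x hx =>
        have := hx (l ++ [a']) (by rw [List.length_append, List.length_singleton]; omega)
        rwa [word_append, word_cons, word_nil, mul_one, mul_assoc (word K Q l)] at this
    have : lf (word K Q l) * (lf x * rt (op y) * lf (arrow K Q a) * z)
        = rt (op y) * (lf (word K Q l * x * arrow K Q a) * z) := by
      have e1 : lf x * rt (op y) * lf (arrow K Q a) = rt (op y) * (lf x * lf (arrow K Q a)) := by
        rw [(hc _ _).eq, mul_assoc]
      rw [e1, mul_assoc, ← mul_assoc, (hc _ _).eq]
      simp only [map_mul, mul_assoc]
    rw [this, key, mul_zero]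
  refine ⟨N, ?_⟩
  have : ∀ n, ∀ l : List A, N ≤ l.length + n →
      lf (word K Q l) * (r * lf (arrow K Q a)) ^ n = 0 := fun n => by
    induction n with
    | zero => intro l hl; rw [hN l hl, zero_mul]
    | succ n ih => intro l hl; rw [pow_succ']; exact step n _ ih l hl
  simpa using this N [] (by simp)

end PathAlgebra

namespace TriangulationQuiver

open PathAlgebra

variable {V A : Type*} {T : TriangulationQuiver V A} {K : Type*} [Field K] [Fintype V]
  {m : T.GOrbit → ℕ+} {c : T.GOrbit → Kˣ} {b : T.border → K}
  {L : Type*} [Ring L] [Algebra K L] {q : PathAlgebra K T.toArrowQuiver →ₐ[K] L}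

theorem Relations.exists_word_eq_zero [Finite A]
    (h : T.Relations m c b fun a => q (arrow K T.toArrowQuiver a)) :
    ∃ N, ∀ l : List A, N ≤ l.length → q (word K T.toArrowQuiver l) = 0 := by
  obtain ⟨N, hN⟩ := h.exists_nilpotent
  refine ⟨N, fun l hl => ?_⟩
  have h1 : q (word K T.toArrowQuiver l) = (l.map fun a => q (arrow K T.toArrowQuiver a)).prod := by
    rw [word, map_list_prod, List.map_map]; rfl
  by_cases hch : l.IsChain fun x y => T.tgt x = T.src y
  · rw [h1, hN l hl hch]
  · cases l with
    | nil => exact absurd List.isChain_nil hch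
    | cons a l =>
      rcases word_cons_eq K T.toArrowQuiver a l with h2 | h2
      · exact absurd h2.1 hch
      · rw [h2.2, map_zero]

theorem Relations.envLeft_arrow_nilpotent [Finite A] (hq : Function.Surjective q)
    (h : T.Relations m c b fun a => q (arrow K T.toArrowQuiver a)) (a : A) (r : Enveloping K L) :
    IsNilpotent (r * envLeft q (arrow K T.toArrowQuiver a)) := by
  obtain ⟨N, hN⟩ := h.exists_word_eq_zero
  refine mul_arrow_nilpotent (env_commute q) (fun P hadd hpure z => env_induction hq hadd hpure z)
    (fun l hl => ?_) a r (N := N)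
  rw [envLeft_apply, hN l hl, TensorProduct.zero_tmul]

theorem envSwap_envLeft (x : PathAlgebra K T.toArrowQuiver) :
    envSwap K (envLeft q x) = envRight q (op x) := rfl

theorem envSwap_envRight (x : PathAlgebra K T.toArrowQuiver) :
    envSwap K (envRight q (op x)) = envLeft q x := rfl

theorem envSwap_pure (x y : PathAlgebra K T.toArrowQuiver) :
    envSwap K (envLeft q x * envRight q (op y)) = envLeft q y * envRight q (op x) := by
  rw [envSwap_mul]; rfl

theorem Relations.envLeft_arrow_mem_jacobson [Finite A] (hq : Function.Surjective q)
    (h : T.Relations m c b fun a => q (arrow K T.toArrowQuiver a)) (a : A) :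
    envLeft q (arrow K T.toArrowQuiver a) ∈ Ring.jacobson (Enveloping K L) :=
  mem_jacobson_of_isNilpotent (h.envLeft_arrow_nilpotent hq a)

/-- The swap exchanges the two actions but reverses products, so nilpotency is transferred through
the fact that xy and yx are nilpotent together. -/
theorem Relations.envRight_arrow_mem_jacobson [Finite A] (hq : Function.Surjective q)
    (h : T.Relations m c b fun a => q (arrow K T.toArrowQuiver a)) (a : A) :
    envRight q (op (arrow K T.toArrowQuiver a)) ∈ Ring.jacobson (Enveloping K L) :=
  mem_jacobson_of_isNilpotent fun y => by
    rw [← isNilpotent_envSwap, envSwap_mul, envSwap_envRight]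
    exact isNilpotent_mul_swap (h.envLeft_arrow_nilpotent hq a _)

/-! ### Characters -/

section Characters

variable {φ : L →ₗ[K] K}

/-- Arrows kill the socle element and vertices fix or kill it, so it spans a one-dimensional left
ideal; φ reads off the scalar because φ is 1 on it. -/
theorem Relations.mul_socle [Finite A] (hq : Function.Surjective q)
    (hφ : ∀ x, φ (q x) = T.socleForm m c b x)
    (h : T.Relations m c b fun a => q (arrow K T.toArrowQuiver a)) (i : V) (x : L) :
    x * T.socle m c q i = φ (x * T.socle m c q i) • T.socle m c q i := by
  obtain ⟨x, rfl⟩ := hq x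
  induction x using mul_induction with
  | zero => simp
  | add x y hx hy => rw [map_add, add_mul, map_add, add_smul, ← hx, ← hy]
  | smul k x hx => rw [map_smul, smul_mul_assoc, map_smul, smul_assoc, ← hx]
  | vert j =>
    by_cases hij : j = i
    · rw [hij, vertex_mul_socle h.three_le, form_socle h.three_le hφ, one_smul]
    · rw [vertex_mul_socle_ne h.three_le hij, map_zero, zero_smul]
  | mul a x hx =>
    rw [map_mul, mul_assoc, hx, mul_smul_comm, h.arrow_mul_socle, smul_zero, map_zero, zero_smul]

/-- The character of the algebra at a vertex, given by its action on the socle element. -/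
noncomputable def Relations.char [Finite A] (hq : Function.Surjective q)
    (hφ : ∀ x, φ (q x) = T.socleForm m c b x)
    (h : T.Relations m c b fun a => q (arrow K T.toArrowQuiver a)) (i : V) : L →ₐ[K] K :=
  AlgHom.ofLinearMap (φ ∘ₗ LinearMap.mulRight K (T.socle m c q i))
    (by simp [form_socle h.three_le hφ])
    (fun x y => by
      change φ (x * y * _) = φ (x * _) * φ (y * _)
      rw [mul_assoc, h.mul_socle hq hφ i y, mul_smul_comm, map_smul, map_smul, form_socle h.three_le hφ]
      simp [mul_comm])

variable [Finite A] (hq : Function.Surjective q) (hφ : ∀ x, φ (q x) = T.socleForm m c b x)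
    (h : T.Relations m c b fun a => q (arrow K T.toArrowQuiver a))

theorem Relations.char_apply (i : V) (x : L) : h.char hq hφ i x = φ (x * T.socle m c q i) := rfl

theorem Relations.char_arrow (i : V) (a : A) :
    h.char hq hφ i (q (arrow K T.toArrowQuiver a)) = 0 := by
  rw [char_apply, h.arrow_mul_socle, map_zero]

theorem Relations.char_vertex (i : V) : h.char hq hφ i (q (vertex K T.toArrowQuiver i)) = 1 := by
  rw [char_apply, vertex_mul_socle h.three_le, form_socle h.three_le hφ]

theorem Relations.char_vertex_ne {i j : V} (hij : j ≠ i) :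
    h.char hq hφ i (q (vertex K T.toArrowQuiver j)) = 0 := by
  rw [char_apply, vertex_mul_socle_ne h.three_le hij, map_zero]

theorem Relations.char_socle (i j : V) : h.char hq hφ i (T.socle m c q j) = 0 := by
  have h3 := h.three_le (T.outArrow j)
  obtain ⟨l, hl⟩ := Nat.exists_eq_add_of_le' (show 1 ≤ T.len m (T.outArrow j) by omega)
  rw [socle, hl, gProd_succ, map_smul, map_mul, map_mul, char_arrow, zero_mul, smul_zero]

/-- The character of the enveloping algebra at a pair of vertices. -/
noncomputable def Relations.envChar (i j : V) : Enveloping K L →ₐ[K] K :=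
  Algebra.TensorProduct.lift (h.char hq hφ i)
    ((h.char hq hφ j).fromOpposite fun _ _ => Commute.all _ _) fun _ _ => Commute.all _ _

theorem Relations.envChar_tmul (i j : V) (x y : L) :
    h.envChar hq hφ i j (x ⊗ₜ op y) = h.char hq hφ i x * h.char hq hφ j y := rfl

theorem Relations.envChar_pure (i j : V) (x y : PathAlgebra K T.toArrowQuiver) :
    h.envChar hq hφ i j (envLeft q x * envRight q (op y))
      = h.char hq hφ i (q x) * h.char hq hφ j (q y) := by
  rw [envLeft_mul_envRight, envChar_tmul]

/-- Multiplying by a socle element before contracting turns φ into the character at i on the first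
factor. -/
theorem Relations.envChar_contract (i j : V) (z : Enveloping K L) :
    h.char hq hφ j (contract φ (z * (T.socle m c q i ⊗ₜ op 1))) = h.envChar hq hφ i j z := by
  induction z using TensorProduct.induction_on with
  | zero => simp
  | add x y hx hy => rw [add_mul, map_add, map_add, map_add, hx, hy]
  | tmul x y =>
    rw [Algebra.TensorProduct.tmul_mul_tmul, MulOpposite.op_one, mul_one, contract_tmul, map_smul,
      ← MulOpposite.op_unop y, envChar_tmul, Relations.char_apply hq hφ h i]
    rfl

/-- For an inner invariant, the socle element can be moved to the second factor, where the character
at j kills it. -/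
theorem Relations.envChar_innerInvariants (i j : V) {z : Enveloping K L}
    (hz : z ∈ innerInvariants K L) : h.envChar hq hφ i j z = 0 := by
  rw [← envChar_contract, hz, contract_mul_right, map_mul, char_socle, zero_mul]

/-- Modulo the radical only the vertex idempotents remain, with the characters as coordinates. Hence
an element killed by all of these characters lies in the radical. -/
theorem Relations.sub_sum_envChar_mem_jacobson (z : Enveloping K L) :
    z - ∑ i, ∑ j, h.envChar hq hφ i j z • idem (envLeft q) (envRight q) i j
      ∈ Ring.jacobson (Enveloping K L) := by
  have hl : ∀ x, envLeft q x - ∑ i, h.char hq hφ i (q x) • envLeft q (vertex K T.toArrowQuiver i)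
      ∈ Ring.jacobson (Enveloping K L) := fun x => by
    induction x using mul_induction with
    | zero => simp
    | add x y hx hy =>
      have := add_mem hx hy
      simp only [map_add, add_smul, Finset.sum_add_distrib]
      convert this using 1
      abel
    | smul k x hx =>
      have := Ideal.mul_mem_left _ (algebraMap K (Enveloping K L) k) hx
      rw [← Algebra.smul_def, smul_sub, Finset.smul_sum] at this
      simpa only [map_smul, smul_eq_mul, mul_smul] using this
    | vert j =>
      rw [Finset.sum_eq_single j (fun i _ hi => by
        rw [h.char_vertex_ne hq hφ hi.symm, zero_smul]) (by simp), char_vertex, one_smul, sub_self]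
      exact zero_mem _
    | mul a x hx =>
      simp only [map_mul, char_arrow, zero_mul, zero_smul, Finset.sum_const_zero, sub_zero]
      exact Ideal.mul_mem_right _ _ (h.envLeft_arrow_mem_jacobson hq a)
  have hr : ∀ x, envRight q (op x)
      - ∑ i, h.char hq hφ i (q x) • envRight q (op (vertex K T.toArrowQuiver i))
      ∈ Ring.jacobson (Enveloping K L) := fun x => by
    induction x using mul_induction with
    | zero => simp
    | add x y hx hy =>
      have := add_mem hx hy
      simp only [map_add, MulOpposite.op_add, add_smul, Finset.sum_add_distrib]
      convert this using 1
      abel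
    | smul k x hx =>
      have := Ideal.mul_mem_left _ (algebraMap K (Enveloping K L) k) hx
      rw [← Algebra.smul_def, smul_sub, Finset.smul_sum] at this
      simpa only [map_smul, MulOpposite.op_smul, smul_eq_mul, mul_smul] using this
    | vert j =>
      rw [Finset.sum_eq_single j (fun i _ hi => by
        rw [h.char_vertex_ne hq hφ hi.symm, zero_smul]) (by simp), char_vertex, one_smul, sub_self]
      exact zero_mem _
    | mul a x hx =>
      simp only [map_mul, MulOpposite.op_mul, char_arrow, zero_mul, zero_smul,
        Finset.sum_const_zero, sub_zero]
      exact Ideal.mul_mem_left _ _ (h.envRight_arrow_mem_jacobson hq a)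
  induction z using env_induction hq with
  | add x y hx hy =>
    have := add_mem hx hy
    simp only [map_add, add_smul, Finset.sum_add_distrib]
    convert this using 1
    abel
  | pure x y =>
    have h1 := Ideal.mul_mem_right (envRight q (op y)) _ (hl x)
    have h2 := Ideal.mul_mem_left _
      (∑ i, h.char hq hφ i (q x) • envLeft q (vertex K T.toArrowQuiver i)) (hr y)
    have h3 := add_mem h1 h2
    convert h3 using 1
    have h4 : ∑ i, ∑ j, h.envChar hq hφ i j (envLeft q x * envRight q (op y))
          • idem (envLeft q) (envRight q) i j
        = (∑ i, h.char hq hφ i (q x) • envLeft q (vertex K T.toArrowQuiver i))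
          * ∑ i, h.char hq hφ i (q y) • envRight q (op (vertex K T.toArrowQuiver i)) := by
      rw [Finset.sum_mul_sum]
      refine Finset.sum_congr rfl fun i _ => Finset.sum_congr rfl fun j _ => ?_
      rw [envChar_pure, idem, smul_mul_smul_comm]
    rw [h4, sub_mul, mul_sub]
    abel

theorem Relations.innerInvariants_le_jacobson {z : Enveloping K L} (hq : Function.Surjective q)
    (hφ : ∀ x, φ (q x) = T.socleForm m c b x)
    (h : T.Relations m c b fun a => q (arrow K T.toArrowQuiver a))
    (hz : z ∈ innerInvariants K L) : z ∈ Ring.jacobson (Enveloping K L) := by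
  have := h.sub_sum_envChar_mem_jacobson hq hφ z
  simp only [h.envChar_innerInvariants hq hφ _ _ hz, zero_smul, Finset.sum_const_zero,
    sub_zero] at this
  exact this

end Characters

end TriangulationQuiver

/-! ### The minimal bimodule resolution -/

section IdemMap

variable {R : Type*} [Ring R] {ι κ μ : Type*} [Fintype ι]

/-- Arbitrary coefficients z may be cut down by the idempotents ε without changing the image, since
the rows of D absorb them on the left. -/
theorem exists_idemMap_eq {ε : ι → R} {ε' : κ → R} (hε : ∀ k, ε k * ε k = ε k) {D : ι → κ → R}
    (hD : ∀ k l, D k l * ε' l = D k l) (hD' : ∀ k l, ε k * D k l = D k l) (y : idemModule ε')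
    (z : ι → R) (h : ∀ l, y.1 l = ∑ k, z k * D k l) : ∃ x, idemMap ε ε' D hD x = y :=
  ⟨idemProj ε hε z, Subtype.ext (funext fun l => by
    rw [idemMap_apply, h]
    refine Finset.sum_congr rfl fun k _ => ?_
    change z k * ε k * D k l = _
    rw [mul_assoc, hD'])⟩

theorem idemMap_idemMap [Fintype κ] {ε : ι → R} {ε' : κ → R} {ε'' : μ → R} {D : ι → κ → R} {D' : κ → μ → R}
    (hD : ∀ k l, D k l * ε' l = D k l) (hD' : ∀ k l, D' k l * ε'' l = D' k l)
    (h : ∀ k l, ∑ j, D k j * D' j l = 0) (x : idemModule ε) :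
    idemMap ε' ε'' D' hD' (idemMap ε ε' D hD x) = 0 := by
  refine Subtype.ext (funext fun l => ?_)
  rw [idemMap_apply]
  simp only [idemMap_apply, Finset.sum_mul, mul_assoc]
  rw [Finset.sum_comm]
  simp only [← Finset.mul_sum, h, mul_zero, Finset.sum_const_zero]
  rfl

end IdemMap

namespace TriangulationQuiver

open PathAlgebra

variable {V A : Type*} {T : TriangulationQuiver V A} {K : Type*} [Field K] [Fintype V]
  {m : T.GOrbit → ℕ+} {c : T.GOrbit → Kˣ} {b : T.border → K}
  {L : Type*} [Ring L] [Algebra K L] {q : PathAlgebra K T.toArrowQuiver →ₐ[K] L}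

theorem envSwap_idem (i j : V) : envSwap K (idem (envLeft q) (envRight q) i j)
    = idem (envLeft q) (envRight q) j i := envSwap_pure _ _

theorem envSwap_diagIdem : envSwap K (diagIdem (envLeft q) (envRight q))
    = diagIdem (envLeft q) (envRight q) := by
  simp only [diagIdem, map_sum, envSwap_idem]

theorem diagIdem_smul_one : diagIdem (envLeft q) (envRight q) • (1 : L) = 1 := by
  have h1 : ∀ i, idem (envLeft q) (envRight q) i i • (1 : L) = q (vertex K T.toArrowQuiver i) :=
    fun i => by rw [idem, env_smul_one, vertex_mul_self]
  rw [diagIdem, Finset.sum_smul]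
  simp only [h1]
  rw [← map_sum, sum_vertex, map_one]

theorem arrowDiff_smul_one (a : A) : arrowDiff (envLeft q) (envRight q) a • (1 : L) = 0 := by
  have h1 := env_smul_one (q := q) (arrow K T.toArrowQuiver a) (vertex K T.toArrowQuiver (T.tgt a))
  have h2 := env_smul_one (q := q) (vertex K T.toArrowQuiver (T.src a)) (arrow K T.toArrowQuiver a)
  rw [arrow_mul_vertex] at h1
  rw [vertex_src_mul] at h2
  rw [arrowDiff, sub_smul, h1, h2, sub_self]

variable (q) in
/-- The first term of the resolution. -/
noncomputable def augmentation :
    idemModule (fun _ : Unit => diagIdem (envLeft q) (envRight q)) →ₗ[Enveloping K L] L :=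
  LinearMap.toSpanSingleton (Enveloping K L) L 1 ∘ₗ LinearMap.proj () ∘ₗ Submodule.subtype _

theorem augmentation_apply (x : idemModule fun _ : Unit => diagIdem (envLeft q) (envRight q)) :
    augmentation q x = x.1 () • (1 : L) := rfl

theorem augmentation_surjective : Function.Surjective (augmentation q) := fun x => by
  refine ⟨⟨fun _ => (x ⊗ₜ op 1) * diagIdem (envLeft q) (envRight q), fun _ => ?_⟩, ?_⟩
  · rw [mul_assoc, diagIdem_mul_self (env_commute q)]
  · rw [augmentation_apply]
    change ((x ⊗ₜ op 1) * diagIdem (envLeft q) (envRight q)) • (1 : L) = x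
    rw [mul_smul, diagIdem_smul_one, Enveloping.tmul_smul, mul_one, mul_one]

/-- Inner invariance need only be tested on vertices, which gives invariance under the diagonal
idempotent, and on arrows, which gives the transposed first differential. This describes the kernel
of P₀ → P₂. -/
theorem mem_innerInvariants_iff (hq : Function.Surjective q) (z : Enveloping K L) :
    z ∈ innerInvariants K L ↔ z * diagIdem (envLeft q) (envRight q) = z ∧
      ∀ a, z * envSwap K (arrowDiff (envLeft q) (envRight q) a) = 0 := by
  have hd : ∀ a, envSwap K (arrowDiff (envLeft q) (envRight q) a)
      = diagIdem (envLeft q) (envRight q) * (envRight q (op (arrow K T.toArrowQuiver a))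
        - envLeft q (arrow K T.toArrowQuiver a)) := fun a => by
    rw [arrowDiff_eq (env_commute q), envSwap_mul, envSwap_diagIdem, map_sub, envSwap_envLeft,
      envSwap_envRight]
  have hv : ∀ i, diagIdem (envLeft q) (envRight q) * (envRight q (op (vertex K T.toArrowQuiver i))
        - envLeft q (vertex K T.toArrowQuiver i)) = 0 := fun i => by
    have := congrArg (envSwap K) (sub_mul_diagIdem_vertex (env_commute q) i)
    rwa [envSwap_mul, envSwap_diagIdem, map_sub, envSwap_envLeft, envSwap_envRight, map_zero]
      at this
  have hz : z ∈ innerInvariants K L ↔ ∀ x, z * envLeft q x = z * envRight q (op x) :=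
    ⟨fun h x => h (q x), fun h x => by obtain ⟨x, rfl⟩ := hq x; exact h x⟩
  rw [hz]
  constructor
  · intro h
    have h0 : z * diagIdem (envLeft q) (envRight q) = z := by
      have h1 : ∀ i, z * idem (envLeft q) (envRight q) i i
          = z * envRight q (op (vertex K T.toArrowQuiver i)) := fun i => by
        rw [idem, ← mul_assoc, h, mul_assoc, rt_mul, vertex_mul_self]
      rw [diagIdem, Finset.mul_sum]
      simp only [h1]
      rw [← Finset.mul_sum, ← map_sum, ← Finset.op_sum, sum_vertex, MulOpposite.op_one, map_one,
        mul_one]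
    exact ⟨h0, fun a => by rw [hd, ← mul_assoc, h0, mul_sub, h, sub_self]⟩
  · rintro ⟨h0, h1⟩ x
    induction x using mul_induction with
    | zero => simp
    | add x y hx hy => rw [map_add, MulOpposite.op_add, map_add, mul_add, mul_add, hx, hy]
    | smul k x hx =>
      rw [map_smul, MulOpposite.op_smul, map_smul, mul_smul_comm, mul_smul_comm, hx]
    | vert i =>
      have := congrArg (z * ·) (hv i)
      simp only [mul_zero] at this
      rw [← mul_assoc, h0, mul_sub, sub_eq_zero] at this
      exact this.symm
    | mul a x hx =>
      have := h1 a
      rw [hd, ← mul_assoc, h0, mul_sub, sub_eq_zero] at this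
      rw [map_mul, ← mul_assoc, ← this, mul_assoc, ← (env_commute q _ _).eq, ← mul_assoc, hx,
        mul_assoc, rt_mul]

variable (T q)

/-- The idempotents of the second term of the resolution. -/
noncomputable def arrowIdem (a : A) : Enveloping K L :=
  idem (envLeft q) (envRight q) (T.src a) (T.tgt a)

/-- The idempotents of the third term of the resolution. -/
noncomputable def relIdem (a : A) : Enveloping K L :=
  idem (envLeft q) (envRight q) (T.tgt a) (T.src a)

variable (m c b) in
/-- The matrix of the second differential. -/
noncomputable def relMatrix (a a' : A) : Enveloping K L :=
  deriv (envLeft q) (envRight q) (T.potentialRel m c b a) a'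

variable {T q}

theorem arrowIdem_mul_self (a : A) : T.arrowIdem q a * T.arrowIdem q a = T.arrowIdem q a :=
  idem_mul_self (env_commute q) _ _

theorem relIdem_mul_self (a : A) : T.relIdem q a * T.relIdem q a = T.relIdem q a :=
  idem_mul_self (env_commute q) _ _

theorem relMatrix_mul_arrowIdem (a a' : A) :
    T.relMatrix m c b q a a' * T.arrowIdem q a' = T.relMatrix m c b q a a' :=
  deriv_mul_idem (env_commute q) _ _

theorem envSwap_relMatrix [Finite A] (hm : ∀ a, 3 ≤ T.len m a) (a a' : A) :
    envSwap K (T.relMatrix m c b q a a') = T.relMatrix m c b q a' a :=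
  (deriv_potentialRel_symm (envSwap K) (env_commute q) hm envSwap_pure a' a).symm

theorem envSwap_arrowIdem (a : A) : envSwap K (T.arrowIdem q a) = T.relIdem q a :=
  envSwap_idem _ _

theorem envSwap_relIdem (a : A) : envSwap K (T.relIdem q a) = T.arrowIdem q a :=
  envSwap_idem _ _

theorem relIdem_mul_relMatrix [Finite A] (hm : ∀ a, 3 ≤ T.len m a) (a a' : A) :
    T.relIdem q a * T.relMatrix m c b q a a' = T.relMatrix m c b q a a' := by
  rw [← envSwap_relMatrix hm, ← envSwap_arrowIdem, ← envSwap_mul, relMatrix_mul_arrowIdem]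

theorem envSwap_arrowDiff_mul_relIdem (a : A) :
    envSwap K (arrowDiff (envLeft q) (envRight q) a) * T.relIdem q a
      = envSwap K (arrowDiff (envLeft q) (envRight q) a) := by
  rw [← envSwap_arrowIdem, ← envSwap_mul, arrowIdem, idem_mul_arrowDiff (env_commute q)]

theorem diagIdem_mul_envSwap_arrowDiff (a : A) :
    diagIdem (envLeft q) (envRight q) * envSwap K (arrowDiff (envLeft q) (envRight q) a)
      = envSwap K (arrowDiff (envLeft q) (envRight q) a) := by
  rw [← envSwap_diagIdem, ← envSwap_mul, arrowDiff_mul_diagIdem (env_commute q)]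

theorem Relations.sum_relMatrix_mul_arrowDiff [Fintype A]
    (h : T.Relations m c b fun a => q (arrow K T.toArrowQuiver a)) (a : A) :
    ∑ a', T.relMatrix m c b q a a' * arrowDiff (envLeft q) (envRight q) a' = 0 := by
  have h1 := sum_deriv_mul_arrowDiff (env_commute q) (T.potentialRel m c b a)
  rw [envLeft_apply, envRight_apply, map_potentialRel h, MulOpposite.op_zero,
    TensorProduct.zero_tmul, TensorProduct.tmul_zero, sub_zero, zero_mul] at h1
  exact h1

theorem Relations.sum_envSwap_arrowDiff_mul_relMatrix [Fintype A]
    (h : T.Relations m c b fun a => q (arrow K T.toArrowQuiver a)) (a : A) :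
    ∑ a', envSwap K (arrowDiff (envLeft q) (envRight q) a') * T.relMatrix m c b q a' a = 0 := by
  have := congrArg (envSwap K) (h.sum_relMatrix_mul_arrowDiff a)
  simpa only [map_sum, map_zero, envSwap_mul, envSwap_relMatrix h.three_le] using this

/-- Exactness at the second term. -/
theorem Relations.exact_relMatrix [Fintype A] (hq : Function.Surjective q)
    (hker : ∀ z, q z = 0 ↔ z ∈ T.relationIdeal K m c b)
    (h : T.Relations m c b fun a => q (arrow K T.toArrowQuiver a))
    (hns : ∀ a, ¬ (T.len m a = 3 ∧ T.len m (T.bar a) = 3 ∧ T.len m (T.f a) = 3 ∧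
      T.len m (T.f (T.bar a)) = 3))
    (x : A → Enveloping K L) (hx : ∀ a, x a * T.arrowIdem q a = x a)
    (h0 : ∑ a, x a * arrowDiff (envLeft q) (envRight q) a = 0) :
    ∃ y : A → Enveloping K L, ∀ a, x a = ∑ k, y k * T.relMatrix m c b q k a := by
  -- Finite dimension makes the enveloping algebra Noetherian, as the Nakayama argument in
  -- `span_deriv_eq` requires.
  have := h.finiteDimensional hq
  have : IsNoetherianRing (Enveloping K L) := isNoetherian_of_tower K inferInstance
  have hset : {z | q z = 0} = {z | z ∈ T.relationIdeal K m c b} := Set.ext hker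
  have h1 := env_mem_span_deriv hq x hx h0
  rw [hset] at h1
  have h2 := span_deriv_eq (envLeft q) (envRight q) (env_commute q)
    (fun z hz => by rw [envLeft_apply, (hker z).2 hz, TensorProduct.zero_tmul])
    (fun z hz => by
      rw [envRight_apply, (hker z).2 hz, MulOpposite.op_zero, TensorProduct.tmul_zero])
    (h.envLeft_arrow_mem_jacobson hq) (h.envRight_arrow_mem_jacobson hq)
    (fun a => (hker _).1 (map_potentialRel h a)) h.three_le hns h1
  obtain ⟨y, hy⟩ := (Submodule.mem_span_range_iff_exists_fun _).1 h2
  refine ⟨y, fun a => ?_⟩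
  rw [← hy, Finset.sum_apply]
  rfl

/-- Exactness at the third term. -/
theorem Relations.exact_envSwap_arrowDiff [Fintype A] {φ : L →ₗ[K] K}
    (hq : Function.Surjective q) (hker : ∀ z, q z = 0 ↔ z ∈ T.relationIdeal K m c b)
    (h : T.Relations m c b fun a => q (arrow K T.toArrowQuiver a))
    (hns : ∀ a, ¬ (T.len m a = 3 ∧ T.len m (T.bar a) = 3 ∧ T.len m (T.f a) = 3 ∧
      T.len m (T.f (T.bar a)) = 3))
    {ι : Type*} [Fintype ι] {e e' : ι → L} (hs : IsSymmetrizing φ e e')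
    (y : A → Enveloping K L) (hy : ∀ a, y a * T.relIdem q a = y a)
    (h0 : ∀ a, ∑ k, y k * T.relMatrix m c b q k a = 0) :
    ∃ z, ∀ a, y a = z * envSwap K (arrowDiff (envLeft q) (envRight q) a) := by
  -- Swapping turns the row y into a column, to which the transpose of the exact sequence P₂ → P₁ →
  -- P₀ applies; symmetry of the relation matrix turns the row equations into column equations.
  obtain ⟨z, hz⟩ := hs.enveloping.exact_transpose (T.arrowIdem q) arrowIdem_mul_self
    (T.relMatrix m c b q) (fun a (_ : Unit) => arrowDiff (envLeft q) (envRight q) a)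
    (fun a _ => idem_mul_arrowDiff (env_commute q) a)
    (fun x hx hx0 => h.exact_relMatrix hq hker hns x hx (hx0 ()))
    (fun a => envSwap K (y a))
    (fun a => by rw [← envSwap_relIdem, ← envSwap_mul, hy])
    (fun a => by
      have := congrArg (envSwap K) (h0 a)
      simpa only [map_sum, map_zero, envSwap_mul, envSwap_relMatrix h.three_le] using this)
  refine ⟨envSwap K (z ()), fun a => ?_⟩
  have := congrArg (envSwap K) (hz a)
  simpa only [envSwap_envSwap, Finset.univ_unique, Finset.sum_singleton, envSwap_mul] using this

/-! ### Entries in the radical -/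

theorem Relations.arrowDiff_mem_jacobson [Finite A] (hq : Function.Surjective q)
    (h : T.Relations m c b fun a => q (arrow K T.toArrowQuiver a)) (a : A) :
    arrowDiff (envLeft q) (envRight q) a ∈ Ring.jacobson (Enveloping K L) :=
  sub_mem (Ideal.mul_mem_right _ _ (h.envLeft_arrow_mem_jacobson hq a))
    (Ideal.mul_mem_left _ _ (h.envRight_arrow_mem_jacobson hq a))

theorem Relations.envSwap_arrowDiff_mem_jacobson [Finite A] (hq : Function.Surjective q)
    (h : T.Relations m c b fun a => q (arrow K T.toArrowQuiver a)) (a : A) :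
    envSwap K (arrowDiff (envLeft q) (envRight q) a) ∈ Ring.jacobson (Enveloping K L) := by
  rw [arrowDiff, map_sub, envSwap_pure, envSwap_pure]
  exact sub_mem (Ideal.mul_mem_left _ _ (h.envRight_arrow_mem_jacobson hq a))
    (Ideal.mul_mem_right _ _ (h.envLeft_arrow_mem_jacobson hq a))

theorem Relations.relMatrix_mem_jacobson [Finite A] (hq : Function.Surjective q)
    (h : T.Relations m c b fun a => q (arrow K T.toArrowQuiver a)) (a a' : A) :
    T.relMatrix m c b q a a' ∈ Ring.jacobson (Enveloping K L) := by
  have key : ∀ (d d' : A) (y : PathAlgebra K T.toArrowQuiver),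
      deriv (envLeft q) (envRight q) (arrow K T.toArrowQuiver d
        * (arrow K T.toArrowQuiver d' * y)) a' ∈ Ring.jacobson (Enveloping K L) := by
    intro d d' y
    rw [deriv_mul _ _ (env_commute q), Pi.add_apply, Pi.smul_apply, Pi.smul_apply,
      MulOpposite.op_mul, map_mul (envRight q)]
    exact add_mem (Ideal.mul_mem_right _ _ (h.envLeft_arrow_mem_jacobson hq d))
      (Ideal.mul_mem_right _ _ (Ideal.mul_mem_left _ _ (h.envRight_arrow_mem_jacobson hq d')))
  have hsmul : ∀ (k : K) {z : Enveloping K L}, z ∈ Ring.jacobson (Enveloping K L) →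
      k • z ∈ Ring.jacobson (Enveloping K L) := fun k z hz => by
    have := Ideal.mul_mem_left _ (algebraMap K (Enveloping K L) k) hz
    rwa [← Algebra.smul_def] at this
  obtain ⟨l, hl⟩ := Nat.exists_eq_add_of_le' (h.three_le a)
  rw [relMatrix, potentialRel, hl, show l + 3 - 1 = l + 1 + 1 from rfl, gProd_succ, gProd_succ,
    pow_succ', pow_succ', map_sub, map_sub, map_smul, map_smul]
  refine sub_mem (sub_mem ?_ (hsmul _ (key _ _ _))) (hsmul _ (key _ _ _))
  rw [← mul_one (arrow K T.toArrowQuiver (T.f (T.f a)))]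
  exact key _ _ _

end TriangulationQuiver

/-! ### Assembly of the resolution and the period -/

namespace TriangulationQuiver

open PathAlgebra

section Periodicity

universe v w

variable {V : Type*} {A : Type v} {T : TriangulationQuiver V A} {K : Type*} [Field K] [Fintype V]
  {m : T.GOrbit → ℕ+} {c : T.GOrbit → Kˣ} {b : T.border → K}
  {L : Type (max v w)} [Ring L] [Algebra K L] {q : PathAlgebra K T.toArrowQuiver →ₐ[K] L}

variable (T q) in
/-- The first differential of the resolution. -/
noncomputable def firstDifferential [Fintype A] :
    idemModule (T.arrowIdem q) →ₗ[Enveloping K L]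
      idemModule (fun _ : Unit => diagIdem (envLeft q) (envRight q)) :=
  idemMap _ _ (fun a _ => arrowDiff (envLeft q) (envRight q) a)
    fun a _ => arrowDiff_mul_diagIdem (env_commute q) a

variable (T m c b q) in
/-- The second differential of the resolution. -/
noncomputable def secondDifferential [Fintype A] :
    idemModule (T.relIdem q) →ₗ[Enveloping K L] idemModule (T.arrowIdem q) :=
  idemMap _ _ (T.relMatrix m c b q) relMatrix_mul_arrowIdem

variable (T q) in
/-- The last differential of the resolution. -/
noncomputable def lastDifferential :
    idemModule (fun _ : Unit => diagIdem (envLeft q) (envRight q)) →ₗ[Enveloping K L]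
      idemModule (T.relIdem q) :=
  idemMap _ _ (fun _ a => envSwap K (arrowDiff (envLeft q) (envRight q) a))
    fun _ a => envSwap_arrowDiff_mul_relIdem a

theorem lastDifferential_apply
    (x : idemModule fun _ : Unit => diagIdem (envLeft q) (envRight q)) (a : A) :
    (T.lastDifferential q x).1 a = x.1 () * envSwap K (arrowDiff (envLeft q) (envRight q) a) := by
  rw [lastDifferential, idemMap_apply, Finset.univ_unique, Finset.sum_singleton]

theorem mem_ker_lastDifferential (hq : Function.Surjective q)
    (x : idemModule fun _ : Unit => diagIdem (envLeft q) (envRight q)) :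
    x ∈ LinearMap.ker (T.lastDifferential q) ↔ x.1 () ∈ innerInvariants K L := by
  rw [mem_innerInvariants_iff hq, LinearMap.mem_ker]
  constructor
  · intro h
    refine ⟨x.2 (), fun a => ?_⟩
    rw [← lastDifferential_apply, h]
    rfl
  · intro h
    refine Subtype.ext (funext fun a => ?_)
    rw [lastDifferential_apply, h.2]
    rfl

/-- The kernel of the last differential consists of the inner invariants. -/
noncomputable def kerLastDifferentialEquiv (hq : Function.Surjective q) :
    LinearMap.ker (T.lastDifferential q) ≃ₗ[Enveloping K L] innerInvariants K L where
  toFun x := ⟨x.1.1 (), (mem_ker_lastDifferential hq x.1).1 x.2⟩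
  map_add' _ _ := rfl
  map_smul' _ _ := rfl
  invFun z := ⟨⟨fun _ => z.1, fun _ => ((mem_innerInvariants_iff hq z.1).1 z.2).1⟩,
    (mem_ker_lastDifferential hq _).2 z.2⟩
  left_inv _ := rfl
  right_inv _ := rfl

/-- A quotient of the path algebra by the ideal of relations is periodic of period four. -/
theorem Relations.isPeriodicModule [Finite A] (hq : Function.Surjective q)
    (hker : ∀ z, q z = 0 ↔ z ∈ T.relationIdeal K m c b)
    (h : T.Relations m c b fun a => q (arrow K T.toArrowQuiver a))
    (hns : ∀ a, ¬ (T.len m a = 3 ∧ T.len m (T.bar a) = 3 ∧ T.len m (T.f a) = 3 ∧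
      T.len m (T.f (T.bar a)) = 3))
    (hloop : ∃ a, T.src a ≠ T.tgt a) :
    IsSyzygy (Enveloping K L) 4 L L ∧ IsPeriodicModule (Enveloping K L) 4 L := by
  have := Fintype.ofFinite A
  obtain ⟨φ, hφ⟩ := exists_form T m c b h.three_le hq hker
  have hcomm : ∀ x y, φ (x * y) = φ (y * x) := fun x y => by
    obtain ⟨x, rfl⟩ := hq x
    obtain ⟨y, rfl⟩ := hq y
    rw [← map_mul, ← map_mul, hφ, hφ, T.socleForm_mul_comm c b h.three_le]
  have hfin := h.finiteDimensional hq
  obtain ⟨e, e', hs⟩ := exists_isSymmetrizing φ hcomm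
    (form_nondegenerate h.three_le hφ h hq hcomm)
  obtain ⟨a₀, ha₀⟩ := hloop
  have hε₀ : ∀ _ : Unit, diagIdem (envLeft q) (envRight q) * diagIdem (envLeft q) (envRight q)
      = diagIdem (envLeft q) (envRight q) := fun _ => diagIdem_mul_self (env_commute q)
  have hε₁ : ∀ a, T.arrowIdem q a * T.arrowIdem q a = T.arrowIdem q a := arrowIdem_mul_self
  have hε₂ : ∀ a, T.relIdem q a * T.relIdem q a = T.relIdem q a := relIdem_mul_self
  have := idemModule_projective _ hε₀
  have := idemModule_projective _ hε₁
  have := idemModule_projective _ hε₂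
  have := idemModule_finite _ hε₀
  have := idemModule_finite _ hε₁
  have := idemModule_finite _ hε₂
  -- A character at two distinct vertices kills every e_k ⊗ e_k. Taken at the ends of an arrow that
  -- is not a loop, in either order, it separates P₀ from P₁ and from P₂.
  have hχ : ∀ i j, i ≠ j → ∀ _ : Unit,
      h.envChar hq hφ i j (diagIdem (envLeft q) (envRight q)) = 0 := fun i j hij _ => by
    rw [diagIdem, map_sum]
    refine Finset.sum_eq_zero fun k _ => ?_
    rw [idem, envChar_pure]
    by_cases hk : k = i
    · rw [h.char_vertex_ne hq hφ (fun hkj => hij (hk.symm.trans hkj)), mul_zero]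
    · rw [h.char_vertex_ne hq hφ hk, zero_mul]
  have hχ' : ∀ i j, h.envChar hq hφ i j (idem (envLeft q) (envRight q) i j) = 1 := fun i j => by
    rw [idem, envChar_pure, char_vertex, char_vertex, one_mul]
  have n₁ := isEmpty_idemModule_equiv _ _ hε₀ hε₁
    (h.envChar hq hφ (T.src a₀) (T.tgt a₀)).toRingHom (hχ _ _ ha₀) a₀ (hχ' _ _)
  have n₂ := isEmpty_idemModule_equiv _ _ hε₀ hε₂
    (h.envChar hq hφ (T.tgt a₀) (T.src a₀)).toRingHom (hχ _ _ ha₀.symm) a₀ (hχ' _ _)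
  have r₀ : LinearMap.range (T.firstDifferential q) ≤ Module.jacobson (Enveloping K L)
      (idemModule fun _ : Unit => diagIdem (envLeft q) (envRight q)) :=
    range_idemMap_le_jacobson _ _ hε₀ _ _ fun a _ => h.arrowDiff_mem_jacobson hq a
  have r₁ : LinearMap.range (T.secondDifferential m c b q)
      ≤ Module.jacobson (Enveloping K L) (idemModule (T.arrowIdem q)) :=
    range_idemMap_le_jacobson _ _ hε₁ _ _ (h.relMatrix_mem_jacobson hq)
  have r₂ : LinearMap.range (T.lastDifferential q)
      ≤ Module.jacobson (Enveloping K L) (idemModule (T.relIdem q)) :=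
    range_idemMap_le_jacobson _ _ hε₂ _ _ fun _ a => h.envSwap_arrowDiff_mem_jacobson hq a
  have r₃ : LinearMap.ker (T.lastDifferential q) ≤ Module.jacobson (Enveloping K L)
      (idemModule fun _ : Unit => diagIdem (envLeft q) (envRight q)) := fun x hx =>
    mem_jacobson_idemModule _ hε₀ x fun _ =>
      h.innerInvariants_le_jacobson hq hφ ((mem_ker_lastDifferential hq x).1 hx)
  refine isPeriodicModule_four (R := Enveloping K L) (M := L)
    (P₀ := idemModule fun _ : Unit => diagIdem (envLeft q) (envRight q))
    (P₁ := idemModule (T.arrowIdem q)) (P₂ := idemModule (T.relIdem q))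
    (P₃ := idemModule fun _ : Unit => diagIdem (envLeft q) (envRight q))
    (augmentation q) (T.firstDifferential q) (T.secondDifferential m c b q) (T.lastDifferential q)
    augmentation_surjective (fun x => ?_) (fun y hy => ?_) (fun x => ?_) (fun y hy => ?_)
    (fun x => ?_) (fun y hy => ?_)
    ((kerLastDifferentialEquiv hq).trans hs.innerInvariantsEquiv) r₀ r₁ r₂ r₃ n₁ n₂
  · rw [augmentation_apply, firstDifferential, idemMap_apply, Finset.sum_smul]
    refine Finset.sum_eq_zero fun a _ => ?_
    rw [mul_smul, arrowDiff_smul_one]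
    exact smul_zero _
  · obtain ⟨z, hz⟩ := (Submodule.mem_span_range_iff_exists_fun _).1
      (mem_span_arrowDiff_of_smul_one hq (y.1 ()) (y.2 ()) hy)
    exact exists_idemMap_eq hε₁ _ (fun a _ => idem_mul_arrowDiff (env_commute q) a) y z
      fun _ => hz.symm
  · exact idemMap_idemMap _ _ (fun a _ => h.sum_relMatrix_mul_arrowDiff a) x
  · obtain ⟨z, hz⟩ := h.exact_relMatrix hq hker hns y.1 y.2 (congrFun (congrArg Subtype.val hy) ())
    exact exists_idemMap_eq hε₂ _ (relIdem_mul_relMatrix h.three_le) y z hz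
  · exact idemMap_idemMap _ _ (fun _ a => h.sum_envSwap_arrowDiff_mul_relMatrix a) x
  · obtain ⟨z, hz⟩ := h.exact_envSwap_arrowDiff hq hker hns hs y.1 y.2
      (fun a => congrFun (congrArg Subtype.val hy) a)
    refine exists_idemMap_eq hε₀ _ (fun _ a => diagIdem_mul_envSwap_arrowDiff a) y (fun _ => z)
      fun a => ?_
    rw [hz, Finset.univ_unique, Finset.sum_singleton]

end Periodicity

end TriangulationQuiver

theorem theorem9p4 {K V A : Type*} [Field K] [IsAlgClosed K] [CharP K 2]
    [Fintype V] [Finite A] (T : TriangulationQuiver V A) (hV : 3 ≤ Fintype.card V)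
    (hborder : T.border.Nonempty)
    (m : T.GOrbit → ℕ+) (c : T.GOrbit → Kˣ) (b : T.border → K) (hb : b ≠ 0)
    (hmn : ∀ a : A, 3 ≤ (m (T.orbit a) : ℕ) * T.n a) :
    IsSyzygy (Enveloping K (T.SocleDeformedAlgebra K m c b)) 4
        (T.SocleDeformedAlgebra K m c b) (T.SocleDeformedAlgebra K m c b) ∧
      IsPeriodicAlgebra K (T.SocleDeformedAlgebra K m c b) 4 := by
  have hq := RingCon.mkₐ_surjective (α := K) (T.relationIdeal K m c b).ringCon
  have hker : ∀ z, RingCon.mkₐ K (T.relationIdeal K m c b).ringCon z = 0 ↔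
      z ∈ T.relationIdeal K m c b := fun z => mkₐ_eq_zero_iff
  have h := T.relations_of_map c b _ hmn fun r hr =>
    (hker r).2 (TwoSidedIdeal.subset_span hr)
  have key := h.isPeriodicModule hq hker (T.not_len_eq_three m hV hborder) (T.exists_src_ne_tgt hV)
  exact ⟨key.1, h.finiteDimensional hq, key.2⟩
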